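/- **Setting.** A finite discounted MDP $M=(\mathcal S,\mathcal A,T,R,\gamma)$ has $S=|\mathcal S|\ge 1$ states, $A=|\mathcal A|\ge 1$ actions, transition distributions $T(\cdot\mid s,a)$, reward distributions $R(\cdot\mid s,a)$ supported in $[0,1]$, and a discount factor $\gamma\in[0,1)$. A policy assigns to every history $h_t=(s_0,a_0,r_0,\dots,a_{t-1},r_{t-1},s_t)$ a probability distribution over actions; when it is followed, $a_t$ is drawn from it and then $r_t\sim R(\cdot\mid s_t,a_t)$, $s_{t+1}\sim T(\cdot\mid s_t,a_t)$ independently. For an algorithm (policy) $\mathfrak A$ let $V^{\mathfrak A_t}_M(s_t)=\mathbb E\big[\sum_{k\ge0}\gamma^k r_{t+k}\mid h_t\big]$, and let $V^*_M(s)$ be the supremum over all policies of the expected discounted return from the initial state $s$. **Directed Delayed Q-learning**, with inputs $\gamma,\varepsilon_1,m,\lambda,\rho,\gamma_E,\eta$. Initially, for all $(s,a)$: $Q(s,a)=1/(1-\gamma)$, $E(s,a)=1-\varepsilon_1$, $\tilde Q(s,a)=\tilde E(s,a)=0$, $n(s,a)=b(s,a)=0$, $LEARN(s,a)=\text{true}$;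 and $t^*=0$. Write $Q'(s,a)=Q(s,a)+\lambda/\sqrt{\log_\eta E(s,a)}$. At each time $t=1,2,\dots$, in the current state $s$, take an action $a\in\arg\max_{a'}Q'(s,a')$ (ties broken in any way, possibly at random and depending on the history) and observe $r$ and $s'$. If $b(s,a)\le t^*$, set $LEARN(s,a)\leftarrow$ true. Then, if $LEARN(s,a)$ is true: 1. $n(s,a)\leftarrow n(s,a)+1$ and, with $\alpha=1/n(s,a)$, $\tilde Q(s,a)\leftarrow(1-\alpha)\tilde Q(s,a)+\alpha\,(r+\gamma\max_{a'}Q(s',a'))$ and $\tilde E(s,a)\leftarrow(1-\alpha)\tilde E(s,a)+\alpha\,\gamma_E\max_{a'}E(s',a')$. 2. If $Q'(s,a)-\Big(\tilde Q(s,a)+\frac{\rho}{\sqrt{n(s,a)}}+\frac{\lambda}{\sqrt{\log_\eta\tilde E(s,a)}}\Big)\ge\varepsilon_1$: set $Q(s,a)\leftarrow\tilde Q(s,a)+\rho/\sqrt{n(s,a)}$, $E(s,a)\leftarrow\tilde E(s,a)$, $t^*\leftarrow t$, and then $n(s,a),\tilde Q(s,a),\tilde E(s,a)\leftarrow0$,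 $b(s,a)\leftarrow t$. 3. Otherwise, if $n(s,a)=m$: if $b(s,a)>t^*$, set $LEARN(s,a)\leftarrow$ false; and then $n(s,a),\tilde Q(s,a),\tilde E(s,a)\leftarrow0$, $b(s,a)\leftarrow t$. **Theorem 1.** Directed Delayed Q-learning is PAC-MDP: there is a universal constant $C>0$ such that the following holds. For all $S,A$, $\gamma\in[0,1)$ and $\varepsilon,\delta>0$ there are $\varepsilon_1\in(0,\tfrac12)$ and an integer $m\ge1$, depending only on $S,A,\gamma,\varepsilon,\delta$, such that, with $\eta=1-\varepsilon_1$ and $\rho=\varepsilon_1\sqrt m$, for every $\lambda\in(0,\varepsilon_1]$ and every $\gamma_E\in(0,1)$, for every MDP $M$ as above with $S$ states, $A$ actions and discount factor $\gamma$, and for every initial state: if Directed Delayed Q-learning with these inputs is executed on $M$, then with probability at least $1-\delta$ the inequality $V^{\mathfrak A_t}_M(s_t)\ge V^*_M(s_t)-\varepsilon$ is true for all but at most $$C\,\frac{SA}{\varepsilon^4(1-\gamma)^8}\;\overline{\ln}\frac1\delta\;\;\overline{\ln}\frac1{\varepsilon(1-\gamma)}\;\;\overline{\ln}\frac{SA}{\delta\,\varepsilon(1-\gamma)}$$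 timesteps $t$, where $\overline{\ln}\,x=\max(1,\ln x)$. -/

import Mathlib

open MeasureTheory ProbabilityTheory

universe u

noncomputable section

namespace RL

/-- A discounted Markov decision process with transition distribution `T(· | s, a)`, reward
distribution `R(· | s, a)` supported in `[0, 1]`, and discount factor `γ ∈ [0, 1)`. -/
structure MDP (S A : Type u) [MeasurableSpace S] [MeasurableSpace A] where
  T : Kernel (S × A) S
  R : Kernel (S × A) ℝ
  γ : ℝ
  markov_T : IsMarkovKernel T
  markov_R : IsMarkovKernel R
  reward_mem : ∀ p, ∀ᵐ r ∂(R p), r ∈ Set.Icc (0 : ℝ) 1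
  γ_nonneg : 0 ≤ γ
  γ_lt_one : γ < 1

/-- What is observed at each index: first the initial state `s₀`, then, at index `n + 1`, the triple
`(aₙ, rₙ, sₙ₊₁)`. -/
def Obs (S A : Type u) : ℕ → Type u
  | 0 => S
  | _ + 1 => A × ℝ × S

instance instMeasurableSpaceObs (S A : Type u) [MeasurableSpace S] [MeasurableSpace A] :
    ∀ n, MeasurableSpace (Obs S A n)
  | 0 => inferInstanceAs (MeasurableSpace S)
  | _ + 1 => inferInstanceAs (MeasurableSpace (A × ℝ × S))

/-- The state contained in an observation. -/
def Obs.state {S A : Type u} : {n : ℕ} → Obs S A n → S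
  | 0, s => s
  | _ + 1, y => y.2.2

/-- Infinite streams `s₀, a₀, r₀, s₁, a₁, r₁, …`. -/
abbrev Stream (S A : Type u) : Type u := (n : ℕ) → Obs S A n

/-- Histories `hₙ = (s₀, a₀, r₀, …, aₙ₋₁, rₙ₋₁, sₙ)`. -/
abbrev Hist (S A : Type u) (n : ℕ) : Type u := (i : Finset.Iic n) → Obs S A i

section

variable {S A : Type u}

/-- The current state `sₙ` of a history. -/
def Hist.state {n : ℕ} (h : Hist S A n) : S :=
  (h ⟨n, Finset.mem_Iic.2 le_rfl⟩).state

/-- The history that consists of the initial state `s`. -/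
def Hist.init (s : S) : Hist S A 0
  | ⟨0, _⟩ => s
  | ⟨_ + 1, h⟩ => absurd (Finset.mem_Iic.1 h) (Nat.not_succ_le_zero _)

/-- The last transition `(aₙ, rₙ, sₙ₊₁)` of a history. -/
def Hist.last {n : ℕ} (h : Hist S A (n + 1)) : A × ℝ × S :=
  h ⟨n + 1, Finset.mem_Iic.2 le_rfl⟩

/-- The history without its last transition. -/
def Hist.prev {n : ℕ} (h : Hist S A (n + 1)) : Hist S A n :=
  Preorder.frestrictLe₂ (π := Obs S A) (Nat.le_succ n) h

/-- The history `hₜ` of a stream. -/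
def Stream.hist (x : Stream S A) (t : ℕ) : Hist S A t :=
  Preorder.frestrictLe (π := Obs S A) t x

/-- The state `sₜ` of a stream. -/
def Stream.state (x : Stream S A) (t : ℕ) : S := (x t).state

/-- The immediate reward `rₜ` of a stream. -/
def Stream.reward (x : Stream S A) (t : ℕ) : ℝ :=
  Prod.fst (Prod.snd (show A × ℝ × S from x (t + 1)))

variable [MeasurableSpace S] [MeasurableSpace A]

theorem measurable_obs_state : ∀ n, Measurable (Obs.state : Obs S A n → S)
  | 0 => measurable_id
  | _ + 1 => measurable_snd.comp (measurable_snd (α := A) (β := ℝ × S))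

theorem Hist.measurable_state (n : ℕ) : Measurable (Hist.state : Hist S A n → S) :=
  (measurable_obs_state n).comp (measurable_pi_apply _)

/-- A (possibly randomized and history-dependent) policy: to every history it assigns a probability
distribution over the actions. -/
structure Policy (S A : Type u) [MeasurableSpace S] [MeasurableSpace A] where
  act : (n : ℕ) → Kernel (Hist S A n) A
  markov : ∀ n, IsMarkovKernel (act n)

/-- One step of the interaction: given `hₙ`, draw `aₙ` from the policy and then, independently,
`rₙ ∼ R(· | sₙ, aₙ)` and `sₙ₊₁ ∼ T(· | sₙ, aₙ)`. -/
def MDP.stepKernel (M : MDP S A) (π : Policy S A) (n : ℕ) :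
    Kernel (Hist S A n) (Obs S A (n + 1)) :=
  show Kernel (Hist S A n) (A × ℝ × S) from
    (π.act n) ⊗ₖ ((M.R ×ₖ M.T).comap (fun p : Hist S A n × A => (p.1.state, p.2))
      (((Hist.measurable_state n).comp measurable_fst).prodMk measurable_snd))

instance instIsMarkovKernelStep (M : MDP S A) (π : Policy S A) (n : ℕ) :
    IsMarkovKernel (M.stepKernel π n) := by
  have := M.markov_T
  have := M.markov_R
  have := π.markov n
  exact inferInstanceAs (IsMarkovKernel ((π.act n) ⊗ₖ ((M.R ×ₖ M.T).comap
    (fun p : Hist S A n × A => (p.1.state, p.2))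
      (((Hist.measurable_state n).comp measurable_fst).prodMk measurable_snd))))

/-- The law of the whole stream when `π` interacts with `M`, given the history `h` up to time `t`. -/
def MDP.law (M : MDP S A) (π : Policy S A) (t : ℕ) (h : Hist S A t) : Measure (Stream S A) :=
  Kernel.traj (X := Obs S A) (M.stepKernel π) t h

/-- The value at time `t` given the past: `E[∑ₖ γᵏ rₜ₊ₖ | hₜ = h]`. -/
def MDP.value (M : MDP S A) (π : Policy S A) (t : ℕ) (h : Hist S A t) : ℝ :=
  ∫ x, ∑' k : ℕ, M.γ ^ k * x.reward (t + k) ∂(M.law π t h)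

/-- The optimal value `V*(s)`: the supremum over all policies. -/
def MDP.optValue (M : MDP S A) (s : S) : ℝ :=
  ⨆ π : Policy S A, M.value π 0 (Hist.init s)

end

/-! Directed Delayed Q-learning -/

/-- The inputs of the algorithm. -/
structure Params where
  γ : ℝ
  ε₁ : ℝ
  m : ℕ
  lam : ℝ
  ρ : ℝ
  γE : ℝ
  η : ℝ

/-- The exploration bonus `λ / √(log_η e)`. -/
def Params.bonus (P : Params) (e : ℝ) : ℝ := P.lam / √(Real.logb P.η e)

/-- The variables that the algorithm maintains. -/
structure Memory (S A : Type u) where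
  /-- Q-value estimate -/
  Q : S × A → ℝ
  /-- exploration value estimate -/
  E : S × A → ℝ
  /-- inner loop estimate for Q-values -/
  Qt : S × A → ℝ
  /-- inner loop estimate for E-values -/
  Et : S × A → ℝ
  /-- inner counter -/
  n : S × A → ℕ
  /-- time at which the previous attempted update ended and the current one began -/
  b : S × A → ℕ
  /-- the LEARN flags -/
  learn : S × A → Bool
  /-- time of the most recent Q-value change -/
  tstar : ℕ

namespace Memory

variable {S A : Type u}

/-- The initialization. -/
def init (P : Params) : Memory S A where
  Q := fun _ => 1 / (1 - P.γ)
  E := fun _ => 1 - P.ε₁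
  Qt := fun _ => 0
  Et := fun _ => 0
  n := fun _ => 0
  b := fun _ => 0
  learn := fun _ => true
  tstar := 0

/-- `Q'(s, a) = Q(s, a) + λ / √(log_η E(s, a))`. -/
def Q' (P : Params) (σ : Memory S A) (p : S × A) : ℝ := σ.Q p + P.bonus (σ.E p)

open Classical in
/-- `if b(s, a) ≤ t* then LEARN(s, a) ← true`. -/
def relearn (σ : Memory S A) (p : S × A) : Memory S A :=
  if σ.b p ≤ σ.tstar then { σ with learn := Function.update σ.learn p true } else σ

open Classical in
/-- Incorporate the sample `(r, s')` of the pair `p = (s, a)` in the inner loop estimates, with the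
step size `1 / n(s, a)` (after the counter has been incremented). -/
def sample [Fintype A] [Nonempty A] (P : Params) (σ : Memory S A) (p : S × A) (r : ℝ) (s' : S) :
    Memory S A :=
  let α : ℝ := 1 / ((σ.n p + 1 : ℕ) : ℝ)
  { σ with
    n := Function.update σ.n p (σ.n p + 1)
    Qt := Function.update σ.Qt p ((1 - α) * σ.Qt p +
      α * (r + P.γ * Finset.univ.sup' Finset.univ_nonempty fun a' : A => σ.Q (s', a')))
    Et := Function.update σ.Et p ((1 - α) * σ.Et p +
      α * (P.γE * Finset.univ.sup' Finset.univ_nonempty fun a' : A => σ.E (s', a'))) }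

open Classical in
/-- `n(s, a) ← 0; Q̃(s, a) ← 0; Ẽ(s, a) ← 0; b(s, a) ← t`. -/
def reset (σ : Memory S A) (t : ℕ) (p : S × A) : Memory S A :=
  { σ with
    n := Function.update σ.n p 0
    Qt := Function.update σ.Qt p 0
    Et := Function.update σ.Et p 0
    b := Function.update σ.b p t }

open Classical in
/-- The attempted update of `p = (s, a)` at time `t`. When it fails with `n(s, a) = m`, learning is
switched off if no Q-value has changed since `b(s, a)`, and the inner loop is restarted. -/
def attempt (P : Params) (σ : Memory S A) (t : ℕ) (p : S × A) : Memory S A :=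
  if P.ε₁ ≤ σ.Q' P p - (σ.Qt p + P.ρ / √(σ.n p : ℝ) + P.bonus (σ.Et p)) then
    reset
      { σ with
        Q := Function.update σ.Q p (σ.Qt p + P.ρ / √(σ.n p : ℝ))
        E := Function.update σ.E p (σ.Et p)
        tstar := t } t p
  else if σ.n p = P.m then
    reset
      (if σ.tstar < σ.b p then { σ with learn := Function.update σ.learn p false } else σ) t p
  else σ

/-- One iteration of the main loop at time `t`, in which the action `a` was taken in the state `s` and
the reward `r` and the next state `s'` were observed. -/
def step [Fintype A] [Nonempty A] (P : Params) (σ : Memory S A) (t : ℕ) (s : S) (a : A) (r : ℝ)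
    (s' : S) : Memory S A :=
  let σ₁ := σ.relearn (s, a)
  if σ₁.learn (s, a) = true then (σ₁.sample P (s, a) r s').attempt P t (s, a) else σ₁

/-- The memory of the algorithm after it has processed a history; the main loop counts time from 1. -/
def run [Fintype A] [Nonempty A] (P : Params) : (n : ℕ) → Hist S A n → Memory S A
  | 0, _ => init P
  | n + 1, h =>
    (run P n h.prev).step P (n + 1) h.prev.state h.last.1 h.last.2.1 h.last.2.2

end Memory

/-- `π` is a policy of Directed Delayed Q-learning with inputs `P`: in every history it takes only
actions that maximize `Q'(s, ·)` at the current state `s`, ties being broken in any way. -/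
def IsDirectedDelayedQ {S A : Type u} [MeasurableSpace S] [MeasurableSpace A] [Fintype A]
    [Nonempty A] (P : Params) (π : Policy S A) : Prop :=
  ∀ (n : ℕ) (h : Hist S A n) (a : A), π.act n h {a} ≠ 0 →
    ∀ a' : A, (Memory.run P n h).Q' P (h.state, a') ≤ (Memory.run P n h).Q' P (h.state, a)

/-- The timesteps at which the current policy is not `ε`-optimal from the current state. -/
def MDP.badTimes {S A : Type u} [MeasurableSpace S] [MeasurableSpace A] (M : MDP S A)
    (π : Policy S A) (ε : ℝ) (x : Stream S A) : Set ℕ :=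
  {t | M.value π t (x.hist t) < M.optValue (x.state t) - ε}

end RL

end

/-! Write `B = 1 / (1 - γ)` and call `Q p - backup V p` the Bellman residual of the pair `p`.
Q-value estimates only decrease, and as long as sample averages are close to their expectations all
residuals stay nonnegative. Then `V` dominates its own backups, hence the optimal value
(`MDP.optValue_le_of_backup_le`), and at a bad timestep `V` at the current state exceeds the value
of the actual policy by more than `ε`. No truncated horizon or auxiliary MDP is used: the Bellman
equation of the history-dependent policy bounds this gap by the expected cost of the next transition
plus the discounted gap after it (`MDP.excess_le_integral_charge`). The cost of a transition is the
part of the residual above `4 ε₁` plus the decrease of the Q-value. The free `4 ε₁` and another `ε₁`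
for the exploration bonus add up to a tolerance `5 ε₁ B`, which is half of `ε`.

With good samples the total cost is bounded on every stream (`Ghost.Good.step`,
`Ghost.Good.totalCost_le`). An attempted update whose residuals average more than `4 ε₁` cannot
fail, a pair with learning switched off has residual at most `4 ε₁`, and each success lowers `Q'` by
at least `ε₁`. So the cost of a pair is paid for by the decrease of its `Q'`, at a price of order
`m` per unit.

Two applications of Ville's inequality (`MDP.ville`) make this hold with high probability. The first
concerns sample accuracy: exponential moments of the running attempts, plus a reserve for every
attempt that can still be completed (`Memory.Bounded.attemptsLeft_step`), form a supermartingale.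
The exploration values matter only through the bonus, which lies in `[0, λ]`. The second turns the
conditional bound on the excess into a bound on the sum of the excesses along the stream, through
the exponential supermartingale of `MDP.lintegral_exp_logPotential_le`. Each bad timestep
contributes at least `ε / 2` to that sum, which bounds their number. -/

noncomputable section

namespace RL

/-! ### Histories, the one-step tower rule and Ville's inequality. -/

section Trajectories

variable {S A : Type u}

/-- The history `h` followed by the transition `y`. -/
def Hist.snoc {n : ℕ} (h : Hist S A n) (y : A × ℝ × S) : Hist S A (n + 1) :=
  IicProdIoc (X := Obs S A) n (n + 1) (h, fun i =>
    (Nat.mem_Ioc_succ.1 i.2).symm ▸ (show Obs S A (n + 1) from y))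

@[simp]
theorem Hist.prev_snoc {n : ℕ} (h : Hist S A n) (y : A × ℝ × S) : (h.snoc y).prev = h :=
  congrFun (frestrictLe₂_comp_IicProdIoc (X := Obs S A) (Nat.le_succ n)) (h, _)

@[simp]
theorem Hist.last_snoc {n : ℕ} (h : Hist S A n) (y : A × ℝ × S) : (h.snoc y).last = y := by
  simp [Hist.last, Hist.snoc, IicProdIoc]

theorem Hist.state_eq_last {n : ℕ} (h : Hist S A (n + 1)) : h.state = h.last.2.2 := rfl

@[simp]
theorem Hist.state_snoc {n : ℕ} (h : Hist S A n) (y : A × ℝ × S) : (h.snoc y).state = y.2.2 := by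
  rw [Hist.state_eq_last, Hist.last_snoc]

@[simp]
theorem Stream.prev_hist (x : Stream S A) (t : ℕ) : (x.hist (t + 1)).prev = x.hist t := rfl

theorem Stream.state_hist (x : Stream S A) (t : ℕ) : (x.hist t).state = x.state t := rfl

theorem Stream.reward_eq (x : Stream S A) (t : ℕ) : x.reward t = (x.hist (t + 1)).last.2.1 := rfl

variable [MeasurableSpace S] [MeasurableSpace A]

theorem Hist.measurable_prev {n : ℕ} : Measurable (Hist.prev : Hist S A (n + 1) → Hist S A n) :=
  Preorder.measurable_frestrictLe₂ (Nat.le_succ n)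

theorem Hist.measurable_last {n : ℕ} : Measurable (Hist.last : Hist S A (n + 1) → A × ℝ × S) :=
  measurable_pi_apply (X := fun i : Finset.Iic (n + 1) => Obs S A i)
    ⟨n + 1, Finset.mem_Iic.2 le_rfl⟩

theorem Stream.measurable_hist (t : ℕ) : Measurable (fun x : Stream S A => x.hist t) :=
  Preorder.measurable_frestrictLe _

theorem Stream.measurable_reward (t : ℕ) : Measurable (fun x : Stream S A => x.reward t) :=
  (measurable_fst.comp measurable_snd).comp (Hist.measurable_last.comp (measurable_hist (t + 1)))

/-- This is the form in which the Ionescu-Tulcea construction of Mathlib appends a coordinate; it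
gives measurability of `snoc` and the identification of the one-step kernel in
`MDP.partialTraj_succ`. -/
theorem Hist.snoc_eq {n : ℕ} :
    (fun q : Hist S A n × (A × ℝ × S) => q.1.snoc q.2) =
      IicProdIoc (X := Obs S A) n (n + 1) ∘
        Prod.map id (MeasurableEquiv.piSingleton (X := Obs S A) n) := by
  rfl

theorem Hist.measurable_snoc {n : ℕ} :
    Measurable (fun q : Hist S A n × (A × ℝ × S) => q.1.snoc q.2) := by
  rw [Hist.snoc_eq]
  exact measurable_IicProdIoc.comp
    (measurable_id.prodMap (MeasurableEquiv.piSingleton (X := Obs S A) n).measurable)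

theorem Hist.measurable_snoc_right {n : ℕ} (h : Hist S A n) : Measurable h.snoc :=
  Hist.measurable_snoc.comp (measurable_const.prodMk measurable_id)

/-- The joint law of the reward and the next state after the pair `p = (s, a)`. -/
def MDP.outcome (M : MDP S A) (p : S × A) : Measure (ℝ × S) := (M.R ×ₖ M.T) p

instance instIsProbabilityMeasureOutcome (M : MDP S A) (p : S × A) :
    IsProbabilityMeasure (M.outcome p) := by
  have := M.markov_T
  have := M.markov_R
  unfold MDP.outcome
  infer_instance

theorem MDP.outcome_reward_mem (M : MDP S A) (p : S × A) :
    ∀ᵐ z ∂(M.outcome p), z.1 ∈ Set.Icc (0 : ℝ) 1 := by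
  have := M.markov_T
  have := M.markov_R
  have h : (M.outcome p).map Prod.fst = M.R p := by
    rw [MDP.outcome, ← Kernel.map_apply _ measurable_fst, ← Kernel.fst_eq, Kernel.fst_prod]
  have h1 := M.reward_mem p
  rw [← h] at h1
  exact ae_of_ae_map measurable_fst.aemeasurable h1

/-- The law of the next transition given the history `h`. -/
def MDP.next (M : MDP S A) (π : Policy S A) (n : ℕ) (h : Hist S A n) : Measure (A × ℝ × S) :=
  M.stepKernel π n h

instance instIsProbabilityMeasureNext (M : MDP S A) (π : Policy S A) (n : ℕ) (h : Hist S A n) :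
    IsProbabilityMeasure (M.next π n h) :=
  inferInstanceAs (IsProbabilityMeasure (M.stepKernel π n h))

instance instIsProbabilityMeasureLaw (M : MDP S A) (π : Policy S A) (n : ℕ) (h : Hist S A n) :
    IsProbabilityMeasure (M.law π n h) :=
  inferInstanceAs (IsProbabilityMeasure (Kernel.traj (X := Obs S A) (M.stepKernel π) n h))

theorem MDP.lintegral_next (M : MDP S A) (π : Policy S A) (n : ℕ) (h : Hist S A n)
    {f : A × ℝ × S → ENNReal} (hf : Measurable f) :
    ∫⁻ y, f y ∂(M.next π n h) =
      ∫⁻ a, ∫⁻ z, f (a, z) ∂(M.outcome (h.state, a)) ∂(π.act n h) := by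
  have := M.markov_T
  have := M.markov_R
  have := π.markov n
  exact Kernel.lintegral_compProd (π.act n) _ h hf

theorem MDP.integral_next (M : MDP S A) (π : Policy S A) (n : ℕ) (h : Hist S A n)
    {f : A × ℝ × S → ℝ} (hf : Integrable f (M.next π n h)) :
    ∫ y, f y ∂(M.next π n h) =
      ∫ a, ∫ z, f (a, z) ∂(M.outcome (h.state, a)) ∂(π.act n h) := by
  have := M.markov_T
  have := M.markov_R
  have := π.markov n
  exact ProbabilityTheory.integral_compProd hf

theorem MDP.ae_next (M : MDP S A) (π : Policy S A) (n : ℕ) (h : Hist S A n)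
    {p : A × ℝ × S → Prop} (hp : MeasurableSet {y | p y})
    (H : ∀ᵐ a ∂(π.act n h), ∀ᵐ z ∂(M.outcome (h.state, a)), p (a, z)) :
    ∀ᵐ y ∂(M.next π n h), p y := by
  have := M.markov_T
  have := M.markov_R
  have := π.markov n
  exact Kernel.ae_compProd_of_ae_ae hp H

theorem MDP.next_reward_mem (M : MDP S A) (π : Policy S A) (n : ℕ) (h : Hist S A n) :
    ∀ᵐ y ∂(M.next π n h), y.2.1 ∈ Set.Icc (0 : ℝ) 1 :=
  M.ae_next π n h ((measurable_fst.comp measurable_snd) measurableSet_Icc)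
    (Filter.Eventually.of_forall fun _ => M.outcome_reward_mem _)

theorem MDP.partialTraj_succ (M : MDP S A) (π : Policy S A) (n : ℕ) (h : Hist S A n) :
    Kernel.partialTraj (X := Obs S A) (M.stepKernel π) n (n + 1) h =
      (M.next π n h).map h.snoc := by
  have hm := (MeasurableEquiv.piSingleton (X := Obs S A) n).measurable
  have : IsMarkovKernel ((M.stepKernel π n).map (MeasurableEquiv.piSingleton (X := Obs S A) n)) :=
    Kernel.IsMarkovKernel.map _ hm
  rw [Kernel.partialTraj_succ_self, Kernel.map_apply _ measurable_IicProdIoc, Kernel.prod_apply,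
    Kernel.id_apply, Measure.dirac_prod, Kernel.map_apply _ hm,
    Measure.map_map measurable_prodMk_left hm, Measure.map_map measurable_IicProdIoc
      (measurable_prodMk_left.comp hm)]
  have e : h.snoc = IicProdIoc (X := Obs S A) n (n + 1) ∘
      (Prod.mk h ∘ (MeasurableEquiv.piSingleton (X := Obs S A) n)) := by
    funext y
    exact congrFun (Hist.snoc_eq (S := S) (A := A) (n := n)) (h, y)
  rw [e]
  rfl

/-- The tower rule for one step. -/
theorem MDP.lintegral_law (M : MDP S A) (π : Policy S A) (n : ℕ) (h : Hist S A n)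
    {f : Stream S A → ENNReal} (hf : Measurable f) :
    ∫⁻ x, f x ∂(M.law π n h) =
      ∫⁻ y, ∫⁻ x, f x ∂(M.law π (n + 1) (h.snoc y)) ∂(M.next π n h) := by
  have e : M.law π n h =
      (Kernel.traj (X := Obs S A) (M.stepKernel π) (n + 1) ∘ₖ
        Kernel.partialTraj (X := Obs S A) (M.stepKernel π) n (n + 1)) h := by
    rw [Kernel.traj_comp_partialTraj (Nat.le_succ n)]
    rfl
  rw [e, Kernel.lintegral_comp _ _ _ hf, M.partialTraj_succ,
    lintegral_map hf.lintegral_kernel h.measurable_snoc_right]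
  rfl

theorem MDP.integral_law (M : MDP S A) (π : Policy S A) (n : ℕ) (h : Hist S A n)
    {f : Stream S A → ℝ} (hm : Measurable f) (hf : Integrable f (M.law π n h)) :
    ∫ x, f x ∂(M.law π n h) =
      ∫ y, ∫ x, f x ∂(M.law π (n + 1) (h.snoc y)) ∂(M.next π n h) := by
  have e := Kernel.integral_traj_partialTraj (X := Obs S A) (κ := M.stepKernel π)
    (Nat.le_succ n) hf
  rw [M.partialTraj_succ, integral_map h.measurable_snoc_right.aemeasurable
    hm.stronglyMeasurable.integral_kernel.aestronglyMeasurable] at e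
  exact e.symm

theorem MDP.law_map_hist (M : MDP S A) (π : Policy S A) (n : ℕ) (h : Hist S A n) :
    (M.law π n h).map (fun x => x.hist n) = Measure.dirac h := by
  have e := Kernel.traj_map_frestrictLe_apply (X := Obs S A) (κ := M.stepKernel π) n n h
  rw [Kernel.partialTraj_self, Kernel.id_apply] at e
  exact e

theorem MDP.ae_law_hist (M : MDP S A) (π : Policy S A) (n : ℕ) (h : Hist S A n)
    {p : Hist S A n → Prop} (hp : MeasurableSet {h | p h}) (hh : p h) :
    ∀ᵐ x ∂(M.law π n h), p (x.hist n) := by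
  have h1 : ∀ᵐ h' ∂((M.law π n h).map (fun x => x.hist n)), p h' := by
    rw [M.law_map_hist, ae_dirac_iff hp]
    exact hh
  exact ae_of_ae_map (Stream.measurable_hist n).aemeasurable h1

/-- Ville's inequality along the interaction: if `W` does not increase on average in any step that
starts in the invariant family `G`, then `W` ever reaches `1` with probability at most its initial
value. -/
theorem MDP.ville (M : MDP S A) (π : Policy S A) (G : ∀ n, Set (Hist S A n))
    (hG : ∀ n, ∀ h ∈ G n, ∀ᵐ y ∂(M.next π n h), h.snoc y ∈ G (n + 1))
    (W : ∀ n, Hist S A n → ENNReal) (hW : ∀ n, Measurable (W n))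
    (hsup : ∀ n, ∀ h ∈ G n, ∫⁻ y, W (n + 1) (h.snoc y) ∂(M.next π n h) ≤ W n h)
    (n : ℕ) (h : Hist S A n) (hh : h ∈ G n) :
    M.law π n h {x | ∃ k, 1 ≤ W (n + k) (x.hist (n + k))} ≤ W n h := by
  have hset : ∀ n, MeasurableSet {x : Stream S A | 1 ≤ W n (x.hist n)} := fun n =>
    measurableSet_le measurable_const ((hW n).comp (Stream.measurable_hist n))
  have hms : ∀ n N, MeasurableSet {x : Stream S A | ∃ k < N, 1 ≤ W (n + k) (x.hist (n + k))} := by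
    intro n N
    have e : {x : Stream S A | ∃ k < N, 1 ≤ W (n + k) (x.hist (n + k))} =
        ⋃ k, ⋃ (_ : k < N), {x : Stream S A | 1 ≤ W (n + k) (x.hist (n + k))} := by
      ext x; simp
    rw [e]
    exact MeasurableSet.iUnion fun k => MeasurableSet.iUnion fun _ => hset _
  have key : ∀ (N n : ℕ) (h : Hist S A n), h ∈ G n →
      M.law π n h {x | ∃ k < N, 1 ≤ W (n + k) (x.hist (n + k))} ≤ W n h := by
    intro N
    induction N with
    | zero => intro n h _; simp
    | succ N ih =>
      intro n h hh
      -- Induction on the horizon replaces a stopping time: once the threshold is reached the claim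
      -- is trivial, since a probability is at most one; before that, one step is taken and the
      -- induction hypothesis is averaged.
      by_cases h1 : 1 ≤ W n h
      · exact prob_le_one.trans h1
      have hle : M.law π n h {x | ∃ k < N + 1, 1 ≤ W (n + k) (x.hist (n + k))} ≤
          M.law π n h {x | ∃ k < N, 1 ≤ W (n + 1 + k) (x.hist (n + 1 + k))} := by
        refine measure_mono_ae ?_
        filter_upwards [M.ae_law_hist π n h (p := fun h => ¬ 1 ≤ W n h)
          (measurableSet_le measurable_const (hW n)).compl h1] with x hx
        rintro ⟨k, hk, hk1⟩
        cases k with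
        | zero => exact absurd hk1 hx
        | succ k =>
          refine ⟨k, by omega, ?_⟩
          have e : n + (k + 1) = n + 1 + k := by omega
          rw [e] at hk1
          exact hk1
      refine hle.trans ?_
      rw [← lintegral_indicator_one (hms (n + 1) N), M.lintegral_law π n h
        (measurable_one.indicator (hms (n + 1) N))]
      refine le_trans (lintegral_mono_ae ?_) (hsup n h hh)
      filter_upwards [hG n h hh] with y hy
      rw [lintegral_indicator_one (hms (n + 1) N)]
      exact ih (n + 1) (h.snoc y) hy
  have e : {x : Stream S A | ∃ k, 1 ≤ W (n + k) (x.hist (n + k))} =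
      ⋃ N, {x : Stream S A | ∃ k < N, 1 ≤ W (n + k) (x.hist (n + k))} := by
    ext x
    simp only [Set.mem_ofPred_eq, Set.mem_iUnion]
    exact ⟨fun ⟨k, hk⟩ => ⟨k + 1, k, Nat.lt_succ_self k, hk⟩, fun ⟨_, k, _, hk⟩ => ⟨k, hk⟩⟩
  rw [e, Monotone.measure_iUnion]
  · exact iSup_le fun N => key N n h hh
  · intro N N' hN x ⟨k, hk, hk1⟩
    exact ⟨k, lt_of_lt_of_le hk hN, hk1⟩

/-- A measurable family of histories that is almost surely preserved by each step is almost surely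
never left. -/
theorem MDP.ae_invariant (M : MDP S A) (π : Policy S A) (G : ∀ n, Set (Hist S A n))
    (hm : ∀ n, MeasurableSet (G n))
    (hG : ∀ n, ∀ h ∈ G n, ∀ᵐ y ∂(M.next π n h), h.snoc y ∈ G (n + 1))
    (n : ℕ) (h : Hist S A n) (hh : h ∈ G n) :
    ∀ᵐ x ∂(M.law π n h), ∀ k, x.hist (n + k) ∈ G (n + k) := by
  -- The indicator of the complement starts at zero, so by Ville it reaches one with probability
  -- zero.
  have hv := M.ville π G hG (fun n => (G n)ᶜ.indicator 1)
    (fun n => measurable_one.indicator (hm n).compl) ?_ n h hh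
  · rw [ae_iff]
    have h0 : (G n)ᶜ.indicator (1 : Hist S A n → ENNReal) h = 0 := by simp [hh]
    rw [h0] at hv
    refine le_antisymm (le_trans (measure_mono ?_) hv) zero_le
    intro x hx
    simp only [Set.mem_ofPred_eq, not_forall] at hx ⊢
    obtain ⟨k, hk⟩ := hx
    exact ⟨k, by simp [hk]⟩
  · intro n h hh
    rw [lintegral_congr_ae (g := fun _ => 0)]
    · simp
    · filter_upwards [hG n h hh] with y hy
      simp [hy]

end Trajectories

/-! ### Values, the Bellman equation and the domination of the optimal value. -/

section Values

variable {S A : Type u}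

/-- The histories of length `n` whose rewards from time `t₀` on lie in `[0, 1]`. -/
def rewardGood (S A : Type u) (t₀ : ℕ) : (n : ℕ) → Set (Hist S A n)
  | 0 => Set.univ
  | n + 1 => {h | h.prev ∈ rewardGood S A t₀ n ∧ (t₀ ≤ n → h.last.2.1 ∈ Set.Icc (0 : ℝ) 1)}

theorem mem_rewardGood_succ {t₀ n : ℕ} {h : Hist S A (n + 1)} :
    h ∈ rewardGood S A t₀ (n + 1) ↔
      h.prev ∈ rewardGood S A t₀ n ∧ (t₀ ≤ n → h.last.2.1 ∈ Set.Icc (0 : ℝ) 1) :=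
  Iff.rfl

theorem mem_rewardGood_of_le {t₀ : ℕ} : ∀ {n : ℕ}, n ≤ t₀ → ∀ h : Hist S A n,
    h ∈ rewardGood S A t₀ n
  | 0, _, _ => Set.mem_univ _
  | _ + 1, hn, h =>
    mem_rewardGood_succ.2 ⟨mem_rewardGood_of_le (by omega) h.prev, fun h1 => absurd h1 (by omega)⟩

variable [MeasurableSpace S] [MeasurableSpace A]

theorem measurableSet_rewardGood (t₀ : ℕ) : ∀ n, MeasurableSet (rewardGood S A t₀ n)
  | 0 => MeasurableSet.univ
  | n + 1 => by
    have h1 : MeasurableSet {h : Hist S A (n + 1) | h.prev ∈ rewardGood S A t₀ n} :=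
      Hist.measurable_prev (measurableSet_rewardGood t₀ n)
    have h2 : MeasurableSet {h : Hist S A (n + 1) | h.last.2.1 ∈ Set.Icc (0 : ℝ) 1} :=
      ((measurable_fst.comp measurable_snd).comp Hist.measurable_last) measurableSet_Icc
    by_cases hn : t₀ ≤ n
    · have e : rewardGood S A t₀ (n + 1) = {h : Hist S A (n + 1) | h.prev ∈ rewardGood S A t₀ n} ∩
          {h : Hist S A (n + 1) | h.last.2.1 ∈ Set.Icc (0 : ℝ) 1} := by
        ext h; simp [mem_rewardGood_succ, hn]
      rw [e]
      exact h1.inter h2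
    · have e : rewardGood S A t₀ (n + 1) =
          {h : Hist S A (n + 1) | h.prev ∈ rewardGood S A t₀ n} := by
        ext h; simp [mem_rewardGood_succ, hn]
      rw [e]
      exact h1

theorem MDP.ae_snoc_mem_rewardGood (M : MDP S A) (π : Policy S A) (t₀ n : ℕ) (h : Hist S A n)
    (hh : h ∈ rewardGood S A t₀ n) :
    ∀ᵐ y ∂(M.next π n h), h.snoc y ∈ rewardGood S A t₀ (n + 1) := by
  filter_upwards [M.next_reward_mem π n h] with y hy
  rw [mem_rewardGood_succ, Hist.prev_snoc, Hist.last_snoc]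
  exact ⟨hh, fun _ => hy⟩

theorem MDP.ae_hist_mem_rewardGood (M : MDP S A) (π : Policy S A) (n : ℕ) (h : Hist S A n) :
    ∀ᵐ x ∂(M.law π n h), ∀ k, x.hist (n + k) ∈ rewardGood S A n (n + k) :=
  M.ae_invariant π _ (measurableSet_rewardGood n) (M.ae_snoc_mem_rewardGood π n) n h
    (mem_rewardGood_of_le le_rfl h)

theorem MDP.ae_reward_mem (M : MDP S A) (π : Policy S A) (n : ℕ) (h : Hist S A n) :
    ∀ᵐ x ∂(M.law π n h), ∀ k, x.reward (n + k) ∈ Set.Icc (0 : ℝ) 1 := by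
  filter_upwards [M.ae_hist_mem_rewardGood π n h] with x hx k
  exact (mem_rewardGood_succ.1 (hx (k + 1))).2 (Nat.le_add_right n k)

/-- The real number nearest to `r` in the unit interval. -/
def clip (r : ℝ) : ℝ := max 0 (min r 1)

theorem clip_nonneg (r : ℝ) : 0 ≤ clip r := le_max_left _ _

theorem clip_le_one (r : ℝ) : clip r ≤ 1 := max_le zero_le_one (min_le_right _ _)

theorem clip_of_mem {r : ℝ} (hr : r ∈ Set.Icc (0 : ℝ) 1) : clip r = r := by
  rw [clip, min_eq_left hr.2, max_eq_right hr.1]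

theorem measurable_clip : Measurable clip :=
  measurable_const.max (measurable_id.min measurable_const)

/-- The discounted return from time `t` on, with the rewards clipped to the unit interval. -/
def MDP.ret (M : MDP S A) (t : ℕ) (x : Stream S A) : ℝ :=
  ∑' k : ℕ, M.γ ^ k * clip (x.reward (t + k))

theorem MDP.summable_ret (M : MDP S A) (t : ℕ) (x : Stream S A) :
    Summable fun k : ℕ => M.γ ^ k * clip (x.reward (t + k)) :=
  (summable_geometric_of_lt_one M.γ_nonneg M.γ_lt_one).of_nonneg_of_le
    (fun k => mul_nonneg (pow_nonneg M.γ_nonneg k) (clip_nonneg _))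
    (fun k => mul_le_of_le_one_right (pow_nonneg M.γ_nonneg k) (clip_le_one _))

theorem MDP.ret_nonneg (M : MDP S A) (t : ℕ) (x : Stream S A) : 0 ≤ M.ret t x :=
  tsum_nonneg fun k => mul_nonneg (pow_nonneg M.γ_nonneg k) (clip_nonneg _)

theorem MDP.ret_le (M : MDP S A) (t : ℕ) (x : Stream S A) : M.ret t x ≤ 1 / (1 - M.γ) := by
  rw [one_div, ← tsum_geometric_of_lt_one M.γ_nonneg M.γ_lt_one]
  exact (M.summable_ret t x).tsum_le_tsum
    (fun k => mul_le_of_le_one_right (pow_nonneg M.γ_nonneg k) (clip_le_one _))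
    (summable_geometric_of_lt_one M.γ_nonneg M.γ_lt_one)

theorem MDP.ret_eq (M : MDP S A) (t : ℕ) (x : Stream S A) :
    M.ret t x = clip (x.reward t) + M.γ * M.ret (t + 1) x := by
  rw [MDP.ret, (M.summable_ret t x).tsum_eq_zero_add, MDP.ret, ← tsum_mul_left]
  congr 1
  · simp
  · refine tsum_congr fun k => ?_
    rw [show t + (k + 1) = t + 1 + k by omega]
    ring

theorem MDP.measurable_ret (M : MDP S A) (t : ℕ) : Measurable (M.ret t) :=
  Measurable.tsum fun _ => (measurable_clip.comp (Stream.measurable_reward _)).const_mul _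

theorem MDP.integrable_ret (M : MDP S A) (t : ℕ) (μ : Measure (Stream S A))
    [IsProbabilityMeasure μ] : Integrable (M.ret t) μ :=
  Integrable.of_mem_Icc 0 (1 / (1 - M.γ)) (M.measurable_ret t).aemeasurable
    (Filter.Eventually.of_forall fun x => ⟨M.ret_nonneg t x, M.ret_le t x⟩)

/-- Rewards lie in `[0, 1]` only almost surely. With clipped rewards the series converges and is
bounded on every stream, so summability and integrability need no exceptional set. -/
theorem MDP.value_eq (M : MDP S A) (π : Policy S A) (t : ℕ) (h : Hist S A t) :
    M.value π t h = ∫ x, M.ret t x ∂(M.law π t h) := by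
  refine integral_congr_ae ?_
  filter_upwards [M.ae_reward_mem π t h] with x hx
  exact tsum_congr fun k => by rw [clip_of_mem (hx k)]

theorem MDP.value_nonneg (M : MDP S A) (π : Policy S A) (t : ℕ) (h : Hist S A t) :
    0 ≤ M.value π t h := by
  rw [M.value_eq]
  exact integral_nonneg fun x => M.ret_nonneg t x

theorem MDP.value_le (M : MDP S A) (π : Policy S A) (t : ℕ) (h : Hist S A t) :
    M.value π t h ≤ 1 / (1 - M.γ) := by
  rw [M.value_eq]
  refine (integral_mono (M.integrable_ret t _) (integrable_const (1 / (1 - M.γ)))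
    fun x => M.ret_le t x).trans ?_
  simp

theorem MDP.measurable_value (M : MDP S A) (π : Policy S A) (t : ℕ) :
    Measurable (M.value π t) := by
  have e : M.value π t = fun h => ∫ x, M.ret t x ∂(M.law π t h) := funext fun h => M.value_eq π t h
  rw [e]
  exact ((M.measurable_ret t).stronglyMeasurable.integral_kernel
    (κ := Kernel.traj (X := Obs S A) (M.stepKernel π) t)).measurable

theorem MDP.integrable_next_reward (M : MDP S A) (π : Policy S A) (t : ℕ) (h : Hist S A t) :
    Integrable (fun y : A × ℝ × S => y.2.1) (M.next π t h) :=
  Integrable.of_mem_Icc 0 1 (measurable_fst.comp measurable_snd).aemeasurable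
    (M.next_reward_mem π t h)

theorem MDP.integrable_next_value (M : MDP S A) (π : Policy S A) (t : ℕ) (h : Hist S A t) :
    Integrable (fun y : A × ℝ × S => M.value π (t + 1) (h.snoc y)) (M.next π t h) :=
  Integrable.of_mem_Icc 0 (1 / (1 - M.γ))
    ((M.measurable_value π (t + 1)).comp h.measurable_snoc_right).aemeasurable
    (Filter.Eventually.of_forall fun _ => ⟨M.value_nonneg π _ _, M.value_le π _ _⟩)

/-- The Bellman equation of a history-dependent policy. -/
theorem MDP.value_bellman (M : MDP S A) (π : Policy S A) (t : ℕ) (h : Hist S A t) :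
    M.value π t h =
      ∫ y, (y.2.1 + M.γ * M.value π (t + 1) (h.snoc y)) ∂(M.next π t h) := by
  rw [M.value_eq, M.integral_law π t h (M.measurable_ret t) (M.integrable_ret t _)]
  refine integral_congr_ae ?_
  filter_upwards [M.next_reward_mem π t h] with y hy
  -- Under the law that continues `h.snoc y`, the reward at time `t` is almost surely the recorded
  -- one.
  have h1 : ∀ᵐ x ∂(M.law π (t + 1) (h.snoc y)), M.ret t x = y.2.1 + M.γ * M.ret (t + 1) x := by
    filter_upwards [M.ae_law_hist π (t + 1) (h.snoc y) (p := fun h' => h'.last.2.1 = y.2.1)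
      (((measurable_fst.comp measurable_snd).comp Hist.measurable_last)
        (measurableSet_singleton y.2.1)) (by rw [Hist.last_snoc])] with x hx
    rw [M.ret_eq, Stream.reward_eq, hx, clip_of_mem hy]
  rw [integral_congr_ae h1, integral_add (integrable_const _)
    ((M.integrable_ret (t + 1) _).const_mul _), integral_const_mul, ← M.value_eq]
  simp

/-- The expected value of `r + γ v(s')` after the pair `p = (s, a)`. -/
def MDP.backup (M : MDP S A) (v : S → ℝ) (p : S × A) : ℝ :=
  ∫ z, (z.1 + M.γ * v z.2) ∂(M.outcome p)

theorem MDP.ae_reward_add_mem (M : MDP S A) {v : S → ℝ} {b : ℝ} (h0 : ∀ s, 0 ≤ v s)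
    (hb : ∀ s, v s ≤ b) (p : S × A) :
    ∀ᵐ z ∂(M.outcome p), z.1 + M.γ * v z.2 ∈ Set.Icc 0 (1 + M.γ * b) := by
  filter_upwards [M.outcome_reward_mem p] with z hz
  exact ⟨add_nonneg hz.1 (mul_nonneg M.γ_nonneg (h0 _)),
    add_le_add hz.2 (mul_le_mul_of_nonneg_left (hb _) M.γ_nonneg)⟩

theorem MDP.backup_nonneg (M : MDP S A) {v : S → ℝ} (h : ∀ s, 0 ≤ v s) (p : S × A) :
    0 ≤ M.backup v p := by
  refine integral_nonneg_of_ae ?_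
  filter_upwards [M.outcome_reward_mem p] with z hz
  exact add_nonneg hz.1 (mul_nonneg M.γ_nonneg (h _))

variable [Finite S] [MeasurableSingletonClass S]

theorem measurable_reward_add (γ : ℝ) (v : S → ℝ) :
    Measurable fun z : ℝ × S => z.1 + γ * v z.2 :=
  measurable_fst.add (((measurable_of_finite v).comp measurable_snd).const_mul γ)

theorem MDP.integrable_backup (M : MDP S A) (v : S → ℝ) (p : S × A) :
    Integrable (fun z : ℝ × S => z.1 + M.γ * v z.2) (M.outcome p) := by
  refine Integrable.add (Integrable.of_mem_Icc 0 1 measurable_fst.aemeasurable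
    (M.outcome_reward_mem p)) (Integrable.const_mul ?_ _)
  obtain ⟨b, hb⟩ := (Set.finite_range v).bddAbove
  obtain ⟨a, ha⟩ := (Set.finite_range v).bddBelow
  exact Integrable.of_mem_Icc a b ((measurable_of_finite v).comp measurable_snd).aemeasurable
    (Filter.Eventually.of_forall fun z => ⟨ha ⟨z.2, rfl⟩, hb ⟨z.2, rfl⟩⟩)

theorem MDP.backup_mono (M : MDP S A) {v w : S → ℝ} (h : ∀ s, v s ≤ w s) (p : S × A) :
    M.backup v p ≤ M.backup w p :=
  integral_mono (M.integrable_backup v p) (M.integrable_backup w p) fun z =>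
    add_le_add le_rfl (mul_le_mul_of_nonneg_left (h z.2) M.γ_nonneg)

theorem MDP.backup_le (M : MDP S A) {v : S → ℝ} {b : ℝ} (h : ∀ s, v s ≤ b) (p : S × A) :
    M.backup v p ≤ 1 + M.γ * b := by
  have e : ∫ _, (1 + M.γ * b) ∂(M.outcome p) = 1 + M.γ * b := by simp
  rw [← e]
  refine integral_mono_ae (M.integrable_backup v p) (integrable_const _) ?_
  filter_upwards [M.outcome_reward_mem p] with z hz
  exact add_le_add hz.2 (mul_le_mul_of_nonneg_left (h _) M.γ_nonneg)

theorem MDP.integrable_next_backup (M : MDP S A) (π : Policy S A) (t : ℕ) (h : Hist S A t)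
    (v : S → ℝ) :
    Integrable (fun y : A × ℝ × S => y.2.1 + M.γ * v y.2.2) (M.next π t h) := by
  refine Integrable.add (M.integrable_next_reward π t h) (Integrable.const_mul ?_ _)
  obtain ⟨b, hb⟩ := (Set.finite_range v).bddAbove
  obtain ⟨a, ha⟩ := (Set.finite_range v).bddBelow
  exact Integrable.of_mem_Icc a b
    ((measurable_of_finite v).comp (measurable_snd.comp measurable_snd)).aemeasurable
    (Filter.Eventually.of_forall fun z => ⟨ha ⟨z.2.2, rfl⟩, hb ⟨z.2.2, rfl⟩⟩)

theorem MDP.integral_next_backup (M : MDP S A) (π : Policy S A) (t : ℕ) (h : Hist S A t)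
    (v : S → ℝ) :
    ∫ y, (y.2.1 + M.γ * v y.2.2) ∂(M.next π t h) =
      ∫ a, M.backup v (h.state, a) ∂(π.act t h) :=
  M.integral_next π t h (M.integrable_next_backup π t h v)

/-- A bounded function that dominates its own one-step backups dominates the value of every
policy. -/
theorem MDP.value_le_of_backup_le [Finite A] [MeasurableSingletonClass A] (M : MDP S A)
    {v : S → ℝ} (h0 : ∀ s, 0 ≤ v s) (hv : ∀ s a, M.backup v (s, a) ≤ v s) (π : Policy S A)
    (t : ℕ) (h : Hist S A t) : M.value π t h ≤ v h.state := by
  -- Applying the Bellman equation `k` times leaves the error `γ ^ k / (1 - γ)`. The statement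
  -- covers all histories because each application passes to longer ones.
  have key : ∀ (k t : ℕ) (h : Hist S A t),
      M.value π t h ≤ v h.state + M.γ ^ k * (1 / (1 - M.γ)) := by
    intro k
    induction k with
    | zero =>
      intro t h
      have h1 := M.value_le π t h
      have h2 := h0 h.state
      simp only [pow_zero, one_mul]
      linarith
    | succ k ih =>
      intro t h
      have := π.markov t
      have i1 := M.integrable_next_backup π t h v
      calc M.value π t h
          = ∫ y, (y.2.1 + M.γ * M.value π (t + 1) (h.snoc y)) ∂(M.next π t h) :=
            M.value_bellman π t h
        _ ≤ ∫ y, ((y.2.1 + M.γ * v y.2.2) + M.γ ^ (k + 1) * (1 / (1 - M.γ))) ∂(M.next π t h) := by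
            refine integral_mono ((M.integrable_next_reward π t h).add
              ((M.integrable_next_value π t h).const_mul _)) (i1.add (integrable_const _)) ?_
            intro y
            have h1 := mul_le_mul_of_nonneg_left (ih (t + 1) (h.snoc y)) M.γ_nonneg
            rw [Hist.state_snoc] at h1
            dsimp only
            rw [pow_succ']
            linarith
        _ = ∫ a, M.backup v (h.state, a) ∂(π.act t h) + M.γ ^ (k + 1) * (1 / (1 - M.γ)) := by
            rw [integral_add i1 (integrable_const _), M.integral_next_backup]
            simp
        _ ≤ v h.state + M.γ ^ (k + 1) * (1 / (1 - M.γ)) := by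
            have h2 : ∫ a, M.backup v (h.state, a) ∂(π.act t h) ≤
                ∫ _, v h.state ∂(π.act t h) :=
              integral_mono Integrable.of_finite (integrable_const _) fun a => hv _ a
            simp only [integral_const, probReal_univ, one_smul] at h2
            linarith
  have lim : Filter.Tendsto (fun k : ℕ => v h.state + M.γ ^ k * (1 / (1 - M.γ))) Filter.atTop
      (nhds (v h.state + 0 * (1 / (1 - M.γ)))) :=
    ((tendsto_pow_atTop_nhds_zero_of_lt_one M.γ_nonneg M.γ_lt_one).mul_const _).const_add _
  rw [zero_mul, add_zero] at lim
  exact ge_of_tendsto' lim fun k => key k t h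

theorem MDP.optValue_le_of_backup_le [Finite A] [MeasurableSingletonClass A] (M : MDP S A)
    {v : S → ℝ} (h0 : ∀ s, 0 ≤ v s) (hv : ∀ s a, M.backup v (s, a) ≤ v s)
    [Nonempty (Policy S A)] (s : S) : M.optValue s ≤ v s :=
  ciSup_le fun π => M.value_le_of_backup_le h0 hv π 0 (Hist.init s)

end Values

/-! ### One step of the algorithm: its possible outcomes and its measurability. -/

namespace Memory

variable {S A : Type u}

/-- The pair `p` is learned from when it is experienced in the memory state `σ`. -/
def Sampled (σ : Memory S A) (p : S × A) : Prop := σ.learn p = true ∨ σ.b p ≤ σ.tstar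

/-- The two memories agree in all variables of the pairs other than `p`. -/
structure AgreeOff (σ σ' : Memory S A) (p : S × A) : Prop where
  Q : ∀ q, q ≠ p → σ'.Q q = σ.Q q
  E : ∀ q, q ≠ p → σ'.E q = σ.E q
  Qt : ∀ q, q ≠ p → σ'.Qt q = σ.Qt q
  Et : ∀ q, q ≠ p → σ'.Et q = σ.Et q
  n : ∀ q, q ≠ p → σ'.n q = σ.n q
  b : ∀ q, q ≠ p → σ'.b q = σ.b q
  learn : ∀ q, q ≠ p → σ'.learn q = σ.learn q

/-- A successful update of `p` at time `t`, with final inner loop estimates `qt` and `et`. -/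
structure SuccessStep (P : Params) (σ σ' : Memory S A) (t : ℕ) (p : S × A) (qt et : ℝ) : Prop where
  sampled : σ.Sampled p
  le : P.ε₁ ≤ σ.Q' P p - (qt + P.ρ / √((σ.n p + 1 : ℕ) : ℝ) + P.bonus et)
  Q : σ'.Q p = qt + P.ρ / √((σ.n p + 1 : ℕ) : ℝ)
  E : σ'.E p = et
  Qt : σ'.Qt p = 0
  Et : σ'.Et p = 0
  n : σ'.n p = 0
  b : σ'.b p = t
  tstar : σ'.tstar = t

/-- A failed attempted update of `p` at time `t`. -/
structure FailStep (P : Params) (σ σ' : Memory S A) (t : ℕ) (p : S × A) (qt et : ℝ) : Prop where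
  sampled : σ.Sampled p
  lt : σ.Q' P p - (qt + P.ρ / √((σ.n p + 1 : ℕ) : ℝ) + P.bonus et) < P.ε₁
  n_succ : σ.n p + 1 = P.m
  Q : σ'.Q p = σ.Q p
  E : σ'.E p = σ.E p
  Qt : σ'.Qt p = 0
  Et : σ'.Et p = 0
  n : σ'.n p = 0
  b : σ'.b p = t
  tstar : σ'.tstar = σ.tstar
  learn : σ'.learn p = true ↔ σ.b p ≤ σ.tstar

/-- A sample of `p` at time `t` that does not end the attempted update. -/
structure ContinueStep (P : Params) (σ σ' : Memory S A) (p : S × A) (qt et : ℝ) : Prop where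
  sampled : σ.Sampled p
  n_succ : σ.n p + 1 ≠ P.m
  Q : σ'.Q p = σ.Q p
  E : σ'.E p = σ.E p
  Qt : σ'.Qt p = qt
  Et : σ'.Et p = et
  n : σ'.n p = σ.n p + 1
  b : σ'.b p = σ.b p
  tstar : σ'.tstar = σ.tstar
  learn : σ'.learn p = true

theorem agreeOff_relearn (σ : Memory S A) (p : S × A) : AgreeOff σ (σ.relearn p) p := by
  unfold relearn
  split_ifs
  · constructor <;> intro q hq <;> simp [hq]
  · constructor <;> intro q hq <;> rfl

theorem AgreeOff.trans {σ σ' σ'' : Memory S A} {p : S × A} (h : AgreeOff σ σ' p)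
    (h' : AgreeOff σ' σ'' p) : AgreeOff σ σ'' p where
  Q q hq := (h'.Q q hq).trans (h.Q q hq)
  E q hq := (h'.E q hq).trans (h.E q hq)
  Qt q hq := (h'.Qt q hq).trans (h.Qt q hq)
  Et q hq := (h'.Et q hq).trans (h.Et q hq)
  n q hq := (h'.n q hq).trans (h.n q hq)
  b q hq := (h'.b q hq).trans (h.b q hq)
  learn q hq := (h'.learn q hq).trans (h.learn q hq)

/-- All variables of the memory depend measurably on a parameter. -/
structure MeasurableFamily {α : Type*} [MeasurableSpace α] (f : α → Memory S A) : Prop where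
  Q : ∀ p, Measurable fun x => (f x).Q p
  E : ∀ p, Measurable fun x => (f x).E p
  Qt : ∀ p, Measurable fun x => (f x).Qt p
  Et : ∀ p, Measurable fun x => (f x).Et p
  n : ∀ p, Measurable fun x => (f x).n p
  b : ∀ p, Measurable fun x => (f x).b p
  learn : ∀ p, Measurable fun x => (f x).learn p
  tstar : Measurable fun x => (f x).tstar

section Measurability

variable {α : Type*} [MeasurableSpace α]

theorem _root_.Measurable.update_const_index {ι β : Type*} [DecidableEq ι] [MeasurableSpace β]
    {g : α → ι → β} {v : α → β} (hg : ∀ i, Measurable fun x => g x i) (hv : Measurable v) (j i : ι) :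
    Measurable fun x => Function.update (g x) j (v x) i := by
  by_cases h : i = j
  · subst h
    simpa using hv
  · simpa [h] using hg i

theorem _root_.Measurable.comp_ite {β γ : Type*} [MeasurableSpace γ] {c : α → Prop}
    [DecidablePred c] {f g : α → β} (F : β → γ) (hc : MeasurableSet {x | c x})
    (hf : Measurable fun x => F (f x)) (hg : Measurable fun x => F (g x)) :
    Measurable fun x => F (if c x then f x else g x) := by
  have e : (fun x => F (if c x then f x else g x)) = fun x => if c x then F (f x) else F (g x) :=
    funext fun x => apply_ite F _ _ _
  rw [e]
  exact Measurable.ite hc hf hg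

theorem MeasurableFamily.ite {c : α → Prop} [DecidablePred c] {f g : α → Memory S A}
    (hc : MeasurableSet {x | c x}) (hf : MeasurableFamily f) (hg : MeasurableFamily g) :
    MeasurableFamily fun x => if c x then f x else g x where
  Q p := Measurable.comp_ite (fun σ : Memory S A => σ.Q p) hc (hf.Q p) (hg.Q p)
  E p := Measurable.comp_ite (fun σ : Memory S A => σ.E p) hc (hf.E p) (hg.E p)
  Qt p := Measurable.comp_ite (fun σ : Memory S A => σ.Qt p) hc (hf.Qt p) (hg.Qt p)
  Et p := Measurable.comp_ite (fun σ : Memory S A => σ.Et p) hc (hf.Et p) (hg.Et p)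
  n p := Measurable.comp_ite (fun σ : Memory S A => σ.n p) hc (hf.n p) (hg.n p)
  b p := Measurable.comp_ite (fun σ : Memory S A => σ.b p) hc (hf.b p) (hg.b p)
  learn p := Measurable.comp_ite (fun σ : Memory S A => σ.learn p) hc (hf.learn p) (hg.learn p)
  tstar := Measurable.comp_ite (fun σ : Memory S A => σ.tstar) hc hf.tstar hg.tstar

theorem _root_.RL.Params.measurable_bonus (P : Params) : Measurable P.bonus :=
  measurable_const.div (Real.continuous_sqrt.measurable.comp
    (Real.measurable_log.div_const (Real.log P.η)))

theorem _root_.Measurable.sup'_univ {ι : Type*} [Fintype ι] [Nonempty ι] {f : α → ι → ℝ}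
    (hf : ∀ i, Measurable fun x => f x i) :
    Measurable fun x => Finset.univ.sup' Finset.univ_nonempty (f x) := by
  have h := Finset.measurable_sup' (s := (Finset.univ : Finset ι)) Finset.univ_nonempty
    (f := fun i x => f x i) fun i _ => hf i
  convert h using 1
  funext x
  rw [Finset.sup'_apply]

theorem MeasurableFamily.relearn {f : α → Memory S A} (hf : MeasurableFamily f) (p : S × A) :
    MeasurableFamily fun x => (f x).relearn p := by
  classical
  unfold Memory.relearn
  refine MeasurableFamily.ite (measurableSet_le (hf.b p) hf.tstar) ?_ hf
  exact { hf with learn := fun q => Measurable.update_const_index hf.learn measurable_const p q }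

theorem MeasurableFamily.reset {f : α → Memory S A} (hf : MeasurableFamily f) (t : ℕ)
    (p : S × A) : MeasurableFamily fun x => (f x).reset t p := by
  classical
  exact { hf with
    n := fun q => Measurable.update_const_index hf.n measurable_const p q
    Qt := fun q => Measurable.update_const_index hf.Qt measurable_const p q
    Et := fun q => Measurable.update_const_index hf.Et measurable_const p q
    b := fun q => Measurable.update_const_index hf.b measurable_const p q }

theorem MeasurableFamily.Q' {f : α → Memory S A} (hf : MeasurableFamily f) (P : Params)
    (p : S × A) : Measurable fun x => (f x).Q' P p :=
  (hf.Q p).add (P.measurable_bonus.comp (hf.E p))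

theorem MeasurableFamily.attempt {f : α → Memory S A} (hf : MeasurableFamily f) (P : Params)
    (t : ℕ) (p : S × A) : MeasurableFamily fun x => (f x).attempt P t p := by
  classical
  have hn : Measurable fun x => P.ρ / √(((f x).n p : ℕ) : ℝ) :=
    (measurable_from_nat (f := fun k : ℕ => P.ρ / √(k : ℝ))).comp (hf.n p)
  unfold Memory.attempt
  refine MeasurableFamily.ite (measurableSet_le measurable_const ((hf.Q' P p).sub
    (((hf.Qt p).add hn).add (P.measurable_bonus.comp (hf.Et p))))) ?_ ?_
  · refine MeasurableFamily.reset ?_ t p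
    exact { hf with
      Q := fun q => Measurable.update_const_index hf.Q ((hf.Qt p).add hn) p q
      E := fun q => Measurable.update_const_index hf.E (hf.Et p) p q
      tstar := measurable_const }
  · refine MeasurableFamily.ite (hf.n p (measurableSet_singleton P.m)) ?_ hf
    refine MeasurableFamily.reset ?_ t p
    refine MeasurableFamily.ite (measurableSet_lt hf.tstar (hf.b p)) ?_ hf
    exact { hf with learn := fun q => Measurable.update_const_index hf.learn measurable_const p q }

end Measurability

variable [Fintype A] [Nonempty A]

/-- The greedy value of the current Q-value estimates. -/
def V (σ : Memory S A) (s : S) : ℝ :=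
  Finset.univ.sup' Finset.univ_nonempty fun a : A => σ.Q (s, a)

theorem Q_le_V (σ : Memory S A) (s : S) (a : A) : σ.Q (s, a) ≤ σ.V s :=
  Finset.le_sup' (fun a : A => σ.Q (s, a)) (Finset.mem_univ a)

theorem V_le {σ : Memory S A} {s : S} {c : ℝ} (h : ∀ a, σ.Q (s, a) ≤ c) : σ.V s ≤ c :=
  Finset.sup'_le _ _ fun a _ => h a

theorem V_eq_of_Q_eq {σ σ' : Memory S A} (h : ∀ q, σ'.Q q = σ.Q q) : σ'.V = σ.V := by
  funext s
  simp [V, h]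

/-- The inner loop estimate of the Q-value after one more sample. -/
def nextQt (P : Params) (σ : Memory S A) (p : S × A) (r : ℝ) (s' : S) : ℝ :=
  (1 - 1 / ((σ.n p + 1 : ℕ) : ℝ)) * σ.Qt p + 1 / ((σ.n p + 1 : ℕ) : ℝ) * (r + P.γ * σ.V s')

/-- The inner loop estimate of the exploration value after one more sample. -/
def nextEt (P : Params) (σ : Memory S A) (p : S × A) (s' : S) : ℝ :=
  (1 - 1 / ((σ.n p + 1 : ℕ) : ℝ)) * σ.Et p + 1 / ((σ.n p + 1 : ℕ) : ℝ) *
    (P.γE * Finset.univ.sup' Finset.univ_nonempty fun a' : A => σ.E (s', a'))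

theorem agreeOff_step (P : Params) (σ : Memory S A) (t : ℕ) (s : S) (a : A) (r : ℝ) (s' : S) :
    AgreeOff σ (σ.step P t s a r s') (s, a) := by
  refine (σ.agreeOff_relearn (s, a)).trans ?_
  unfold step
  dsimp only
  split_ifs
  · refine AgreeOff.trans (σ' := (σ.relearn (s, a)).sample P (s, a) r s') ?_ ?_
    · constructor <;> intro q hq <;> simp [sample, hq]
    · unfold attempt
      split_ifs <;> constructor <;> intro q hq <;> simp [reset, hq]
  · constructor <;> intro q hq <;> rfl

/-- The invariants below are proved by distinguishing these four outcomes, with `agreeOff_step` for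
the other pairs. In the first outcome the whole memory is unchanged, because `relearn` does nothing
when `b` exceeds `tstar`. -/
theorem step_cases (P : Params) (σ : Memory S A) (t : ℕ) (s : S) (a : A) (r : ℝ) (s' : S) :
    (¬ σ.Sampled (s, a) ∧ σ.step P t s a r s' = σ) ∨
    SuccessStep P σ (σ.step P t s a r s') t (s, a) (σ.nextQt P (s, a) r s')
      (σ.nextEt P (s, a) s') ∨
    FailStep P σ (σ.step P t s a r s') t (s, a) (σ.nextQt P (s, a) r s')
      (σ.nextEt P (s, a) s') ∨
    ContinueStep P σ (σ.step P t s a r s') (s, a) (σ.nextQt P (s, a) r s')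
      (σ.nextEt P (s, a) s') := by
  by_cases hs : σ.Sampled (s, a)
  · have hl : (σ.relearn (s, a)).learn (s, a) = true := by
      unfold relearn
      split_ifs with h
      · simp
      · exact hs.resolve_right h
    have hQ : (σ.relearn (s, a)).Q = σ.Q := by unfold relearn; split_ifs <;> rfl
    have hE : (σ.relearn (s, a)).E = σ.E := by unfold relearn; split_ifs <;> rfl
    have hQt : (σ.relearn (s, a)).Qt = σ.Qt := by unfold relearn; split_ifs <;> rfl
    have hEt : (σ.relearn (s, a)).Et = σ.Et := by unfold relearn; split_ifs <;> rfl
    have hn : (σ.relearn (s, a)).n = σ.n := by unfold relearn; split_ifs <;> rfl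
    have hb : (σ.relearn (s, a)).b = σ.b := by unfold relearn; split_ifs <;> rfl
    have ht : (σ.relearn (s, a)).tstar = σ.tstar := by unfold relearn; split_ifs <;> rfl
    have e : σ.step P t s a r s' =
        ((σ.relearn (s, a)).sample P (s, a) r s').attempt P t (s, a) := by
      unfold step
      simp [hl]
    have eQt : ((σ.relearn (s, a)).sample P (s, a) r s').Qt (s, a) = σ.nextQt P (s, a) r s' := by
      simp [sample, hn, hQt, hQ, nextQt, V]
    have eEt : ((σ.relearn (s, a)).sample P (s, a) r s').Et (s, a) = σ.nextEt P (s, a) s' := by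
      simp [sample, hn, hEt, hE, nextEt]
    have en : ((σ.relearn (s, a)).sample P (s, a) r s').n (s, a) = σ.n (s, a) + 1 := by
      simp [sample, hn]
    have eQ' : ((σ.relearn (s, a)).sample P (s, a) r s').Q' P (s, a) = σ.Q' P (s, a) := by
      simp [sample, Q', hQ, hE]
    have eQ : ((σ.relearn (s, a)).sample P (s, a) r s').Q (s, a) = σ.Q (s, a) := by
      simp [sample, hQ]
    have eE : ((σ.relearn (s, a)).sample P (s, a) r s').E (s, a) = σ.E (s, a) := by
      simp [sample, hE]
    have eb : ((σ.relearn (s, a)).sample P (s, a) r s').b (s, a) = σ.b (s, a) := by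
      simp [sample, hb]
    have et : ((σ.relearn (s, a)).sample P (s, a) r s').tstar = σ.tstar := by
      simp [sample, ht]
    have el : ((σ.relearn (s, a)).sample P (s, a) r s').learn (s, a) = true := by
      simp [sample, hl]
    rw [e]
    generalize (σ.relearn (s, a)).sample P (s, a) r s' = τ at eQt eEt en eQ' eQ eE eb et el ⊢
    right
    unfold attempt
    rw [eQt, eEt, en, eQ', et, eb]
    split_ifs with h1 h2 h3
    · left
      exact ⟨hs, h1, by simp [reset], by simp [reset], by simp [reset], by simp [reset],
        by simp [reset], by simp [reset], rfl⟩
    · right; left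
      exact ⟨hs, not_le.1 h1, h2, by simp [reset, eQ], by simp [reset, eE], by simp [reset],
        by simp [reset], by simp [reset], by simp [reset], by simp [reset],
        by simp [reset, h3]⟩
    · right; left
      exact ⟨hs, not_le.1 h1, h2, by simp [reset, eQ], by simp [reset, eE], by simp [reset],
        by simp [reset], by simp [reset], by simp [reset], by simp [reset, et],
        by simp [reset, el, not_lt.1 h3]⟩
    · right; right
      exact ⟨hs, h2, eQ, eE, eQt, eEt, en, eb, et, el⟩
  · left
    refine ⟨hs, ?_⟩
    have h1 : ¬ σ.b (s, a) ≤ σ.tstar := fun h => hs (Or.inr h)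
    have h2 : ¬ σ.learn (s, a) = true := fun h => hs (Or.inl h)
    unfold step relearn
    simp [h1, h2]

section Measurability

variable {α : Type*} [MeasurableSpace α]

theorem MeasurableFamily.sample {f : α → Memory S A} (hf : MeasurableFamily f) (P : Params)
    (p : S × A) {r : α → ℝ} (hr : Measurable r) (s' : S) :
    MeasurableFamily fun x => (f x).sample P p (r x) s' := by
  classical
  have hα : Measurable fun x => 1 / ((((f x).n p + 1 : ℕ)) : ℝ) :=
    measurable_const.div ((measurable_from_nat (f := fun k : ℕ => ((k + 1 : ℕ) : ℝ))).comp (hf.n p))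
  exact { hf with
    n := fun q => Measurable.update_const_index hf.n
      ((measurable_from_nat (f := fun k : ℕ => k + 1)).comp (hf.n p)) p q
    Qt := fun q => Measurable.update_const_index hf.Qt
      (((measurable_const.sub hα).mul (hf.Qt p)).add
        (hα.mul (hr.add ((Measurable.sup'_univ fun a' => hf.Q (s', a')).const_mul _)))) p q
    Et := fun q => Measurable.update_const_index hf.Et
      (((measurable_const.sub hα).mul (hf.Et p)).add
        (hα.mul ((Measurable.sup'_univ fun a' => hf.E (s', a')).const_mul _))) p q }

theorem MeasurableFamily.step {f : α → Memory S A} (hf : MeasurableFamily f) (P : Params)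
    (t : ℕ) (s : S) (a : A) {r : α → ℝ} (hr : Measurable r) (s' : S) :
    MeasurableFamily fun x => (f x).step P t s a (r x) s' := by
  have h1 := hf.relearn (s, a)
  unfold Memory.step
  exact MeasurableFamily.ite (h1.learn (s, a) (measurableSet_singleton true))
    ((h1.sample P (s, a) hr s').attempt P t (s, a)) h1

theorem MeasurableFamily.V {f : α → Memory S A} (hf : MeasurableFamily f) (s : S) :
    Measurable fun x => (f x).V s :=
  Measurable.sup'_univ fun a => hf.Q (s, a)

end Measurability

end Memory

/-! ### Admissible inputs and elementary bounds on the memory. -/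

/-- The conditions on the inputs of the algorithm. -/
structure Params.Admissible (P : Params) : Prop where
  γ_nonneg : 0 ≤ P.γ
  γ_lt_one : P.γ < 1
  ε₁_pos : 0 < P.ε₁
  ε₁_lt : P.ε₁ < 1 / 2
  m_pos : 0 < P.m
  lam_pos : 0 < P.lam
  lam_le : P.lam ≤ P.ε₁
  γE_pos : 0 < P.γE
  γE_lt_one : P.γE < 1
  ρ_eq : P.ρ = P.ε₁ * √(P.m : ℝ)
  η_eq : P.η = 1 - P.ε₁

/-- The largest possible value `1 / (1 - γ)`. -/
def Params.B (P : Params) : ℝ := 1 / (1 - P.γ)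

namespace Params.Admissible

variable {P : Params} (hP : P.Admissible)
include hP

theorem one_sub_γ_pos : 0 < 1 - P.γ := sub_pos.2 hP.γ_lt_one

theorem B_pos : 0 < P.B := one_div_pos.2 hP.one_sub_γ_pos

theorem one_le_B : 1 ≤ P.B := by
  rw [Params.B, le_div_iff₀ hP.one_sub_γ_pos]
  linarith [hP.γ_nonneg]

theorem one_sub_γ_mul_B : (1 - P.γ) * P.B = 1 := mul_one_div_cancel hP.one_sub_γ_pos.ne'

theorem one_add_γ_mul_B : 1 + P.γ * P.B = P.B := by
  linarith [hP.one_sub_γ_mul_B, sub_mul 1 P.γ P.B]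

theorem ρ_nonneg : 0 ≤ P.ρ := by
  rw [hP.ρ_eq]
  exact mul_nonneg hP.ε₁_pos.le (Real.sqrt_nonneg _)

theorem one_le_m : (1 : ℝ) ≤ P.m := Nat.one_le_cast.2 hP.m_pos

theorem ρ_mul_sqrt_m : P.ρ * √(P.m : ℝ) = P.ε₁ * P.m := by
  rw [hP.ρ_eq, mul_assoc, Real.mul_self_sqrt (Nat.cast_nonneg _)]

theorem ρ_mul_sqrt_le {k : ℕ} (hk : k ≤ P.m) : P.ρ * √(k : ℝ) ≤ P.ε₁ * P.m := by
  rw [← hP.ρ_mul_sqrt_m]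
  exact mul_le_mul_of_nonneg_left (Real.sqrt_le_sqrt (Nat.cast_le.2 hk)) hP.ρ_nonneg

theorem bonus_nonneg (e : ℝ) : 0 ≤ P.bonus e := div_nonneg hP.lam_pos.le (Real.sqrt_nonneg _)

/-- Exploration values are at most `η < 1`, so `log_η e` is at least one. Together with
`bonus_nonneg` this is all that the analysis needs about the exploration values. -/
theorem bonus_le {e : ℝ} (h0 : 0 ≤ e) (he : e ≤ P.η) : P.bonus e ≤ P.lam := by
  -- At `e = 0` the conventions `log 0 = 0` and division by zero make the bonus vanish.
  rcases h0.eq_or_lt with rfl | h0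
  · simp [Params.bonus, hP.lam_pos.le]
  · have hη0 : 0 < P.η := h0.trans_le he
    have hη1 : P.η < 1 := by rw [hP.η_eq]; linarith [hP.ε₁_pos]
    have hlog : Real.log P.η < 0 := Real.log_neg hη0 hη1
    have h1 : 1 ≤ Real.logb P.η e := by
      rw [Real.logb, ← neg_div_neg_eq, le_div_iff₀ (neg_pos.2 hlog), one_mul]
      exact neg_le_neg (Real.log_le_log h0 he)
    exact div_le_self hP.lam_pos.le (Real.one_le_sqrt.2 h1)

end Params.Admissible

theorem natCast_mul_div_sqrt (c : ℝ) {k : ℕ} (hk : 0 < k) :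
    (k : ℝ) * (c / √(k : ℝ)) = c * √(k : ℝ) := by
  have h : (0 : ℝ) < √(k : ℝ) := Real.sqrt_pos.2 (Nat.cast_pos.2 hk)
  have h2 : √(k : ℝ) * √(k : ℝ) = k := Real.mul_self_sqrt (Nat.cast_nonneg k)
  rw [mul_div_assoc', div_eq_iff h.ne', mul_assoc c, h2, mul_comm]

namespace Memory

variable {S A : Type u} [Fintype A] [Nonempty A]

/-- The bounds on the variables of the algorithm that hold after `t` steps with nonnegative
rewards. -/
structure Bounded (P : Params) (t : ℕ) (σ : Memory S A) : Prop where
  Q_nonneg : ∀ p, 0 ≤ σ.Q p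
  Q_le : ∀ p, σ.Q p ≤ P.B
  E_nonneg : ∀ p, 0 ≤ σ.E p
  E_le : ∀ p, σ.E p ≤ P.η
  Qt_nonneg : ∀ p, 0 ≤ σ.Qt p
  Et_nonneg : ∀ p, 0 ≤ σ.Et p
  Et_le : ∀ p, σ.Et p ≤ P.η
  n_lt : ∀ p, σ.n p < P.m
  b_le : ∀ p, σ.b p ≤ t
  tstar_le : σ.tstar ≤ t

variable {P : Params} {t : ℕ} {σ : Memory S A}

omit [Fintype A] [Nonempty A] in
theorem bounded_init (hP : P.Admissible) : Bounded P 0 (init P : Memory S A) where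
  Q_nonneg _ := hP.B_pos.le
  Q_le _ := le_rfl
  E_nonneg _ := by simp only [init]; linarith [hP.ε₁_lt]
  E_le _ := by rw [hP.η_eq]; exact le_rfl
  Qt_nonneg _ := le_rfl
  Et_nonneg _ := le_rfl
  Et_le _ := by simp only [init]; linarith [hP.ε₁_lt, hP.η_eq]
  n_lt _ := hP.m_pos
  b_le _ := le_rfl
  tstar_le := le_rfl

/-- The step sizes `1 / n` make the estimate a running mean, so the counter times the estimate is
the sum of the samples; deviations are measured on that sum. -/
theorem nextQt_mul (P : Params) (σ : Memory S A) (p : S × A) (r : ℝ) (s' : S) :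
    ((σ.n p + 1 : ℕ) : ℝ) * σ.nextQt P p r s' = σ.n p * σ.Qt p + (r + P.γ * σ.V s') := by
  have h : ((σ.n p : ℝ) + 1) ≠ 0 := by positivity
  unfold nextQt
  push_cast
  field_simp
  ring

theorem stepSize_mem (k : ℕ) : 0 ≤ 1 / ((k + 1 : ℕ) : ℝ) ∧ 0 ≤ 1 - 1 / ((k + 1 : ℕ) : ℝ) := by
  refine ⟨by positivity, sub_nonneg.2 ?_⟩
  rw [div_le_one (by positivity)]
  exact_mod_cast Nat.le_add_left 1 k

namespace Bounded

theorem V_nonneg (h : Bounded P t σ) (s : S) : 0 ≤ σ.V s :=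
  (h.Q_nonneg (s, Classical.arbitrary A)).trans (σ.Q_le_V s _)

theorem V_le (h : Bounded P t σ) (s : S) : σ.V s ≤ P.B := Memory.V_le fun a => h.Q_le (s, a)

theorem nextQt_nonneg (h : Bounded P t σ) (hP : P.Admissible) {r : ℝ} (hr : 0 ≤ r) (p : S × A)
    (s' : S) : 0 ≤ σ.nextQt P p r s' :=
  add_nonneg (mul_nonneg (stepSize_mem _).2 (h.Qt_nonneg p))
    (mul_nonneg (stepSize_mem _).1 (add_nonneg hr (mul_nonneg hP.γ_nonneg (h.V_nonneg s'))))

theorem nextEt_mem (h : Bounded P t σ) (hP : P.Admissible) (p : S × A) (s' : S) :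
    0 ≤ σ.nextEt P p s' ∧ σ.nextEt P p s' ≤ P.η := by
  have h0 : 0 ≤ Finset.univ.sup' Finset.univ_nonempty fun a' : A => σ.E (s', a') :=
    (h.E_nonneg (s', Classical.arbitrary A)).trans
      (Finset.le_sup' (fun a' : A => σ.E (s', a')) (Finset.mem_univ _))
  have h1 : (Finset.univ.sup' Finset.univ_nonempty fun a' : A => σ.E (s', a')) ≤ P.η :=
    Finset.sup'_le _ _ fun a' _ => h.E_le (s', a')
  obtain ⟨a0, a1⟩ := stepSize_mem (σ.n p)
  have h2 := mul_nonneg hP.γE_pos.le h0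
  have h3 := (mul_le_of_le_one_left h0 hP.γE_lt_one.le).trans h1
  refine ⟨add_nonneg (mul_nonneg a1 (h.Et_nonneg p)) (mul_nonneg a0 h2), ?_⟩
  calc _ ≤ (1 - 1 / ((σ.n p + 1 : ℕ) : ℝ)) * P.η + 1 / ((σ.n p + 1 : ℕ) : ℝ) * P.η :=
        add_le_add (mul_le_mul_of_nonneg_left (h.Et_le p) a1) (mul_le_mul_of_nonneg_left h3 a0)
    _ = P.η := by ring

omit [Fintype A] [Nonempty A] in
theorem bonus_E_le (h : Bounded P t σ) (hP : P.Admissible) (p : S × A) :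
    P.bonus (σ.E p) ≤ P.lam := hP.bonus_le (h.E_nonneg p) (h.E_le p)

omit [Fintype A] [Nonempty A] in
theorem Q'_nonneg (h : Bounded P t σ) (hP : P.Admissible) (p : S × A) : 0 ≤ σ.Q' P p :=
  add_nonneg (h.Q_nonneg p) (hP.bonus_nonneg _)

/-- Q-value estimates never increase. -/
theorem Q_step_le (h : Bounded P t σ) (hP : P.Admissible) (s : S) (a : A) (r : ℝ) (s' : S)
    (q : S × A) : (σ.step P (t + 1) s a r s').Q q ≤ σ.Q q := by
  by_cases hq : q = (s, a)
  · subst hq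
    rcases σ.step_cases P (t + 1) s a r s' with c | c | c | c
    · rw [c.2]
    · have h1 := c.le
      rw [c.Q]
      have h2 := h.bonus_E_le hP (s, a)
      have h3 := hP.bonus_nonneg (σ.nextEt P (s, a) s')
      have h4 := hP.lam_le
      unfold Q' at h1
      linarith
    · rw [c.Q]
    · rw [c.Q]
  · rw [(σ.agreeOff_step P (t + 1) s a r s').Q q hq]

theorem V_step_le (h : Bounded P t σ) (hP : P.Admissible) (s : S) (a : A) (r : ℝ) (s' : S)
    (z : S) : (σ.step P (t + 1) s a r s').V z ≤ σ.V z :=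
  Memory.V_le fun a' => (h.Q_step_le hP s a r s' (z, a')).trans (σ.Q_le_V z a')

theorem step (h : Bounded P t σ) (hP : P.Admissible) (s : S) (a : A) {r : ℝ} (hr : 0 ≤ r)
    (s' : S) : Bounded P (t + 1) (σ.step P (t + 1) s a r s') := by
  have hag := σ.agreeOff_step P (t + 1) s a r s'
  have hQt := h.nextQt_nonneg hP hr (s, a) s'
  have hEt := h.nextEt_mem hP (s, a) s'
  have hη : 0 ≤ P.η := (h.E_nonneg (s, a)).trans (h.E_le (s, a))
  have hρ : 0 ≤ P.ρ / √((σ.n (s, a) + 1 : ℕ) : ℝ) := div_nonneg hP.ρ_nonneg (Real.sqrt_nonneg _)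
  have hn := h.n_lt (s, a)
  have hm := hP.m_pos
  have off : ∀ q, q ≠ (s, a) →
      0 ≤ (σ.step P (t + 1) s a r s').Q q ∧ 0 ≤ (σ.step P (t + 1) s a r s').E q ∧
      (σ.step P (t + 1) s a r s').E q ≤ P.η ∧ 0 ≤ (σ.step P (t + 1) s a r s').Qt q ∧
      0 ≤ (σ.step P (t + 1) s a r s').Et q ∧ (σ.step P (t + 1) s a r s').Et q ≤ P.η ∧
      (σ.step P (t + 1) s a r s').n q < P.m ∧ (σ.step P (t + 1) s a r s').b q ≤ t + 1 := by
    intro q hq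
    rw [hag.Q q hq, hag.E q hq, hag.Qt q hq, hag.Et q hq, hag.n q hq, hag.b q hq]
    exact ⟨h.Q_nonneg q, h.E_nonneg q, h.E_le q, h.Qt_nonneg q, h.Et_nonneg q, h.Et_le q, h.n_lt q,
      (h.b_le q).trans (Nat.le_succ t)⟩
  have on : 0 ≤ (σ.step P (t + 1) s a r s').Q (s, a) ∧ 0 ≤ (σ.step P (t + 1) s a r s').E (s, a) ∧
      (σ.step P (t + 1) s a r s').E (s, a) ≤ P.η ∧ 0 ≤ (σ.step P (t + 1) s a r s').Qt (s, a) ∧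
      0 ≤ (σ.step P (t + 1) s a r s').Et (s, a) ∧ (σ.step P (t + 1) s a r s').Et (s, a) ≤ P.η ∧
      (σ.step P (t + 1) s a r s').n (s, a) < P.m ∧
      (σ.step P (t + 1) s a r s').b (s, a) ≤ t + 1 := by
    have hb := h.b_le (s, a)
    rcases σ.step_cases P (t + 1) s a r s' with c | c | c | c
    · rw [c.2]
      exact ⟨h.Q_nonneg _, h.E_nonneg _, h.E_le _, h.Qt_nonneg _, h.Et_nonneg _, h.Et_le _,
        h.n_lt _, by omega⟩
    · rw [c.Q, c.E, c.Qt, c.Et, c.n, c.b]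
      exact ⟨add_nonneg hQt hρ, hEt.1, hEt.2, le_rfl, le_rfl, hη, hm, le_rfl⟩
    · rw [c.Q, c.E, c.Qt, c.Et, c.n, c.b]
      exact ⟨h.Q_nonneg _, h.E_nonneg _, h.E_le _, le_rfl, le_rfl, hη, hm, le_rfl⟩
    · rw [c.Q, c.E, c.Qt, c.Et, c.n, c.b]
      have := c.n_succ
      exact ⟨h.Q_nonneg _, h.E_nonneg _, h.E_le _, hQt, hEt.1, hEt.2, by omega, by omega⟩
  classical
  have all : ∀ q, _ := fun q => if hq : q = (s, a) then hq ▸ on else off q hq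
  exact
    { Q_nonneg := fun q => (all q).1
      Q_le := fun q => (h.Q_step_le hP s a r s' q).trans (h.Q_le q)
      E_nonneg := fun q => (all q).2.1
      E_le := fun q => (all q).2.2.1
      Qt_nonneg := fun q => (all q).2.2.2.1
      Et_nonneg := fun q => (all q).2.2.2.2.1
      Et_le := fun q => (all q).2.2.2.2.2.1
      n_lt := fun q => (all q).2.2.2.2.2.2.1
      b_le := fun q => (all q).2.2.2.2.2.2.2
      tstar_le := by
        have ht := h.tstar_le
        rcases σ.step_cases P (t + 1) s a r s' with c | c | c | c
        · rw [c.2]; omega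
        · rw [c.tstar]
        · rw [c.tstar]; omega
        · rw [c.tstar]; omega }

end Bounded

omit [Fintype A] [Nonempty A] in
/-- A successful update decreases `Q'` by at least `ε₁`. -/
theorem SuccessStep.Q'_le {σ' : Memory S A} {p : S × A} {qt et : ℝ}
    (c : SuccessStep P σ σ' t p qt et) : σ'.Q' P p + P.ε₁ ≤ σ.Q' P p := by
  have h := c.le
  have e : σ'.Q' P p = qt + P.ρ / √((σ.n p + 1 : ℕ) : ℝ) + P.bonus et := by
    rw [Q', c.Q, c.E]
  linarith

end Memory

/-! ### The bound on the cost of a pair when all samples are good. -/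

/-- The memory of the algorithm together with two quantities that only the analysis uses. -/
structure Ghost (S A : Type u) where
  mem : Memory S A
  /-- the sum of the expected samples of the current attempted update -/
  Z : S × A → ℝ
  /-- the accumulated cost of the experiences of a pair -/
  cost : S × A → ℝ

section

variable {S A : Type u} [MeasurableSpace S] [MeasurableSpace A] [Fintype A] [Nonempty A]

/-- The Bellman residual of the Q-value estimates. -/
def MDP.residual (M : MDP S A) (σ : Memory S A) (p : S × A) : ℝ := σ.Q p - M.backup σ.V p

/-- The cost of the experience of `p` that changes the memory from `σ` to `σ'`: the excess of the
Bellman residual, and the decrease of the Q-value. -/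
def MDP.stepCost (M : MDP S A) (P : Params) (σ σ' : Memory S A) (p : S × A) : ℝ :=
  max 0 (M.residual σ p - 4 * P.ε₁) + (σ.Q p - σ'.Q p)

namespace Ghost

/-- The initialization. -/
def init (P : Params) : Ghost S A := ⟨Memory.init P, fun _ => 0, fun _ => 0⟩

open Classical in
/-- One iteration of the main loop. -/
def step (M : MDP S A) (P : Params) (e : Ghost S A) (t : ℕ) (s : S) (a : A) (r : ℝ) (s' : S) :
    Ghost S A where
  mem := e.mem.step P t s a r s'
  Z := if e.mem.Sampled (s, a) then Function.update e.Z (s, a)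
      (if (e.mem.step P t s a r s').n (s, a) = 0 then 0
        else e.Z (s, a) + M.backup e.mem.V (s, a)) else e.Z
  cost := Function.update e.cost (s, a)
    (e.cost (s, a) + M.stepCost P e.mem (e.mem.step P t s a r s') (s, a))

/-- The state after a history has been processed. -/
def run (M : MDP S A) (P : Params) : (n : ℕ) → Hist S A n → Ghost S A
  | 0, _ => init P
  | n + 1, h => (run M P n h.prev).step M P (n + 1) h.prev.state h.last.1 h.last.2.1 h.last.2.2

theorem run_succ (M : MDP S A) (P : Params) (n : ℕ) (h : Hist S A (n + 1)) :
    run M P (n + 1) h =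
      (run M P n h.prev).step M P (n + 1) h.prev.state h.last.1 h.last.2.1 h.last.2.2 := rfl

theorem run_snoc (M : MDP S A) (P : Params) (n : ℕ) (h : Hist S A n) (y : A × ℝ × S) :
    run M P (n + 1) (h.snoc y) =
      (run M P n h).step M P (n + 1) h.state y.1 y.2.1 y.2.2 := by
  rw [run_succ, Hist.prev_snoc, Hist.last_snoc]

theorem run_mem (M : MDP S A) (P : Params) :
    ∀ (n : ℕ) (h : Hist S A n), (run M P n h).mem = Memory.run P n h
  | 0, _ => rfl
  | n + 1, h => by
    rw [run_succ, Memory.run, step, run_mem M P n h.prev]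

theorem step_Z_of_ne (M : MDP S A) (P : Params) (e : Ghost S A) (t : ℕ) (s : S) (a : A) (r : ℝ)
    (s' : S) {q : S × A} (hq : q ≠ (s, a)) : (e.step M P t s a r s').Z q = e.Z q := by
  unfold step
  dsimp only
  split_ifs <;> simp [hq]

theorem step_cost_of_ne (M : MDP S A) (P : Params) (e : Ghost S A) (t : ℕ) (s : S) (a : A)
    (r : ℝ) (s' : S) {q : S × A} (hq : q ≠ (s, a)) :
    (e.step M P t s a r s').cost q = e.cost q := by
  simp [step, hq]

theorem step_cost_self (M : MDP S A) (P : Params) (e : Ghost S A) (t : ℕ) (s : S) (a : A)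
    (r : ℝ) (s' : S) :
    (e.step M P t s a r s').cost (s, a) =
      e.cost (s, a) + M.stepCost P e.mem (e.mem.step P t s a r s') (s, a) := by
  simp [step]

theorem step_Z_of_not_sampled (M : MDP S A) (P : Params) (e : Ghost S A) (t : ℕ) (s : S) (a : A)
    (r : ℝ) (s' : S) (h : ¬ e.mem.Sampled (s, a)) : (e.step M P t s a r s').Z = e.Z := by
  simp [step, h]

theorem step_Z_reset (M : MDP S A) (P : Params) (e : Ghost S A) (t : ℕ) (s : S) (a : A)
    (r : ℝ) (s' : S) (h : e.mem.Sampled (s, a))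
    (hn : (e.mem.step P t s a r s').n (s, a) = 0) : (e.step M P t s a r s').Z (s, a) = 0 := by
  simp [step, h, hn]

theorem step_Z_continue (M : MDP S A) (P : Params) (e : Ghost S A) (t : ℕ) (s : S) (a : A)
    (r : ℝ) (s' : S) (h : e.mem.Sampled (s, a))
    (hn : (e.mem.step P t s a r s').n (s, a) ≠ 0) :
    (e.step M P t s a r s').Z (s, a) = e.Z (s, a) + M.backup e.mem.V (s, a) := by
  simp [step, h, hn]

/-- The bounds on the sums of expected samples. -/
structure Bounded (M : MDP S A) (P : Params) (t : ℕ) (e : Ghost S A) : Prop where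
  mem : Memory.Bounded P t e.mem
  Z_zero : ∀ p, e.mem.n p = 0 → e.Z p = 0
  Z_ge : ∀ p, e.mem.n p * M.backup e.mem.V p ≤ e.Z p
  Z_eq : ∀ p, e.mem.tstar < e.mem.b p → e.Z p = e.mem.n p * M.backup e.mem.V p

variable {M : MDP S A} {P : Params} {t : ℕ} {e : Ghost S A}

theorem bounded_init (hP : P.Admissible) : Bounded M P 0 (init P : Ghost S A) where
  mem := Memory.bounded_init hP
  Z_zero _ _ := rfl
  Z_ge _ := by simp [init, Memory.init]
  Z_eq _ _ := by simp [init, Memory.init]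

/-- `Z` sums backups of the functions `V` that were current at each sample. As `V` only decreases,
the sum dominates `n` times the present backup; as long as `tstar < b` no Q-value has changed during
the attempt, and equality holds. -/
theorem Bounded.step [Finite S] [MeasurableSingletonClass S] (h : Bounded M P t e)
    (hP : P.Admissible) (s : S) (a : A) {r : ℝ}
    (hr : 0 ≤ r) (s' : S) : Bounded M P (t + 1) (e.step M P (t + 1) s a r s') := by
  have hag := e.mem.agreeOff_step P (t + 1) s a r s'
  have hV := h.mem.V_step_le hP s a r s'
  have hbk : ∀ q, M.backup (e.mem.step P (t + 1) s a r s').V q ≤ M.backup e.mem.V q :=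
    M.backup_mono hV
  have hmem := h.mem.step hP s a hr s'
  have hoff : ∀ q, q ≠ (s, a) →
      (e.step M P (t + 1) s a r s').mem.n q * M.backup (e.step M P (t + 1) s a r s').mem.V q ≤
        (e.step M P (t + 1) s a r s').Z q := by
    intro q hq
    rw [step_Z_of_ne M P e _ s a r s' hq]
    change ((e.mem.step P (t + 1) s a r s').n q : ℝ) * M.backup (e.mem.step P (t + 1) s a r s').V q ≤ _
    rw [hag.n q hq]
    exact (mul_le_mul_of_nonneg_left (hbk q) (Nat.cast_nonneg _)).trans (h.Z_ge q)
  have hz : ∀ q, q ≠ (s, a) → (e.step M P (t + 1) s a r s').mem.n q = 0 →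
      (e.step M P (t + 1) s a r s').Z q = 0 := by
    intro q hq hn
    rw [step_Z_of_ne M P e _ s a r s' hq]
    refine h.Z_zero q ?_
    rw [← hag.n q hq]
    exact hn
  have hVeq : (e.mem.step P (t + 1) s a r s').Q (s, a) = e.mem.Q (s, a) →
      (e.mem.step P (t + 1) s a r s').V = e.mem.V := by
    intro h1
    refine Memory.V_eq_of_Q_eq fun q => ?_
    by_cases hq : q = (s, a)
    · rw [hq, h1]
    · exact hag.Q q hq
  have hoffeq : (e.mem.step P (t + 1) s a r s').Q (s, a) = e.mem.Q (s, a) →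
      (e.mem.step P (t + 1) s a r s').tstar = e.mem.tstar → ∀ q, q ≠ (s, a) →
      (e.mem.step P (t + 1) s a r s').tstar < (e.mem.step P (t + 1) s a r s').b q →
      (e.step M P (t + 1) s a r s').Z q =
        (e.mem.step P (t + 1) s a r s').n q * M.backup (e.mem.step P (t + 1) s a r s').V q := by
    intro h1 h2 q hq hlt
    rw [step_Z_of_ne M P e _ s a r s' hq, hag.n q hq, hVeq h1]
    refine h.Z_eq q ?_
    rwa [h2, hag.b q hq] at hlt
  rcases e.mem.step_cases P (t + 1) s a r s' with c | c | c | c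
  · have hZ := step_Z_of_not_sampled M P e (t + 1) s a r s' c.1
    have hm : (e.step M P (t + 1) s a r s').mem = e.mem := c.2
    refine ⟨hmem, ?_, ?_, ?_⟩
    · intro p; rw [hZ, hm]; exact h.Z_zero p
    · intro p; rw [hZ, hm]; exact h.Z_ge p
    · intro p; rw [hZ, hm]; exact h.Z_eq p
  · have hZ := step_Z_reset M P e (t + 1) s a r s' c.sampled c.n
    refine ⟨hmem, fun q hn => ?_, fun q => ?_, fun q hlt => ?_⟩
    · by_cases hq : q = (s, a)
      · rw [hq, hZ]
      · exact hz q hq hn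
    · by_cases hq : q = (s, a)
      · rw [hq, hZ]
        change ((e.mem.step P (t + 1) s a r s').n (s, a) : ℝ) * _ ≤ 0
        rw [c.n]
        simp
      · exact hoff q hq
    -- A success moves `tstar` to the present time, which no `b` exceeds, so after it the equality
    -- is claimed for no pair.
    · have h1 : (e.mem.step P (t + 1) s a r s').tstar < (e.mem.step P (t + 1) s a r s').b q := hlt
      rw [c.tstar] at h1
      exact absurd (hmem.b_le q) (not_le.2 h1)
  · have hZ := step_Z_reset M P e (t + 1) s a r s' c.sampled c.n
    refine ⟨hmem, fun q hn => ?_, fun q => ?_, fun q hlt => ?_⟩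
    · by_cases hq : q = (s, a)
      · rw [hq, hZ]
      · exact hz q hq hn
    · by_cases hq : q = (s, a)
      · rw [hq, hZ]
        change ((e.mem.step P (t + 1) s a r s').n (s, a) : ℝ) * _ ≤ 0
        rw [c.n]
        simp
      · exact hoff q hq
    · by_cases hq : q = (s, a)
      · rw [hq, hZ]
        change 0 = ((e.mem.step P (t + 1) s a r s').n (s, a) : ℝ) * _
        rw [c.n]
        simp
      · exact hoffeq c.Q c.tstar q hq hlt
  · have hn0 : (e.mem.step P (t + 1) s a r s').n (s, a) ≠ 0 := by rw [c.n]; omega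
    have hZ := step_Z_continue M P e (t + 1) s a r s' c.sampled hn0
    refine ⟨hmem, fun q hn => ?_, fun q => ?_, fun q hlt => ?_⟩
    · by_cases hq : q = (s, a)
      · rw [hq] at hn
        exact absurd hn hn0
      · exact hz q hq hn
    · by_cases hq : q = (s, a)
      · rw [hq, hZ]
        change ((e.mem.step P (t + 1) s a r s').n (s, a) : ℝ) *
          M.backup (e.mem.step P (t + 1) s a r s').V (s, a) ≤ _
        rw [c.n, hVeq c.Q]
        push_cast
        linarith [h.Z_ge (s, a)]
      · exact hoff q hq
    · by_cases hq : q = (s, a)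
      · rw [hq] at hlt ⊢
        rw [hZ]
        change _ = ((e.mem.step P (t + 1) s a r s').n (s, a) : ℝ) *
          M.backup (e.mem.step P (t + 1) s a r s').V (s, a)
        have h1 : (e.mem.step P (t + 1) s a r s').tstar <
          (e.mem.step P (t + 1) s a r s').b (s, a) := hlt
        rw [c.tstar, c.b] at h1
        rw [c.n, hVeq c.Q, h.Z_eq _ h1]
        push_cast
        ring
      · exact hoffeq c.Q c.tstar q hq hlt

/-- If the pair `p` is learned from in the next step, then the sum of the samples of the current
attempted update is close to the sum of their expectations. -/
def GoodSample (M : MDP S A) (P : Params) (e : Ghost S A) (p : S × A) (r : ℝ) (s' : S) : Prop :=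
  e.mem.Sampled p →
    |((e.mem.n p + 1 : ℕ) : ℝ) * e.mem.nextQt P p r s' - (e.Z p + M.backup e.mem.V p)| ≤
      P.ρ * √((e.mem.n p + 1 : ℕ) : ℝ)

/-- The bound on the cost of a pair that its past successful updates pay for. -/
def budget (P : Params) (σ : Memory S A) (p : S × A) : ℝ :=
  10 * P.m * (P.B + P.lam - σ.Q' P p)

/-- The invariants that hold as long as all samples are good. -/
structure Good (M : MDP S A) (P : Params) (e : Ghost S A) : Prop where
  residual_nonneg : ∀ p, 0 ≤ M.residual e.mem p
  Z_le : ∀ p, e.Z p ≤ e.mem.n p * e.mem.Q p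
  residual_le : ∀ p, ¬ e.mem.Sampled p → M.residual e.mem p ≤ 4 * P.ε₁
  cost_le : ∀ p, e.cost p ≤
    budget P e.mem p + (e.mem.n p * e.mem.Q p - e.Z p) + 4 * P.ε₁ * P.m
  cost_le_of_lt : ∀ p, e.mem.n p * e.mem.Q p - e.Z p < 4 * P.ε₁ * e.mem.n p →
    e.cost p ≤ budget P e.mem p + (e.mem.n p * e.mem.Q p - e.Z p)
  cost_le_of_residual_le : ∀ p, M.residual e.mem p ≤ 4 * P.ε₁ → e.cost p ≤ budget P e.mem p

theorem good_init (hP : P.Admissible) (hM : M.γ = P.γ) [Finite S] [MeasurableSingletonClass S] :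
    Good M P (init P : Ghost S A) := by
  have hB := Memory.bounded_init (S := S) (A := A) hP
  have hb : ∀ p, 0 ≤ budget P (Memory.init P : Memory S A) p := by
    intro p
    have h1 := hB.bonus_E_le hP p
    have h2 := hB.Q_le p
    unfold budget Memory.Q'
    have := hP.one_le_m
    exact mul_nonneg (by positivity) (by linarith)
  have hε := hP.ε₁_pos
  refine ⟨fun p => ?_, fun p => ?_, fun p h => ?_, fun p => ?_, fun p h => ?_, fun p _ => hb p⟩
  -- Optimistic start: `Q = B = 1 + γ B` is at least every backup of the constant `B`.
  · have h1 := M.backup_le (v := (Memory.init P : Memory S A).V) hB.V_le p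
    rw [hM, hP.one_add_γ_mul_B] at h1
    exact sub_nonneg.2 h1
  · simp [init, Memory.init]
  · exact absurd (Or.inl rfl) h
  · have h1 := hb p
    have h2 : 0 ≤ 4 * P.ε₁ * P.m := by positivity
    simp only [init, Memory.init, CharP.cast_eq_zero, zero_mul, sub_zero, add_zero] at h1 ⊢
    linarith
  · simp [init, Memory.init] at h

/-- Let `X = n Q - Z`. Since `Q p` is fixed between successes of `p`, this is the sum of the
residuals seen by the current attempt, and these are nondecreasing because `V` falls. So a residual
that is now at most `4 ε₁` has been so since the last success of `p`, and no cost has accrued since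
then. Likewise, if the average residual of the attempt is below `4 ε₁`, the attempt began with such
a residual, and only it can have cost anything, at most `X`. A failing attempt ends with `X ≤ 4 ε₁
m`. If its last residual exceeds `4 ε₁`, then all residuals of `p` exceed `4 ε₁` until the next
success, and no further attempt of `p` can fail before it. One allowance of `4 ε₁ m` between two
successes is therefore enough. -/
theorem Good.step [Finite S] [MeasurableSingletonClass S] (h : Good M P e) (hb : Bounded M P t e)
    (hP : P.Admissible) (s : S) (a : A) {r : ℝ} (hr : 0 ≤ r) (s' : S)
    (hg : GoodSample M P e (s, a) r s') : Good M P (e.step M P (t + 1) s a r s') := by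
  have hag := e.mem.agreeOff_step P (t + 1) s a r s'
  have hV := hb.mem.V_step_le hP s a r s'
  have hbk : ∀ q, M.backup (e.mem.step P (t + 1) s a r s').V q ≤ M.backup e.mem.V q :=
    M.backup_mono hV
  have hε := hP.ε₁_pos
  have hm := hP.one_le_m
  have hres : ∀ q, q ≠ (s, a) →
      M.residual e.mem q ≤ M.residual (e.mem.step P (t + 1) s a r s') q := by
    intro q hq
    unfold MDP.residual
    rw [hag.Q q hq]
    linarith [hbk q]
  have hbud : ∀ q, q ≠ (s, a) →
      budget P (e.mem.step P (t + 1) s a r s') q = budget P e.mem q := by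
    intro q hq
    unfold budget Memory.Q'
    rw [hag.Q q hq, hag.E q hq]
  have hVeq : (e.mem.step P (t + 1) s a r s').Q (s, a) = e.mem.Q (s, a) →
      (e.mem.step P (t + 1) s a r s').V = e.mem.V := by
    intro h1
    refine Memory.V_eq_of_Q_eq fun q => ?_
    by_cases hq : q = (s, a)
    · rw [hq, h1]
    · exact hag.Q q hq
  have hreseq : (e.mem.step P (t + 1) s a r s').Q (s, a) = e.mem.Q (s, a) →
      ∀ q, M.residual (e.mem.step P (t + 1) s a r s') q = M.residual e.mem q := by
    intro h1 q
    unfold MDP.residual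
    rw [hVeq h1]
    by_cases hq : q = (s, a)
    · rw [hq, h1]
    · rw [hag.Q q hq]
  -- For the other pairs only `residual_le` is missing here: it depends on the global `tstar` and is
  -- treated in each case.
  have hoff : ∀ q, q ≠ (s, a) →
      (0 ≤ M.residual (e.mem.step P (t + 1) s a r s') q) ∧
      ((e.step M P (t + 1) s a r s').Z q ≤ (e.mem.step P (t + 1) s a r s').n q *
        (e.mem.step P (t + 1) s a r s').Q q) ∧
      ((e.step M P (t + 1) s a r s').cost q ≤ budget P (e.mem.step P (t + 1) s a r s') q +
        ((e.mem.step P (t + 1) s a r s').n q * (e.mem.step P (t + 1) s a r s').Q q -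
          (e.step M P (t + 1) s a r s').Z q) + 4 * P.ε₁ * P.m) ∧
      ((e.mem.step P (t + 1) s a r s').n q * (e.mem.step P (t + 1) s a r s').Q q -
          (e.step M P (t + 1) s a r s').Z q < 4 * P.ε₁ * (e.mem.step P (t + 1) s a r s').n q →
        (e.step M P (t + 1) s a r s').cost q ≤ budget P (e.mem.step P (t + 1) s a r s') q +
        ((e.mem.step P (t + 1) s a r s').n q * (e.mem.step P (t + 1) s a r s').Q q -
          (e.step M P (t + 1) s a r s').Z q)) ∧
      (M.residual (e.mem.step P (t + 1) s a r s') q ≤ 4 * P.ε₁ →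
        (e.step M P (t + 1) s a r s').cost q ≤ budget P (e.mem.step P (t + 1) s a r s') q) := by
    intro q hq
    rw [hbud q hq, step_Z_of_ne M P e _ s a r s' hq, step_cost_of_ne M P e _ s a r s' hq,
      hag.Q q hq, hag.n q hq]
    exact ⟨(h.residual_nonneg q).trans (hres q hq), h.Z_le q, h.cost_le q, h.cost_le_of_lt q,
      fun h1 => h.cost_le_of_residual_le q ((hres q hq).trans h1)⟩
  have hnn := h.residual_nonneg (s, a)
  have hZle := h.Z_le (s, a)
  have hk : ((e.mem.n (s, a) + 1 : ℕ) : ℝ) ≤ P.m := Nat.cast_le.2 (hb.mem.n_lt (s, a))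
  have hcost := step_cost_self M P e (t + 1) s a r s'
  have hmax : max 0 (M.residual e.mem (s, a) - 4 * P.ε₁) ≤ M.residual e.mem (s, a) :=
    max_le hnn (by linarith)
  have hmax0 : M.residual e.mem (s, a) ≤ 4 * P.ε₁ →
      max 0 (M.residual e.mem (s, a) - 4 * P.ε₁) = 0 := fun h1 => max_eq_left (by linarith)
  have hX : ((e.mem.n (s, a) + 1 : ℕ) : ℝ) * e.mem.Q (s, a) -
      (e.Z (s, a) + M.backup e.mem.V (s, a)) =
      (e.mem.n (s, a) * e.mem.Q (s, a) - e.Z (s, a)) + M.residual e.mem (s, a) := by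
    unfold MDP.residual
    push_cast
    ring
  rcases e.mem.step_cases P (t + 1) s a r s' with c | c | c | c
  · have hZ := step_Z_of_not_sampled M P e (t + 1) s a r s' c.1
    have hmem : (e.step M P (t + 1) s a r s').mem = e.mem := c.2
    have hC : (e.step M P (t + 1) s a r s').cost = e.cost := by
      funext q
      by_cases hq : q = (s, a)
      · rw [hq, hcost, MDP.stepCost, hmax0 (h.residual_le _ c.1), c.2]
        ring
      · exact step_cost_of_ne M P e _ s a r s' hq
    constructor <;> intro p <;> (try rw [hZ]) <;> (try rw [hC]) <;> rw [hmem]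
    exacts [h.residual_nonneg p, h.Z_le p, h.residual_le p, h.cost_le p, h.cost_le_of_lt p,
      h.cost_le_of_residual_le p]
  · have hZ := step_Z_reset M P e (t + 1) s a r s' c.sampled c.n
    obtain ⟨hg1, hg2⟩ := abs_le.1 (hg c.sampled)
    have hkQ : ((e.mem.n (s, a) + 1 : ℕ) : ℝ) * (e.mem.step P (t + 1) s a r s').Q (s, a) =
        ((e.mem.n (s, a) + 1 : ℕ) : ℝ) * e.mem.nextQt P (s, a) r s' +
          P.ρ * √((e.mem.n (s, a) + 1 : ℕ) : ℝ) := by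
      rw [c.Q, mul_add, natCast_mul_div_sqrt _ (Nat.succ_pos _)]
    have hkpos : (0 : ℝ) < ((e.mem.n (s, a) + 1 : ℕ) : ℝ) := Nat.cast_pos.2 (Nat.succ_pos _)
    -- Optimism survives a success: `k` times the new Q-value is the sum of the samples plus `ρ √k`,
    -- hence at least the sum of their expectations, hence at least `k` times the backup of the
    -- present, smaller `V`.
    have hresp : 0 ≤ M.residual (e.mem.step P (t + 1) s a r s') (s, a) := by
      have h1 := hb.Z_ge (s, a)
      have h2 : ((e.mem.n (s, a) + 1 : ℕ) : ℝ) * M.backup e.mem.V (s, a) ≤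
          ((e.mem.n (s, a) + 1 : ℕ) : ℝ) * (e.mem.step P (t + 1) s a r s').Q (s, a) := by
        rw [hkQ]
        push_cast at hg1 ⊢
        linarith
      have h3 := le_of_mul_le_mul_left h2 hkpos
      unfold MDP.residual
      linarith [hbk (s, a)]
    have hdrop := c.Q'_le
    have hQle := hb.mem.Q_step_le hP s a r s' (s, a)
    -- The bonus can rise by at most `λ ≤ ε₁`, which is at most the drop of `Q'`; hence the factor
    -- two.
    have hd1 : e.mem.Q (s, a) - (e.mem.step P (t + 1) s a r s').Q (s, a) ≤
        2 * (e.mem.Q' P (s, a) - (e.mem.step P (t + 1) s a r s').Q' P (s, a)) := by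
      have h1 := (hb.mem.step hP s a hr s').bonus_E_le hP (s, a)
      have h2 := hP.bonus_nonneg (e.mem.E (s, a))
      have h3 := hP.lam_le
      unfold Memory.Q' at hdrop ⊢
      linarith
    -- Let `Δ ≥ ε₁` be the drop of `Q'`. The allowance is at most `4 m Δ`; the residuals of the
    -- attempt sum to at most `m` times the drop of `Q` plus `2 ρ √k`, so to at most `2 m Δ + 2 m
    -- Δ`; the drop of `Q` costs `2 Δ ≤ 2 m Δ`. The total `10 m Δ` is the increase of the budget.
    have hC : (e.step M P (t + 1) s a r s').cost (s, a) ≤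
        budget P (e.mem.step P (t + 1) s a r s') (s, a) := by
      have h1 := h.cost_le (s, a)
      have h2 := hP.ρ_mul_sqrt_le (k := e.mem.n (s, a) + 1) (hb.mem.n_lt (s, a))
      have h3 : ((e.mem.n (s, a) + 1 : ℕ) : ℝ) *
          (e.mem.Q (s, a) - (e.mem.step P (t + 1) s a r s').Q (s, a)) ≤
          P.m * (e.mem.Q (s, a) - (e.mem.step P (t + 1) s a r s').Q (s, a)) :=
        mul_le_mul_of_nonneg_right hk (by linarith)
      rw [mul_sub, hkQ] at h3
      have h4 := mul_le_mul_of_nonneg_left hd1 (by linarith : (0 : ℝ) ≤ P.m)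
      have h5 : P.ε₁ * P.m ≤ P.m *
          (e.mem.Q' P (s, a) - (e.mem.step P (t + 1) s a r s').Q' P (s, a)) := by
        rw [mul_comm]
        exact mul_le_mul_of_nonneg_left (by linarith) (by linarith)
      have h6 : e.mem.Q' P (s, a) - (e.mem.step P (t + 1) s a r s').Q' P (s, a) ≤ P.m *
          (e.mem.Q' P (s, a) - (e.mem.step P (t + 1) s a r s').Q' P (s, a)) :=
        le_mul_of_one_le_left (by linarith) hm
      rw [hcost, MDP.stepCost]
      unfold budget at h1 ⊢
      linarith
    have hbudm : 0 ≤ 4 * P.ε₁ * P.m := by positivity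
    have hn0 : (((e.step M P (t + 1) s a r s').mem.n (s, a) : ℕ) : ℝ) = 0 := by
      rw [show (e.step M P (t + 1) s a r s').mem.n (s, a) = 0 from c.n]; simp
    refine ⟨fun q => ?_, fun q => ?_, fun q hs => ?_, fun q => ?_, fun q => ?_, fun q => ?_⟩
    · by_cases hq : q = (s, a)
      · rw [hq]; exact hresp
      · exact (hoff q hq).1
    · by_cases hq : q = (s, a)
      · rw [hq, hZ, hn0, zero_mul]
      · exact (hoff q hq).2.1
    -- After a success every pair is sampled again, so nothing is claimed.
    · refine absurd (Or.inr ?_) hs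
      rw [show (e.step M P (t + 1) s a r s').mem.tstar = t + 1 from c.tstar]
      exact (hb.mem.step hP s a hr s').b_le q
    · by_cases hq : q = (s, a)
      · rw [hq, hZ, hn0, zero_mul, sub_zero, add_zero]
        exact hC.trans (le_add_of_nonneg_right hbudm)
      · exact (hoff q hq).2.2.1
    · by_cases hq : q = (s, a)
      · rw [hq, hZ, hn0, zero_mul, sub_zero, add_zero]
        exact fun _ => hC
      · exact (hoff q hq).2.2.2.1
    · by_cases hq : q = (s, a)
      · rw [hq]
        exact fun _ => hC
      · exact (hoff q hq).2.2.2.2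
  · have hZ := step_Z_reset M P e (t + 1) s a r s' c.sampled c.n
    obtain ⟨hg1, hg2⟩ := abs_le.1 (hg c.sampled)
    have hres' := hreseq c.Q
    -- Failure gives a gap below `3 ε₁` between `Q` and the sample mean: the threshold, `ρ / √m =
    -- ε₁`, and a bonus of at most `λ ≤ ε₁`. The fourth `ε₁` is the admitted deviation `ρ √m = ε₁ m`
    -- of the sum.
    have hXm : (e.mem.n (s, a) * e.mem.Q (s, a) - e.Z (s, a)) + M.residual e.mem (s, a) ≤
        4 * P.ε₁ * P.m := by
      have h1 := c.lt
      rw [← hX]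
      rw [c.n_succ] at hg2 h1 ⊢
      rw [hP.ρ_mul_sqrt_m] at hg2
      have h2 : P.ρ / √(P.m : ℝ) = P.ε₁ := by
        rw [hP.ρ_eq, mul_div_assoc, div_self (Real.sqrt_pos.2 (by linarith)).ne', mul_one]
      have h3 := hP.bonus_nonneg (e.mem.E (s, a))
      have h4 := hP.bonus_le (hb.mem.nextEt_mem hP (s, a) s').1 (hb.mem.nextEt_mem hP (s, a) s').2
      have h5 := hP.lam_le
      unfold Memory.Q' at h1
      rw [h2] at h1
      have h6 := mul_le_mul_of_nonneg_left
        (by linarith : e.mem.Q (s, a) - e.mem.nextQt P (s, a) r s' ≤ 3 * P.ε₁)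
        (by linarith : (0 : ℝ) ≤ P.m)
      linarith
    have hbudp : budget P (e.mem.step P (t + 1) s a r s') (s, a) = budget P e.mem (s, a) := by
      unfold budget Memory.Q'
      rw [c.Q, c.E]
    have hC1 : M.residual e.mem (s, a) ≤ 4 * P.ε₁ → (e.step M P (t + 1) s a r s').cost (s, a) ≤
        budget P (e.mem.step P (t + 1) s a r s') (s, a) := by
      intro h1
      rw [hcost, MDP.stepCost, hmax0 h1, hbudp, c.Q]
      linarith [h.cost_le_of_residual_le _ h1]
    have hbudm : 0 ≤ 4 * P.ε₁ * P.m := by positivity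
    have hC2 : (e.step M P (t + 1) s a r s').cost (s, a) ≤
        budget P (e.mem.step P (t + 1) s a r s') (s, a) + 4 * P.ε₁ * P.m := by
      rcases le_or_gt (M.residual e.mem (s, a)) (4 * P.ε₁) with h1 | h1
      · linarith [hC1 h1]
      · have h2 : (P.m : ℝ) = e.mem.n (s, a) + 1 := by rw [← c.n_succ]; push_cast; ring
        -- Removing a last residual above `4 ε₁` from a sum of at most `4 ε₁ m` leaves less than `4
        -- ε₁ (m - 1)`, so the sharper bound was available before this sample.
        have h3 := h.cost_le_of_lt (s, a) (by rw [h2] at hXm; linarith)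
        rw [hcost, MDP.stepCost, hbudp, c.Q]
        linarith
    have hn0 : (((e.step M P (t + 1) s a r s').mem.n (s, a) : ℕ) : ℝ) = 0 := by
      rw [show (e.step M P (t + 1) s a r s').mem.n (s, a) = 0 from c.n]; simp
    refine ⟨fun q => ?_, fun q => ?_, fun q hs => ?_, fun q => ?_, fun q => ?_, fun q => ?_⟩
    · by_cases hq : q = (s, a)
      · rw [hq]; exact (hres' _).symm ▸ hnn
      · exact (hoff q hq).1
    · by_cases hq : q = (s, a)
      · rw [hq, hZ, hn0, zero_mul]
      · exact (hoff q hq).2.1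
    · have e1 : M.residual (e.step M P (t + 1) s a r s').mem q = M.residual e.mem q := hres' q
      rw [e1]
      by_cases hq : q = (s, a)
      · rw [hq] at hs ⊢
        -- Learning is switched off only when no Q-value has changed since the attempt began. Its
        -- `m` residuals are then equal, and the bound on their sum bounds the present one.
        have h1 : ¬ e.mem.b (s, a) ≤ e.mem.tstar := fun h2 => hs (Or.inl (c.learn.2 h2))
        have h2 := hb.Z_eq _ (not_le.1 h1)
        have h3 : e.mem.n (s, a) * e.mem.Q (s, a) - e.Z (s, a) =
            e.mem.n (s, a) * M.residual e.mem (s, a) := by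
          rw [h2, MDP.residual]; ring
        have h4 : (P.m : ℝ) = e.mem.n (s, a) + 1 := by rw [← c.n_succ]; push_cast; ring
        rw [h3, h4] at hXm
        have h5 : ((e.mem.n (s, a) : ℝ) + 1) * M.residual e.mem (s, a) ≤
            (e.mem.n (s, a) + 1) * (4 * P.ε₁) := by linarith
        exact le_of_mul_le_mul_left h5 (by positivity)
      · refine h.residual_le q fun h1 => hs ?_
        unfold Memory.Sampled at h1 ⊢
        rw [show (e.step M P (t + 1) s a r s').mem.learn q = e.mem.learn q from hag.learn q hq,
          show (e.step M P (t + 1) s a r s').mem.b q = e.mem.b q from hag.b q hq,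
          show (e.step M P (t + 1) s a r s').mem.tstar = e.mem.tstar from c.tstar]
        exact h1
    · by_cases hq : q = (s, a)
      · rw [hq, hZ, hn0, zero_mul, sub_zero, add_zero]
        exact hC2
      · exact (hoff q hq).2.2.1
    · by_cases hq : q = (s, a)
      · rw [hq, hZ, hn0, zero_mul, sub_zero, mul_zero]
        exact fun h1 => absurd h1 (lt_irrefl _)
      · exact (hoff q hq).2.2.2.1
    · by_cases hq : q = (s, a)
      · rw [hq]
        intro h1
        refine hC1 ?_
        rw [← hres' (s, a)]
        exact h1
      · exact (hoff q hq).2.2.2.2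
  · have hn1 : (e.mem.step P (t + 1) s a r s').n (s, a) ≠ 0 := by rw [c.n]; omega
    have hZ := step_Z_continue M P e (t + 1) s a r s' c.sampled hn1
    have hres' := hreseq c.Q
    have hbudp : budget P (e.mem.step P (t + 1) s a r s') (s, a) = budget P e.mem (s, a) := by
      unfold budget Memory.Q'
      rw [c.Q, c.E]
    have hC0 : (e.step M P (t + 1) s a r s').cost (s, a) =
        e.cost (s, a) + max 0 (M.residual e.mem (s, a) - 4 * P.ε₁) := by
      rw [hcost, MDP.stepCost, c.Q]; ring
    have hX' : ((e.step M P (t + 1) s a r s').mem.n (s, a) : ℝ) *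
        (e.step M P (t + 1) s a r s').mem.Q (s, a) - (e.step M P (t + 1) s a r s').Z (s, a) =
        (e.mem.n (s, a) * e.mem.Q (s, a) - e.Z (s, a)) + M.residual e.mem (s, a) := by
      rw [← hX, hZ, show (e.step M P (t + 1) s a r s').mem.n (s, a) = e.mem.n (s, a) + 1 from c.n,
        show (e.step M P (t + 1) s a r s').mem.Q (s, a) = e.mem.Q (s, a) from c.Q]
    have hC1 : M.residual e.mem (s, a) ≤ 4 * P.ε₁ → (e.step M P (t + 1) s a r s').cost (s, a) ≤
        budget P e.mem (s, a) := by
      intro h1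
      rw [hC0, hmax0 h1]
      linarith [h.cost_le_of_residual_le _ h1]
    refine ⟨fun q => ?_, fun q => ?_, fun q hs => ?_, fun q => ?_, fun q => ?_, fun q => ?_⟩
    · by_cases hq : q = (s, a)
      · rw [hq]; exact (hres' _).symm ▸ hnn
      · exact (hoff q hq).1
    · by_cases hq : q = (s, a)
      · rw [hq]
        linarith
      · exact (hoff q hq).2.1
    · have e1 : M.residual (e.step M P (t + 1) s a r s').mem q = M.residual e.mem q := hres' q
      rw [e1]
      by_cases hq : q = (s, a)
      · rw [hq] at hs
        exact absurd (Or.inl c.learn) hs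
      · refine h.residual_le q fun h1 => hs ?_
        unfold Memory.Sampled at h1 ⊢
        rw [show (e.step M P (t + 1) s a r s').mem.learn q = e.mem.learn q from hag.learn q hq,
          show (e.step M P (t + 1) s a r s').mem.b q = e.mem.b q from hag.b q hq,
          show (e.step M P (t + 1) s a r s').mem.tstar = e.mem.tstar from c.tstar]
        exact h1
    · by_cases hq : q = (s, a)
      · rw [hq, hX', show budget P (e.step M P (t + 1) s a r s').mem (s, a) = _ from hbudp, hC0]
        linarith [h.cost_le (s, a)]
      · exact (hoff q hq).2.2.1
    · by_cases hq : q = (s, a)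
      · rw [hq, hX', show budget P (e.step M P (t + 1) s a r s').mem (s, a) = _ from hbudp,
          show (e.step M P (t + 1) s a r s').mem.n (s, a) = e.mem.n (s, a) + 1 from c.n]
        intro h1
        -- Either no cost has accrued since the last success, or removing this residual keeps the
        -- average below `4 ε₁` and the bound is inherited.
        rcases le_or_gt (M.residual e.mem (s, a)) (4 * P.ε₁) with h2 | h2
        · linarith [hC1 h2]
        · push_cast at h1
          have h3 := h.cost_le_of_lt (s, a) (by linarith)
          rw [hC0]
          linarith
      · exact (hoff q hq).2.2.2.1
    · by_cases hq : q = (s, a)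
      · rw [hq, show budget P (e.step M P (t + 1) s a r s').mem (s, a) = _ from hbudp,
          show M.residual (e.step M P (t + 1) s a r s').mem (s, a) = _ from hres' (s, a)]
        exact hC1
      · exact (hoff q hq).2.2.2.2

end Ghost

end

/-! ### Measurability of the analysis variables along histories. -/

/-- The last state, action and next state decide which entries are read and written. Freezing their
finitely many values reduces the measurability of a run to its dependence on rewards and earlier
history. -/
theorem measurable_countable_index {α β ι : Type*} [MeasurableSpace α] [MeasurableSpace β]
    [MeasurableSpace ι] [Countable ι] [MeasurableSingletonClass ι] {F : ι → α → β}
    (hF : ∀ i, Measurable (F i)) {k : α → ι} (hk : Measurable k) :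
    Measurable fun x => F (k x) x :=
  (measurable_from_prod_countable_right (f := fun q : ι × α => F q.1 q.2) hF).comp
    (hk.prodMk measurable_id)

section

variable {S A : Type u} [MeasurableSpace S] [MeasurableSpace A]

theorem MDP.measurable_backup [Finite S] [MeasurableSingletonClass S] (M : MDP S A) (p : S × A)
    {α : Type*} [MeasurableSpace α] {v : α → S → ℝ} (hv : ∀ s, Measurable fun x => v x s) :
    Measurable fun x => M.backup (v x) p := by
  have h : Measurable fun q : α × (ℝ × S) => v q.1 q.2.2 :=
    measurable_countable_index (F := fun s (q : α × (ℝ × S)) => v q.1 s)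
      (fun s => (hv s).comp measurable_fst) (measurable_snd.comp measurable_snd)
  have h1 : Measurable fun q : α × (ℝ × S) => q.2.1 + M.γ * v q.1 q.2.2 :=
    (measurable_fst.comp measurable_snd).add (h.const_mul _)
  exact (h1.stronglyMeasurable.integral_prod_right' (ν := M.outcome p)).measurable

variable [Fintype A] [Nonempty A]

/-- All components depend measurably on a parameter. -/
structure Ghost.MeasurableFamily {α : Type*} [MeasurableSpace α] (f : α → Ghost S A) : Prop where
  mem : Memory.MeasurableFamily fun x => (f x).mem
  Z : ∀ p, Measurable fun x => (f x).Z p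
  cost : ∀ p, Measurable fun x => (f x).cost p

variable {α : Type*} [MeasurableSpace α]

omit [MeasurableSpace S] [MeasurableSpace A] [Fintype A] [Nonempty A] in
theorem Memory.MeasurableFamily.measurableSet_sampled {f : α → Memory S A}
    (hf : Memory.MeasurableFamily f) (p : S × A) : MeasurableSet {x | (f x).Sampled p} :=
  (hf.learn p (measurableSet_singleton true)).union (measurableSet_le (hf.b p) hf.tstar)

theorem Ghost.MeasurableFamily.step [Finite S] [MeasurableSingletonClass S] {f : α → Ghost S A}
    (hf : Ghost.MeasurableFamily f) (M : MDP S A) (P : Params) (t : ℕ) (s : S) (a : A)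
    {r : α → ℝ} (hr : Measurable r) (s' : S) :
    Ghost.MeasurableFamily fun x => (f x).step M P t s a (r x) s' := by
  classical
  have hm := hf.mem.step P t s a hr s'
  have hbk := M.measurable_backup (s, a) hf.mem.V
  refine ⟨hm, fun p => ?_, fun p => ?_⟩
  · refine Measurable.comp_ite (fun z : S × A → ℝ => z p) (hf.mem.measurableSet_sampled (s, a))
      ?_ (hf.Z p)
    exact Measurable.update_const_index hf.Z
      (Measurable.ite (hm.n (s, a) (measurableSet_singleton 0)) measurable_const
        ((hf.Z (s, a)).add hbk)) (s, a) p
  · exact Measurable.update_const_index hf.cost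
      ((hf.cost (s, a)).add ((measurable_const.max
        (((hf.mem.Q (s, a)).sub hbk).sub measurable_const)).add
          ((hf.mem.Q (s, a)).sub (hm.Q (s, a))))) (s, a) p

omit [MeasurableSpace S] [MeasurableSpace A] [Fintype A] [Nonempty A] in
theorem Ghost.MeasurableFamily.countable_index {ι : Type*} [MeasurableSpace ι] [Countable ι]
    [MeasurableSingletonClass ι] {F : ι → α → Ghost S A} (hF : ∀ i, Ghost.MeasurableFamily (F i))
    {k : α → ι} (hk : Measurable k) : Ghost.MeasurableFamily fun x => F (k x) x where
  mem :=
    { Q := fun p => measurable_countable_index (F := fun i x => (F i x).mem.Q p)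
        (fun i => (hF i).mem.Q p) hk
      E := fun p => measurable_countable_index (F := fun i x => (F i x).mem.E p)
        (fun i => (hF i).mem.E p) hk
      Qt := fun p => measurable_countable_index (F := fun i x => (F i x).mem.Qt p)
        (fun i => (hF i).mem.Qt p) hk
      Et := fun p => measurable_countable_index (F := fun i x => (F i x).mem.Et p)
        (fun i => (hF i).mem.Et p) hk
      n := fun p => measurable_countable_index (F := fun i x => (F i x).mem.n p)
        (fun i => (hF i).mem.n p) hk
      b := fun p => measurable_countable_index (F := fun i x => (F i x).mem.b p)
        (fun i => (hF i).mem.b p) hk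
      learn := fun p => measurable_countable_index (F := fun i x => (F i x).mem.learn p)
        (fun i => (hF i).mem.learn p) hk
      tstar := measurable_countable_index (F := fun i x => (F i x).mem.tstar)
        (fun i => (hF i).mem.tstar) hk }
  Z p := measurable_countable_index (F := fun i x => (F i x).Z p) (fun i => (hF i).Z p) hk
  cost p := measurable_countable_index (F := fun i x => (F i x).cost p)
    (fun i => (hF i).cost p) hk

omit [MeasurableSpace S] [MeasurableSpace A] [Fintype A] [Nonempty A] in
theorem Ghost.MeasurableFamily.comp {β : Type*} [MeasurableSpace β] {f : α → Ghost S A}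
    (hf : Ghost.MeasurableFamily f) {g : β → α} (hg : Measurable g) :
    Ghost.MeasurableFamily fun x => f (g x) where
  mem :=
    { Q := fun p => (hf.mem.Q p).comp hg
      E := fun p => (hf.mem.E p).comp hg
      Qt := fun p => (hf.mem.Qt p).comp hg
      Et := fun p => (hf.mem.Et p).comp hg
      n := fun p => (hf.mem.n p).comp hg
      b := fun p => (hf.mem.b p).comp hg
      learn := fun p => (hf.mem.learn p).comp hg
      tstar := hf.mem.tstar.comp hg }
  Z p := (hf.Z p).comp hg
  cost p := (hf.cost p).comp hg

/-- The state, the action and the next state of the last transition. -/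
def Hist.lastTriple {n : ℕ} (h : Hist S A (n + 1)) : S × A × S :=
  (h.prev.state, h.last.1, h.last.2.2)

omit [Fintype A] [Nonempty A] in
theorem Hist.measurable_lastTriple {n : ℕ} :
    Measurable (Hist.lastTriple : Hist S A (n + 1) → S × A × S) :=
  ((Hist.measurable_state n).comp Hist.measurable_prev).prodMk
    ((measurable_fst.comp Hist.measurable_last).prodMk
      ((measurable_snd.comp measurable_snd).comp Hist.measurable_last))

omit [Fintype A] [Nonempty A] in
theorem Hist.measurable_last_reward {n : ℕ} :
    Measurable fun h : Hist S A (n + 1) => h.last.2.1 :=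
  (measurable_fst.comp measurable_snd).comp Hist.measurable_last

theorem Ghost.measurableFamily_run [Finite S] [MeasurableSingletonClass S]
    [MeasurableSingletonClass A] (M : MDP S A) (P : Params) :
    ∀ n, Ghost.MeasurableFamily fun h : Hist S A n => Ghost.run M P n h
  | 0 => by
    refine ⟨?_, fun _ => measurable_const, fun _ => measurable_const⟩
    constructor <;> intros <;> exact measurable_const
  | n + 1 =>
    Ghost.MeasurableFamily.countable_index
      (F := fun (i : S × A × S) (h : Hist S A (n + 1)) =>
        (Ghost.run M P n h.prev).step M P (n + 1) i.1 i.2.1 h.last.2.1 i.2.2)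
      (fun i => ((Ghost.measurableFamily_run M P n).comp Hist.measurable_prev).step M P (n + 1)
        i.1 i.2.1 Hist.measurable_last_reward i.2.2) Hist.measurable_lastTriple

end

/-! ### Exponential moments of a single attempted update. -/

/-- The scale of the exponential moment that controls sums of `j` samples. -/
def Params.rate (P : Params) (j : ℕ) : ℝ := 4 * P.ρ / (√(j : ℝ) * P.B ^ 2)

/-- The bound of Hoeffding's inequality on the probability of one deviation. -/
def Params.tail (P : Params) : ℝ := Real.exp (-(2 * P.ρ ^ 2 / P.B ^ 2))

/-- The exponential moments of a sum with the deviation `d` after `k` samples. -/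
def Params.moment (P : Params) (k : ℕ) (d : ℝ) (j : ℕ) : ℝ :=
  Real.exp (P.rate j * d - k * (P.rate j ^ 2 * P.B ^ 2 / 8)) +
    Real.exp (-P.rate j * d - k * (P.rate j ^ 2 * P.B ^ 2 / 8))

/-- A bound on the probability that an attempted update with `k` samples and the deviation `d` will
have a large deviation. -/
def Params.risk (P : Params) (k : ℕ) (d : ℝ) : ℝ :=
  P.tail * ∑ j ∈ (Finset.Icc 1 P.m).filter (k ≤ ·), P.moment k d j

namespace Params

variable (P : Params)

theorem tail_pos : 0 < P.tail := Real.exp_pos _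

theorem moment_nonneg (k : ℕ) (d : ℝ) (j : ℕ) : 0 ≤ P.moment k d j :=
  add_nonneg (Real.exp_pos _).le (Real.exp_pos _).le

theorem risk_nonneg (k : ℕ) (d : ℝ) : 0 ≤ P.risk k d :=
  mul_nonneg P.tail_pos.le (Finset.sum_nonneg fun j _ => P.moment_nonneg k d j)

theorem risk_zero : P.risk 0 0 = 2 * P.m * P.tail := by
  have h : ∀ j, P.moment 0 0 j = 2 := fun j => by simp [moment]; norm_num
  simp [risk, h]
  ring

theorem measurable_risk (k : ℕ) : Measurable (P.risk k) := by
  unfold risk moment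
  refine Measurable.const_mul (Finset.measurable_fun_sum _ fun j _ => ?_) _
  fun_prop

/-- Only the term `j = k` is needed: `rate k` is the Chernoff optimiser for the deviation `ρ √k`
after `k` samples, where the exponent `4 ρ² / B² - 2 ρ² / B²` exactly cancels `tail`. The two
exponentials in `moment` serve the two signs of `d`. -/
theorem one_le_risk {k : ℕ} (hk : 1 ≤ k) (hkm : k ≤ P.m) (hB : 0 < P.B) (hρ : 0 ≤ P.ρ) {d : ℝ}
    (hd : P.ρ * √(k : ℝ) ≤ |d|) : 1 ≤ P.risk k d := by
  have hk0 : (0 : ℝ) < k := Nat.cast_pos.2 hk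
  have hs : 0 < √(k : ℝ) := Real.sqrt_pos.2 hk0
  have hss : √(k : ℝ) ^ 2 = k := Real.sq_sqrt hk0.le
  have hr : 0 ≤ P.rate k := by unfold rate; positivity
  have hsum : P.moment k d k ≤ ∑ j ∈ (Finset.Icc 1 P.m).filter (k ≤ ·), P.moment k d j :=
    Finset.single_le_sum (f := fun j => P.moment k d j) (fun j _ => P.moment_nonneg k d j)
      (by simp [hk, hkm])
  have e1 : P.rate k * (P.ρ * √(k : ℝ)) = 4 * P.ρ ^ 2 / P.B ^ 2 := by
    unfold rate; field_simp
  have e2 : (k : ℝ) * (P.rate k ^ 2 * P.B ^ 2 / 8) = 2 * P.ρ ^ 2 / P.B ^ 2 := by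
    rw [rate, div_pow, mul_pow (√(k : ℝ)), hss]; field_simp; ring
  have hm : Real.exp (2 * P.ρ ^ 2 / P.B ^ 2) ≤ P.moment k d k := by
    unfold moment
    rw [e2]
    have h1 := mul_le_mul_of_nonneg_left hd hr
    rw [e1] at h1
    have e3 : 4 * P.ρ ^ 2 / P.B ^ 2 = 2 * P.ρ ^ 2 / P.B ^ 2 + 2 * P.ρ ^ 2 / P.B ^ 2 := by ring
    rcases abs_cases d with ⟨h2, _⟩ | ⟨h2, _⟩
    · rw [h2] at h1
      exact (Real.exp_le_exp.2 (by linarith)).trans (le_add_of_nonneg_right (Real.exp_pos _).le)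
    · rw [h2] at h1
      exact (Real.exp_le_exp.2 (by linarith)).trans (le_add_of_nonneg_left (Real.exp_pos _).le)
  calc (1 : ℝ) = P.tail * Real.exp (2 * P.ρ ^ 2 / P.B ^ 2) := by
        rw [tail, ← Real.exp_add]; simp
    _ ≤ P.risk k d := mul_le_mul_of_nonneg_left (hm.trans hsum) P.tail_pos.le

end Params

section

variable {S A : Type u} [MeasurableSpace S] [MeasurableSpace A] [Finite S]
  [MeasurableSingletonClass S] {M : MDP S A} {P : Params}

/-- Hoeffding's lemma for the sample `r + γ v(s')`. -/
theorem MDP.exp_moment_le (M : MDP S A) (hP : P.Admissible) (hM : M.γ = P.γ) {v : S → ℝ}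
    (h0 : ∀ s, 0 ≤ v s) (hB : ∀ s, v s ≤ P.B) (p : S × A) (θ : ℝ) :
    Integrable (fun z : ℝ × S => Real.exp (θ * (z.1 + M.γ * v z.2 - M.backup v p)))
      (M.outcome p) ∧
    ∫ z, Real.exp (θ * (z.1 + M.γ * v z.2 - M.backup v p)) ∂(M.outcome p) ≤
      Real.exp (θ ^ 2 * P.B ^ 2 / 8) := by
  have h1 := M.ae_reward_add_mem h0 hB p
  rw [hM, hP.one_add_γ_mul_B, ← hM] at h1
  have h2 := hasSubgaussianMGF_of_mem_Icc (measurable_reward_add M.γ v).aemeasurable h1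
  refine ⟨h2.integrable_exp_mul θ, (h2.mgf_le θ).trans_eq ?_⟩
  congr 1
  have h3 : ((‖P.B - 0‖₊ : NNReal) : ℝ) = P.B := by
    rw [coe_nnnorm, sub_zero, Real.norm_of_nonneg hP.B_pos.le]
  push_cast
  rw [show ‖P.B - 0‖ = P.B from h3]
  ring

/-- Hoeffding's lemma makes each `moment` a supermartingale in the number of samples, and going from
`k` to `k + 1` only discards the nonnegative term `j = k`. -/
theorem MDP.integral_risk_le (M : MDP S A) (hP : P.Admissible) (hM : M.γ = P.γ) {v : S → ℝ}
    (h0 : ∀ s, 0 ≤ v s) (hB : ∀ s, v s ≤ P.B) (p : S × A) (k : ℕ) (d : ℝ) :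
    Integrable (fun z : ℝ × S => P.risk (k + 1) (d + (z.1 + M.γ * v z.2 - M.backup v p)))
      (M.outcome p) ∧
    ∫ z, P.risk (k + 1) (d + (z.1 + M.γ * v z.2 - M.backup v p)) ∂(M.outcome p) ≤ P.risk k d := by
  have term : ∀ θ : ℝ,
      Integrable (fun z : ℝ × S => Real.exp (θ * (d + (z.1 + M.γ * v z.2 - M.backup v p)) -
        ((k + 1 : ℕ) : ℝ) * (θ ^ 2 * P.B ^ 2 / 8))) (M.outcome p) ∧
      ∫ z, Real.exp (θ * (d + (z.1 + M.γ * v z.2 - M.backup v p)) -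
        ((k + 1 : ℕ) : ℝ) * (θ ^ 2 * P.B ^ 2 / 8)) ∂(M.outcome p) ≤
        Real.exp (θ * d - k * (θ ^ 2 * P.B ^ 2 / 8)) := by
    intro θ
    obtain ⟨i1, i2⟩ := M.exp_moment_le hP hM h0 hB p θ
    have e : (fun z : ℝ × S => Real.exp (θ * (d + (z.1 + M.γ * v z.2 - M.backup v p)) -
        ((k + 1 : ℕ) : ℝ) * (θ ^ 2 * P.B ^ 2 / 8))) = fun z =>
        Real.exp (θ * d - ((k + 1 : ℕ) : ℝ) * (θ ^ 2 * P.B ^ 2 / 8)) *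
          Real.exp (θ * (z.1 + M.γ * v z.2 - M.backup v p)) := by
      funext z
      rw [← Real.exp_add]
      congr 1
      ring
    rw [e]
    refine ⟨i1.const_mul _, ?_⟩
    rw [integral_const_mul]
    refine (mul_le_mul_of_nonneg_left i2 (Real.exp_pos _).le).trans_eq ?_
    rw [← Real.exp_add]
    congr 1
    push_cast
    ring
  have hInt : ∀ j, Integrable (fun z : ℝ × S =>
      P.moment (k + 1) (d + (z.1 + M.γ * v z.2 - M.backup v p)) j) (M.outcome p) := by
    intro j
    have h2 := (term (-P.rate j)).1
    rw [neg_sq] at h2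
    exact (term (P.rate j)).1.add h2
  have hle : ∀ j, ∫ z, P.moment (k + 1) (d + (z.1 + M.γ * v z.2 - M.backup v p)) j
      ∂(M.outcome p) ≤ P.moment k d j := by
    intro j
    have h2 := term (-P.rate j)
    rw [neg_sq] at h2
    unfold Params.moment
    rw [integral_add (term (P.rate j)).1 h2.1]
    exact add_le_add (term (P.rate j)).2 h2.2
  unfold Params.risk
  refine ⟨(integrable_finsetSum _ fun j _ => hInt j).const_mul _, ?_⟩
  rw [integral_const_mul, integral_finsetSum _ fun j _ => hInt j]
  refine mul_le_mul_of_nonneg_left ?_ P.tail_pos.le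
  refine (Finset.sum_le_sum fun j _ => hle j).trans ?_
  refine Finset.sum_le_sum_of_subset_of_nonneg ?_ fun j _ _ => P.moment_nonneg k d j
  intro j
  simp only [Finset.mem_filter]
  exact fun h => ⟨h.1, by omega⟩

end

/-! ### Counting the attempted updates that can still be completed. -/

section

variable {S A : Type u} [Fintype S] [Fintype A]

/-- A bound on the number of attempted updates of `p` that can fail before the next successful
update of any pair. -/
def Memory.failuresLeft (σ : Memory S A) (p : S × A) : ℝ :=
  if σ.b p ≤ σ.tstar then 2 else if σ.learn p = true then 1 else 0

/-- A bound on the number of attempted updates that are still to be completed. -/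
def Memory.attemptsLeft (P : Params) (σ : Memory S A) : ℝ :=
  ∑ p, σ.failuresLeft p + (1 + 2 * Fintype.card (S × A)) / P.ε₁ * ∑ p, σ.Q' P p

omit [Fintype S] [Fintype A] in
theorem Memory.failuresLeft_mem (σ : Memory S A) (p : S × A) :
    0 ≤ σ.failuresLeft p ∧ σ.failuresLeft p ≤ 2 := by
  unfold failuresLeft
  split_ifs <;> norm_num

variable [Nonempty A] {P : Params} {t : ℕ} {σ : Memory S A}

omit [Nonempty A] in
theorem Memory.Bounded.attemptsLeft_nonneg (h : Memory.Bounded P t σ) (hP : P.Admissible) :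
    0 ≤ σ.attemptsLeft P :=
  add_nonneg (Finset.sum_nonneg fun p _ => (σ.failuresLeft_mem p).1)
    (mul_nonneg (div_nonneg (by positivity) hP.ε₁_pos.le)
      (Finset.sum_nonneg fun p _ => h.Q'_nonneg hP p))

theorem sum_eq_add_of_eq_off {ι : Type*} [Fintype ι] {f g : ι → ℝ} (i : ι)
    (h : ∀ j, j ≠ i → f j = g j) : ∑ j, f j = ∑ j, g j + (f i - g i) := by
  classical
  rw [← Finset.add_sum_erase _ f (Finset.mem_univ i), ← Finset.add_sum_erase _ g (Finset.mem_univ i),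
    Finset.sum_congr rfl fun j hj => h j (Finset.ne_of_mem_erase hj)]
  ring

/-- Each completed attempted update uses up at least one of the attempts left. -/
theorem Memory.Bounded.attemptsLeft_step (h : Memory.Bounded P t σ) (hP : P.Admissible) (s : S)
    (a : A) (r : ℝ) (s' : S) :
    (σ.step P (t + 1) s a r s').attemptsLeft P ≤ σ.attemptsLeft P ∧
    (σ.Sampled (s, a) → (σ.step P (t + 1) s a r s').n (s, a) = 0 →
      (σ.step P (t + 1) s a r s').attemptsLeft P ≤ σ.attemptsLeft P - 1) := by
  have hag := σ.agreeOff_step P (t + 1) s a r s'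
  have hQ' : ∀ q, q ≠ (s, a) → (σ.step P (t + 1) s a r s').Q' P q = σ.Q' P q := by
    intro q hq
    unfold Memory.Q'
    rw [hag.Q q hq, hag.E q hq]
  have hf : (σ.step P (t + 1) s a r s').tstar = σ.tstar → ∀ q, q ≠ (s, a) →
      (σ.step P (t + 1) s a r s').failuresLeft q = σ.failuresLeft q := by
    intro h1 q hq
    unfold Memory.failuresLeft
    rw [hag.b q hq, hag.learn q hq, h1]
  have hsumQ := sum_eq_add_of_eq_off (s, a) hQ'
  have hsumf := fun h1 => sum_eq_add_of_eq_off (s, a) (hf h1)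
  have hε := hP.ε₁_pos
  rcases σ.step_cases P (t + 1) s a r s' with c | c | c | c
  · rw [c.2]
    exact ⟨le_rfl, fun h1 => absurd h1 c.1⟩
  · have key : (σ.step P (t + 1) s a r s').attemptsLeft P ≤ σ.attemptsLeft P - 1 := by
      -- A success may restore up to two failures for every pair. The weight `(1 + 2 N) / ε₁`, with
      -- `N` the number of pairs, makes the drop of `Q'` pay for these and for the completed
      -- attempt.
      unfold Memory.attemptsLeft
      have h1 : ∑ p, (σ.step P (t + 1) s a r s').failuresLeft p ≤ 2 * Fintype.card (S × A) := by
        refine (Finset.sum_le_card_nsmul _ _ 2 fun p _ => (Memory.failuresLeft_mem _ p).2).trans ?_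
        rw [nsmul_eq_mul, mul_comm]
        rfl
      have h2 : 0 ≤ ∑ p, σ.failuresLeft p :=
        Finset.sum_nonneg fun p _ => (σ.failuresLeft_mem p).1
      have h3 : ∑ p, (σ.step P (t + 1) s a r s').Q' P p ≤ ∑ p, σ.Q' P p - P.ε₁ := by
        rw [hsumQ]
        linarith [c.Q'_le]
      have h4 : (0 : ℝ) ≤ (1 + 2 * Fintype.card (S × A)) / P.ε₁ := by positivity
      have h5 := mul_le_mul_of_nonneg_left h3 h4
      rw [mul_sub, div_mul_cancel₀ _ hε.ne'] at h5
      linarith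
    exact ⟨by linarith, fun _ _ => key⟩
  · have hQp : (σ.step P (t + 1) s a r s').Q' P (s, a) = σ.Q' P (s, a) := by
      unfold Memory.Q'
      rw [c.Q, c.E]
    have h1 := h.tstar_le
    -- A failed attempt that began no later than `tstar` leaves learning on and leads from two to
    -- one; the next, begun after `tstar`, switches it off and leads to zero.
    have hfp : (σ.step P (t + 1) s a r s').failuresLeft (s, a) = σ.failuresLeft (s, a) - 1 := by
      have h2 : ¬ t + 1 ≤ σ.tstar := by omega
      unfold Memory.failuresLeft
      rw [c.b, c.tstar, if_neg h2]
      by_cases h3 : σ.b (s, a) ≤ σ.tstar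
      · rw [if_pos h3, if_pos (c.learn.2 h3)]; norm_num
      · rw [if_neg h3, if_neg fun h4 => h3 (c.learn.1 h4), if_pos (c.sampled.resolve_right h3)]
        norm_num
    have key : (σ.step P (t + 1) s a r s').attemptsLeft P ≤ σ.attemptsLeft P - 1 := by
      unfold Memory.attemptsLeft
      rw [hsumQ, hsumf c.tstar, hQp, hfp]
      linarith
    exact ⟨by linarith, fun _ _ => key⟩
  · have hQp : (σ.step P (t + 1) s a r s').Q' P (s, a) = σ.Q' P (s, a) := by
      unfold Memory.Q'
      rw [c.Q, c.E]
    have hfp : (σ.step P (t + 1) s a r s').failuresLeft (s, a) = σ.failuresLeft (s, a) := by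
      unfold Memory.failuresLeft
      rw [c.b, c.tstar]
      by_cases h3 : σ.b (s, a) ≤ σ.tstar
      · rw [if_pos h3, if_pos h3]
      · rw [if_neg h3, if_neg h3, if_pos c.learn, if_pos (c.sampled.resolve_right h3)]
    refine ⟨?_, fun _ h1 => ?_⟩
    · unfold Memory.attemptsLeft
      rw [hsumQ, hsumf c.tstar, hQp, hfp]
      linarith
    · rw [c.n] at h1
      omega

end

/-! ### The probability that a sample is ever bad. -/

section

variable {S A : Type u} [Fintype S] [Fintype A] [MeasurableSpace S] [MeasurableSpace A]

namespace Ghost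

/-- The deviation of the sum of the samples of the current attempted update of `p`. -/
def deviation (e : Ghost S A) (p : S × A) : ℝ := e.mem.n p * e.mem.Qt p - e.Z p

/-- A bound on the probability that a sample will ever be bad. -/
def totalRisk (P : Params) (e : Ghost S A) : ℝ :=
  P.risk 0 0 * e.mem.attemptsLeft P + ∑ p, P.risk (e.mem.n p) (e.deviation p)

variable [Nonempty A]

/-- The deviation of `p` after one more sample. -/
def nextDeviation (M : MDP S A) (e : Ghost S A) (p : S × A) (r : ℝ) (s' : S) : ℝ :=
  e.deviation p + (r + M.γ * e.mem.V s' - M.backup e.mem.V p)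

open Classical in
/-- The value of `totalRisk` when a sample of `p` has been drawn but the inner loop has not been
restarted yet. -/
def sampledRisk (M : MDP S A) (P : Params) (e : Ghost S A) (p : S × A) (r : ℝ) (s' : S) : ℝ :=
  if e.mem.Sampled p then
    e.totalRisk P + (P.risk (e.mem.n p + 1) (e.nextDeviation M p r s') -
      P.risk (e.mem.n p) (e.deviation p))
  else e.totalRisk P

variable {M : MDP S A} {P : Params} {t : ℕ} {e : Ghost S A}

omit [Fintype S] in
theorem nextDeviation_eq (hM : M.γ = P.γ) (p : S × A) (r : ℝ) (s' : S) :
    e.nextDeviation M p r s' = ((e.mem.n p + 1 : ℕ) : ℝ) * e.mem.nextQt P p r s' -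
      (e.Z p + M.backup e.mem.V p) := by
  rw [Memory.nextQt_mul, nextDeviation, deviation, hM]
  ring

omit [MeasurableSpace S] [MeasurableSpace A] [Nonempty A] in
theorem risk_le_totalRisk (hb : Memory.Bounded P t e.mem) (hP : P.Admissible) (p : S × A) :
    P.risk (e.mem.n p) (e.deviation p) ≤ e.totalRisk P :=
  (Finset.single_le_sum (f := fun p => P.risk (e.mem.n p) (e.deviation p))
    (fun _ _ => P.risk_nonneg _ _) (Finset.mem_univ p)).trans
      (le_add_of_nonneg_left (mul_nonneg (P.risk_nonneg 0 0) (hb.attemptsLeft_nonneg hP)))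

omit [MeasurableSpace S] [MeasurableSpace A] [Nonempty A] in
theorem totalRisk_nonneg (hb : Memory.Bounded P t e.mem) (hP : P.Admissible) :
    0 ≤ e.totalRisk P :=
  add_nonneg (mul_nonneg (P.risk_nonneg 0 0) (hb.attemptsLeft_nonneg hP))
    (Finset.sum_nonneg fun _ _ => P.risk_nonneg _ _)

theorem sampledRisk_nonneg (hb : Memory.Bounded P t e.mem) (hP : P.Admissible) (p : S × A)
    (r : ℝ) (s' : S) : 0 ≤ e.sampledRisk M P p r s' := by
  unfold sampledRisk
  split_ifs
  · linarith [risk_le_totalRisk hb hP p, P.risk_nonneg (e.mem.n p + 1) (e.nextDeviation M p r s')]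
  · exact totalRisk_nonneg hb hP

/-- All other contributions to the sampled risk are nonnegative, so the risk of the pair just
sampled is itself below one, and `one_le_risk` excludes a large deviation. -/
theorem goodSample_of_sampledRisk_lt (hb : Memory.Bounded P t e.mem) (hP : P.Admissible)
    (hM : M.γ = P.γ) {p : S × A} {r : ℝ} {s' : S} (h : e.sampledRisk M P p r s' < 1) :
    GoodSample M P e p r s' := by
  intro hs
  rw [sampledRisk, if_pos hs] at h
  have h1 : P.risk (e.mem.n p + 1) (e.nextDeviation M p r s') < 1 := by
    linarith [risk_le_totalRisk hb hP p]
  rw [nextDeviation_eq hM] at h1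
  by_contra h2
  exact absurd (P.one_le_risk (Nat.le_add_left 1 _) (hb.n_lt p) hP.B_pos hP.ρ_nonneg
    (not_le.1 h2).le) (not_le.2 h1)

/-- A completed attempt is replaced by a fresh one of risk `P.risk 0 0`; the unit that leaves
`attemptsLeft` pays for it. -/
theorem totalRisk_step_le (hb : Bounded M P t e) (hP : P.Admissible) (hM : M.γ = P.γ) (s : S)
    (a : A) (r : ℝ) (s' : S) :
    (e.step M P (t + 1) s a r s').totalRisk P ≤ e.sampledRisk M P (s, a) r s' := by
  have hag := e.mem.agreeOff_step P (t + 1) s a r s'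
  obtain ⟨hA1, hA2⟩ := hb.mem.attemptsLeft_step hP s a r s'
  have h0 := P.risk_nonneg 0 0
  have hoff : ∀ q, q ≠ (s, a) →
      P.risk ((e.step M P (t + 1) s a r s').mem.n q) ((e.step M P (t + 1) s a r s').deviation q) =
        P.risk (e.mem.n q) (e.deviation q) := by
    intro q hq
    unfold deviation
    rw [step_Z_of_ne M P e _ s a r s' hq,
      show (e.step M P (t + 1) s a r s').mem.n q = e.mem.n q from hag.n q hq,
      show (e.step M P (t + 1) s a r s').mem.Qt q = e.mem.Qt q from hag.Qt q hq]
  have hsum := sum_eq_add_of_eq_off (s, a) hoff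
  have reset : e.mem.Sampled (s, a) → (e.mem.step P (t + 1) s a r s').n (s, a) = 0 →
      (e.step M P (t + 1) s a r s').totalRisk P ≤ e.sampledRisk M P (s, a) r s' := by
    intro hs hn
    have hd : P.risk ((e.step M P (t + 1) s a r s').mem.n (s, a))
        ((e.step M P (t + 1) s a r s').deviation (s, a)) = P.risk 0 0 := by
      unfold deviation
      rw [step_Z_reset M P e _ s a r s' hs hn,
        show (e.step M P (t + 1) s a r s').mem.n (s, a) = 0 from hn]
      simp
    rw [sampledRisk, if_pos hs]
    unfold totalRisk
    rw [hsum, hd]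
    have h1 := mul_le_mul_of_nonneg_left (hA2 hs hn) h0
    have h2 := P.risk_nonneg (e.mem.n (s, a) + 1) (e.nextDeviation M (s, a) r s')
    change P.risk 0 0 * (e.mem.step P (t + 1) s a r s').attemptsLeft P + _ ≤ _
    linarith
  rcases e.mem.step_cases P (t + 1) s a r s' with c | c | c | c
  · rw [sampledRisk, if_neg c.1]
    unfold totalRisk deviation
    rw [step_Z_of_not_sampled M P e _ s a r s' c.1,
      show (e.step M P (t + 1) s a r s').mem = e.mem from c.2]
  · exact reset c.sampled c.n
  · exact reset c.sampled c.n
  · have hn1 : (e.mem.step P (t + 1) s a r s').n (s, a) ≠ 0 := by rw [c.n]; omega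
    have hd : P.risk ((e.step M P (t + 1) s a r s').mem.n (s, a))
        ((e.step M P (t + 1) s a r s').deviation (s, a)) =
        P.risk (e.mem.n (s, a) + 1) (e.nextDeviation M (s, a) r s') := by
      unfold deviation
      rw [nextDeviation_eq hM, step_Z_continue M P e _ s a r s' c.sampled hn1,
        show (e.step M P (t + 1) s a r s').mem.n (s, a) = e.mem.n (s, a) + 1 from c.n,
        show (e.step M P (t + 1) s a r s').mem.Qt (s, a) = _ from c.Qt]
    rw [sampledRisk, if_pos c.sampled]
    unfold totalRisk
    rw [hsum, hd]
    have h1 := mul_le_mul_of_nonneg_left hA1 h0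
    change P.risk 0 0 * (e.mem.step P (t + 1) s a r s').attemptsLeft P + _ ≤ _
    linarith

theorem lintegral_sampledRisk_le [MeasurableSingletonClass S] (hb : Memory.Bounded P t e.mem)
    (hP : P.Admissible) (hM : M.γ = P.γ) (p : S × A) :
    ∫⁻ z, ENNReal.ofReal (e.sampledRisk M P p z.1 z.2) ∂(M.outcome p) ≤
      ENNReal.ofReal (e.totalRisk P) := by
  by_cases hs : e.mem.Sampled p
  · obtain ⟨i1, i2⟩ := M.integral_risk_le hP hM hb.V_nonneg hb.V_le p (e.mem.n p) (e.deviation p)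
    change Integrable (fun z : ℝ × S => P.risk (e.mem.n p + 1) (e.nextDeviation M p z.1 z.2)) _ at i1
    change ∫ z, P.risk (e.mem.n p + 1) (e.nextDeviation M p z.1 z.2) ∂(M.outcome p) ≤ _ at i2
    have i3 : Integrable (fun z : ℝ × S => P.risk (e.mem.n p + 1) (e.nextDeviation M p z.1 z.2) -
          P.risk (e.mem.n p) (e.deviation p)) (M.outcome p) :=
      i1.sub (integrable_const _)
    have e1 : ∀ z : ℝ × S, e.sampledRisk M P p z.1 z.2 = e.totalRisk P +
        (P.risk (e.mem.n p + 1) (e.nextDeviation M p z.1 z.2) -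
          P.risk (e.mem.n p) (e.deviation p)) := fun z => if_pos hs
    rw [← ofReal_integral_eq_lintegral_ofReal]
    · refine ENNReal.ofReal_le_ofReal ?_
      simp only [e1]
      rw [integral_add (integrable_const _) i3,
        integral_sub i1 (integrable_const _)]
      simp only [integral_const, probReal_univ, one_smul]
      linarith
    · simp only [e1]
      exact (integrable_const _).add i3
    · exact Filter.Eventually.of_forall fun z => sampledRisk_nonneg hb hP p z.1 z.2
  · have e1 : ∀ z : ℝ × S, e.sampledRisk M P p z.1 z.2 = e.totalRisk P := fun z => if_neg hs
    simp only [e1, lintegral_const, measure_univ, mul_one, le_refl]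

theorem bounded_run [MeasurableSingletonClass S] (hP : P.Admissible) :
    ∀ (n : ℕ) (h : Hist S A n), h ∈ rewardGood S A 0 n → Bounded M P n (run M P n h)
  | 0, _, _ => bounded_init hP
  | n + 1, h, hh => by
    obtain ⟨h1, h2⟩ := mem_rewardGood_succ.1 hh
    exact (bounded_run hP n h.prev h1).step hP _ _ (h2 (Nat.zero_le n)).1 _

/-- The value of `sampledRisk` at the last transition of a history. -/
def riskBound (M : MDP S A) (P : Params) : (n : ℕ) → Hist S A n → ENNReal
  | 0, _ => ENNReal.ofReal ((init P : Ghost S A).totalRisk P)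
  | n + 1, h => ENNReal.ofReal ((run M P n h.prev).sampledRisk M P
      (h.prev.state, h.last.1) h.last.2.1 h.last.2.2)

omit [Fintype S] [Fintype A] [MeasurableSpace S] [MeasurableSpace A] [Nonempty A] in
theorem MeasurableFamily.deviation {α : Type*} [MeasurableSpace α] {f : α → Ghost S A}
    (hf : MeasurableFamily f) (p : S × A) : Measurable fun x => (f x).deviation p :=
  (((measurable_from_nat (f := fun k : ℕ => (k : ℝ))).comp (hf.mem.n p)).mul (hf.mem.Qt p)).sub
    (hf.Z p)

omit [MeasurableSpace S] [MeasurableSpace A] [Nonempty A] in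
theorem MeasurableFamily.totalRisk {α : Type*} [MeasurableSpace α] {f : α → Ghost S A}
    (hf : MeasurableFamily f) (P : Params) : Measurable fun x => (f x).totalRisk P := by
  have h1 : ∀ p, Measurable fun x => (f x).mem.failuresLeft p := fun p =>
    Measurable.ite (measurableSet_le (hf.mem.b p) hf.mem.tstar) measurable_const
      (Measurable.ite (hf.mem.learn p (measurableSet_singleton true)) measurable_const
        measurable_const)
  refine Measurable.add (Measurable.const_mul ?_ _) (Finset.measurable_fun_sum _ fun p _ => ?_)
  · exact (Finset.measurable_fun_sum _ fun p _ => h1 p).add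
      ((Finset.measurable_fun_sum _ fun p _ => hf.mem.Q' P p).const_mul _)
  · exact measurable_countable_index (F := fun k x => P.risk k ((f x).deviation p))
      (fun k => (P.measurable_risk k).comp (hf.deviation p)) (hf.mem.n p)

theorem MeasurableFamily.sampledRisk [MeasurableSingletonClass S] {α : Type*} [MeasurableSpace α]
    {f : α → Ghost S A} (hf : MeasurableFamily f) (M : MDP S A) (P : Params) (p : S × A)
    {r : α → ℝ} (hr : Measurable r) (s' : S) :
    Measurable fun x => (f x).sampledRisk M P p (r x) s' := by
  classical
  have hd : Measurable fun x => (f x).nextDeviation M p (r x) s' :=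
    (hf.deviation p).add ((hr.add ((hf.mem.V s').const_mul _)).sub
      (M.measurable_backup p hf.mem.V))
  refine Measurable.ite (hf.mem.measurableSet_sampled p) ((hf.totalRisk P).add
    (Measurable.sub ?_ ?_)) (hf.totalRisk P)
  · exact measurable_countable_index
      (F := fun k x => P.risk (k + 1) ((f x).nextDeviation M p (r x) s'))
      (fun k => (P.measurable_risk (k + 1)).comp hd) (hf.mem.n p)
  · exact measurable_countable_index (F := fun k x => P.risk k ((f x).deviation p))
      (fun k => (P.measurable_risk k).comp (hf.deviation p)) (hf.mem.n p)

theorem measurable_riskBound [MeasurableSingletonClass S] [MeasurableSingletonClass A]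
    (M : MDP S A) (P : Params) : ∀ n, Measurable (riskBound M P n)
  | 0 => measurable_const
  | n + 1 => by
    refine ENNReal.measurable_ofReal.comp ?_
    exact measurable_countable_index
      (F := fun (i : S × A × S) (h : Hist S A (n + 1)) =>
        (run M P n h.prev).sampledRisk M P (i.1, i.2.1) h.last.2.1 i.2.2)
      (fun i => ((measurableFamily_run M P n).comp Hist.measurable_prev).sampledRisk M P
        (i.1, i.2.1) Hist.measurable_last_reward i.2.2) Hist.measurable_lastTriple

theorem totalRisk_run_le [MeasurableSingletonClass S] (hP : P.Admissible) (hM : M.γ = P.γ) :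
    ∀ (n : ℕ) (h : Hist S A n), h ∈ rewardGood S A 0 n →
      ENNReal.ofReal ((run M P n h).totalRisk P) ≤ riskBound M P n h
  | 0, _, _ => le_rfl
  | n + 1, h, hh => ENNReal.ofReal_le_ofReal
      (totalRisk_step_le (bounded_run hP n h.prev (mem_rewardGood_succ.1 hh).1) hP hM _ _ _ _)

/-- The risk is recorded after the draw and before a restart, so that a bad sample that ends its
attempt is still seen. Averaging over the draw returns at most `totalRisk`, which is at most the
value recorded one step earlier. -/
theorem lintegral_riskBound_le [MeasurableSingletonClass S] [MeasurableSingletonClass A]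
    (hP : P.Admissible) (hM : M.γ = P.γ) (π : Policy S A) (n : ℕ) (h : Hist S A n)
    (hh : h ∈ rewardGood S A 0 n) :
    ∫⁻ y, riskBound M P (n + 1) (h.snoc y) ∂(M.next π n h) ≤ riskBound M P n h := by
  have := π.markov n
  rw [M.lintegral_next π n h (f := fun y => riskBound M P (n + 1) (h.snoc y))
    ((measurable_riskBound M P (n + 1)).comp h.measurable_snoc_right)]
  refine le_trans (lintegral_mono (g := fun _ => ENNReal.ofReal ((run M P n h).totalRisk P))
    fun a => ?_) ?_
  · simp only [riskBound, Hist.prev_snoc, Hist.last_snoc]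
    exact lintegral_sampledRisk_le (bounded_run hP n h hh).mem hP hM (h.state, a)
  · simp only [lintegral_const, measure_univ, mul_one]
    exact totalRisk_run_le hP hM n h hh

/-- The invariants hold along all streams on which the risk stays below one. -/
theorem good_run [MeasurableSingletonClass S] (hP : P.Admissible) (hM : M.γ = P.γ)
    (x : Stream S A) (hx : ∀ n, x.hist n ∈ rewardGood S A 0 n)
    (hr : ∀ n, riskBound M P n (x.hist n) < 1) : ∀ n, Good M P (run M P n (x.hist n))
  | 0 => good_init hP hM
  | n + 1 => by
    have hb := bounded_run (M := M) hP n (x.hist n) (hx n)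
    have h1 := (mem_rewardGood_succ.1 (hx (n + 1))).2 (Nat.zero_le n)
    rw [run_succ]
    refine (good_run hP hM x hx hr n).step hb hP _ _ h1.1 _ ?_
    refine goodSample_of_sampledRisk_lt hb.mem hP hM ?_
    have h2 := hr (n + 1)
    rw [riskBound, ENNReal.ofReal_lt_one] at h2
    exact h2

/-- The accumulated cost of all pairs. -/
def totalCost (e : Ghost S A) : ℝ := ∑ p, e.cost p

/-- Since `Q'` stays nonnegative, the budget of a pair is at most `10 m (B + λ)`; the running
attempt adds at most `m B` and the allowance `4 ε₁ m`. The constant 20 is generous. -/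
theorem Good.totalCost_le (h : Good M P e) (hb : Bounded M P t e) (hP : P.Admissible) :
    e.totalCost ≤ 20 * Fintype.card (S × A) * P.m * P.B := by
  have hm := hP.one_le_m
  have hB := hP.one_le_B
  have h1 : ∀ p, e.cost p ≤ 20 * P.m * P.B := by
    intro p
    have c1 := h.cost_le p
    have c2 : 0 ≤ e.Z p := le_trans (mul_nonneg (Nat.cast_nonneg _)
      (M.backup_nonneg hb.mem.V_nonneg p)) (hb.Z_ge p)
    have c3 : (e.mem.n p : ℝ) * e.mem.Q p ≤ P.m * P.B :=
      mul_le_mul (Nat.cast_le.2 (hb.mem.n_lt p).le) (hb.mem.Q_le p) (hb.mem.Q_nonneg p)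
        (Nat.cast_nonneg _)
    have c4 : budget P e.mem p ≤ 10 * P.m * (P.B + 1 / 2) := by
      unfold budget
      refine mul_le_mul_of_nonneg_left ?_ (by positivity)
      linarith [hb.mem.Q'_nonneg hP p, hP.lam_le, hP.ε₁_lt]
    have c5 : 4 * P.ε₁ * P.m ≤ 2 * P.m :=
      mul_le_mul_of_nonneg_right (by linarith [hP.ε₁_lt]) (by linarith)
    have c6 : (P.m : ℝ) * 1 ≤ P.m * P.B := mul_le_mul_of_nonneg_left hB (by linarith)
    linarith
  refine (Finset.sum_le_card_nsmul _ _ _ fun p _ => h1 p).trans_eq ?_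
  rw [nsmul_eq_mul, Finset.card_univ]
  ring

end Ghost

end

/-! ### From total cost to the sum of the excesses. -/

/-- The product of `1 - u + u²/2` and `1 + u + u²/2` is `1 + u⁴/4`, and the second factor is at most
`exp u`. -/
theorem exp_neg_le_of_nonneg {u : ℝ} (hu : 0 ≤ u) : Real.exp (-u) ≤ 1 - u + u ^ 2 / 2 := by
  rw [Real.exp_neg, inv_le_iff_one_le_mul₀ (Real.exp_pos u)]
  have h1 := Real.quadratic_le_exp_of_nonneg hu
  have h2 : 0 ≤ 1 - u + u ^ 2 / 2 := by nlinarith [sq_nonneg (u - 1)]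
  calc (1 : ℝ) ≤ (1 - u + u ^ 2 / 2) * (1 + u + u ^ 2 / 2) := by nlinarith [sq_nonneg (u ^ 2)]
    _ ≤ (1 - u + u ^ 2 / 2) * Real.exp u := mul_le_mul_of_nonneg_left h1 h2

theorem exp_neg_mul_le {θ x : ℝ} (hθ : 0 ≤ θ) (h0 : 0 ≤ x) (h1 : x ≤ 1) :
    Real.exp (-(θ * x)) ≤ 1 - θ * (1 - θ / 2) * x := by
  refine (exp_neg_le_of_nonneg (mul_nonneg hθ h0)).trans ?_
  have h2 : x ^ 2 ≤ x := by nlinarith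
  have h3 := mul_le_mul_of_nonneg_left h2 (sq_nonneg θ)
  rw [mul_pow]
  linarith

section

variable {S A : Type u} [Fintype S] [Fintype A] [Nonempty A] [MeasurableSpace S]
  [MeasurableSpace A] {M : MDP S A} {P : Params}

omit [Fintype S] [MeasurableSpace S] [MeasurableSpace A] in
theorem Memory.Bounded.V_le_step_add {t : ℕ} {σ : Memory S A} (h : Memory.Bounded P t σ)
    (hP : P.Admissible) (s : S) (a : A) (r : ℝ) (s' z : S) :
    σ.V z ≤ (σ.step P (t + 1) s a r s').V z +
      (σ.Q (s, a) - (σ.step P (t + 1) s a r s').Q (s, a)) := by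
  refine Memory.V_le fun a' => ?_
  have h1 := (σ.step P (t + 1) s a r s').Q_le_V z a'
  by_cases hq : (z, a') = (s, a)
  · rw [hq] at h1 ⊢
    linarith
  · rw [(σ.agreeOff_step P (t + 1) s a r s').Q _ hq] at h1
    linarith [h.Q_step_le hP s a r s' (s, a)]

omit [Fintype S] in
theorem Memory.Bounded.stepCost_mem {t : ℕ} {σ : Memory S A} (h : Memory.Bounded P t σ)
    (hP : P.Admissible) (s : S) (a : A) {r : ℝ} (hr : 0 ≤ r) (s' : S) :
    0 ≤ M.stepCost P σ (σ.step P (t + 1) s a r s') (s, a) ∧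
      M.stepCost P σ (σ.step P (t + 1) s a r s') (s, a) ≤ 2 * P.B := by
  have h1 := h.Q_step_le hP s a r s' (s, a)
  have h2 := h.Q_le (s, a)
  have h3 := (h.step hP s a hr s').Q_nonneg (s, a)
  have h4 := M.backup_nonneg h.V_nonneg (s, a)
  have h5 := hP.ε₁_pos
  have h6 : max 0 (M.residual σ (s, a) - 4 * P.ε₁) ≤ P.B :=
    max_le hP.B_pos.le (by unfold MDP.residual; linarith)
  have h7 : 0 ≤ max 0 (M.residual σ (s, a) - 4 * P.ε₁) := le_max_left _ _
  unfold MDP.stepCost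
  exact ⟨by linarith, by linarith⟩

theorem Ghost.totalCost_step (e : Ghost S A) (t : ℕ) (s : S) (a : A) (r : ℝ) (s' : S) :
    (e.step M P t s a r s').totalCost =
      e.totalCost + M.stepCost P e.mem (e.mem.step P t s a r s') (s, a) := by
  unfold totalCost
  rw [sum_eq_add_of_eq_off (s, a) fun q hq => step_cost_of_ne M P e t s a r s' hq,
    step_cost_self]
  ring

/-- The amount by which the greedy value at the current state exceeds the value of the policy, above
the tolerance `5 ε₁ / (1 - γ)`. -/
def MDP.excess (M : MDP S A) (π : Policy S A) (P : Params) (n : ℕ) (h : Hist S A n) : ℝ :=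
  max 0 ((Ghost.run M P n h).mem.V h.state - M.value π n h - 5 * P.ε₁ * P.B)

/-- The sum of the excesses at the proper prefixes of a history. -/
def MDP.sumExcess (M : MDP S A) (π : Policy S A) (P : Params) : (n : ℕ) → Hist S A n → ℝ
  | 0, _ => 0
  | n + 1, h => M.sumExcess π P n h.prev + M.excess π P n h.prev

omit [Fintype S] in
theorem MDP.excess_nonneg (π : Policy S A) (n : ℕ) (h : Hist S A n) : 0 ≤ M.excess π P n h :=
  le_max_left _ _

variable [MeasurableSingletonClass S]

theorem MDP.excess_le (hP : P.Admissible) (π : Policy S A) (n : ℕ) (h : Hist S A n)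
    (hh : h ∈ rewardGood S A 0 n) : M.excess π P n h ≤ P.B := by
  have h1 := (Ghost.bounded_run (M := M) hP n h hh).mem.V_le h.state
  have h2 := M.value_nonneg π n h
  have h3 := mul_nonneg (mul_nonneg (by norm_num : (0 : ℝ) ≤ 5) hP.ε₁_pos.le) hP.B_pos.le
  exact max_le hP.B_pos.le (by linarith)

variable [MeasurableSingletonClass A]

theorem MDP.measurable_excess (M : MDP S A) (π : Policy S A) (P : Params) (n : ℕ) :
    Measurable (M.excess π P n) := by
  have h1 : Measurable fun h : Hist S A n => (Ghost.run M P n h).mem.V h.state :=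
    measurable_countable_index (F := fun s (h : Hist S A n) => (Ghost.run M P n h).mem.V s)
      (fun s => (Ghost.measurableFamily_run M P n).mem.V s) (Hist.measurable_state n)
  exact measurable_const.max ((h1.sub (M.measurable_value π n)).sub measurable_const)

theorem MDP.measurable_sumExcess (M : MDP S A) (π : Policy S A) (P : Params) :
    ∀ n, Measurable (M.sumExcess π P n)
  | 0 => measurable_const
  | n + 1 => ((M.measurable_sumExcess π P n).comp Hist.measurable_prev).add
      ((M.measurable_excess π P n).comp Hist.measurable_prev)

theorem Ghost.measurable_totalCost_run (M : MDP S A) (P : Params) (n : ℕ) :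
    Measurable fun h : Hist S A n => (Ghost.run M P n h).totalCost :=
  Finset.measurable_fun_sum _ fun p _ => (Ghost.measurableFamily_run M P n).cost p

/-- The cost of the next transition plus the discounted excess after it. -/
def MDP.charge (M : MDP S A) (π : Policy S A) (P : Params) (n : ℕ) (h : Hist S A n)
    (y : A × ℝ × S) : ℝ :=
  (Ghost.run M P (n + 1) (h.snoc y)).totalCost - (Ghost.run M P n h).totalCost +
    P.γ * M.excess π P (n + 1) (h.snoc y)

theorem MDP.measurable_charge (M : MDP S A) (π : Policy S A) (P : Params) (n : ℕ)
    (h : Hist S A n) : Measurable (M.charge π P n h) :=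
  (((Ghost.measurable_totalCost_run M P (n + 1)).comp h.measurable_snoc_right).sub
    measurable_const).add
      (((M.measurable_excess π P (n + 1)).comp h.measurable_snoc_right).const_mul _)

omit [MeasurableSingletonClass S] [MeasurableSingletonClass A] in
theorem MDP.charge_eq (π : Policy S A) (n : ℕ) (h : Hist S A n) (y : A × ℝ × S) :
    M.charge π P n h y = M.stepCost P (Ghost.run M P n h).mem
      ((Ghost.run M P n h).mem.step P (n + 1) h.state y.1 y.2.1 y.2.2) (h.state, y.1) +
      P.γ * M.excess π P (n + 1) (h.snoc y) := by
  rw [MDP.charge, Ghost.run_snoc, Ghost.totalCost_step]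
  ring

omit [MeasurableSingletonClass A] in
theorem MDP.ae_charge_mem (hP : P.Admissible) (π : Policy S A) (n : ℕ) (h : Hist S A n)
    (hh : h ∈ rewardGood S A 0 n) :
    ∀ᵐ y ∂(M.next π n h), M.charge π P n h y ∈ Set.Icc 0 (3 * P.B) := by
  filter_upwards [M.next_reward_mem π n h, M.ae_snoc_mem_rewardGood π 0 n h hh] with y hy hy'
  have h1 := (Ghost.bounded_run (M := M) hP n h hh).mem.stepCost_mem (M := M) hP h.state y.1 hy.1
    y.2.2
  have h2 := MDP.excess_le (M := M) hP π (n + 1) (h.snoc y) hy'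
  have h3 := MDP.excess_nonneg (M := M) (P := P) π (n + 1) (h.snoc y)
  have h4 := mul_nonneg hP.γ_nonneg h3
  have h5 := mul_le_of_le_one_left h3 hP.γ_lt_one.le
  rw [MDP.charge_eq]
  exact ⟨by linarith, by linarith⟩

theorem MDP.integrable_charge (hP : P.Admissible) (π : Policy S A) (n : ℕ) (h : Hist S A n)
    (hh : h ∈ rewardGood S A 0 n) : Integrable (M.charge π P n h) (M.next π n h) :=
  Integrable.of_mem_Icc 0 (3 * P.B) (M.measurable_charge π P n h).aemeasurable
    (MDP.ae_charge_mem hP π n h hh)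

/-- The excess is at most the expected charge of the next transition. -/
theorem MDP.excess_le_integral_charge (hP : P.Admissible) (hM : M.γ = P.γ) (π : Policy S A)
    (hπ : IsDirectedDelayedQ P π) (n : ℕ) (h : Hist S A n) (hh : h ∈ rewardGood S A 0 n) :
    M.excess π P n h ≤ ∫ y, M.charge π P n h y ∂(M.next π n h) := by
  have := π.markov n
  have hb := (Ghost.bounded_run (M := M) hP n h hh).mem
  have hc := MDP.ae_charge_mem (M := M) hP π n h hh
  refine max_le (integral_nonneg_of_ae (hc.mono fun y hy => hy.1)) ?_
  set σ := (Ghost.run M P n h).mem with hσ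
  -- This part of the step cost depends on the action but not on the outcome, so it can be combined
  -- with the backup before the outcome is averaged.
  let κ : A → ℝ := fun a => max 0 (M.residual σ (h.state, a) - 4 * P.ε₁)
  have hκm : Measurable fun y : A × ℝ × S => κ y.1 :=
    (measurable_of_finite κ).comp measurable_fst
  have hκi : Integrable (fun y : A × ℝ × S => κ y.1) (M.next π n h) := by
    refine Integrable.of_mem_Icc 0 P.B hκm.aemeasurable (Filter.Eventually.of_forall fun y => ?_)
    have h2 := hb.Q_le (h.state, y.1)
    have h4 := M.backup_nonneg hb.V_nonneg (h.state, y.1)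
    have h5 := hP.ε₁_pos
    exact ⟨le_max_left _ _, max_le hP.B_pos.le (by unfold MDP.residual; linarith)⟩
  have i1 : Integrable (fun y : A × ℝ × S => (y.2.1 + M.γ * σ.V y.2.2) + κ y.1) (M.next π n h) :=
    (M.integrable_next_backup π n h σ.V).add hκi
  have h1 : σ.V h.state - 5 * P.ε₁ ≤
      ∫ y, ((y.2.1 + M.γ * σ.V y.2.2) + κ y.1) ∂(M.next π n h) := by
    have e1 : ∫ y, ((y.2.1 + M.γ * σ.V y.2.2) + κ y.1) ∂(M.next π n h) =
        ∫ a, (M.backup σ.V (h.state, a) + κ a) ∂(π.act n h) := by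
      rw [M.integral_next π n h i1]
      refine integral_congr_ae (Filter.Eventually.of_forall fun a => ?_)
      dsimp only
      rw [integral_add (M.integrable_backup σ.V (h.state, a)) (integrable_const _)]
      simp [MDP.backup]
    rw [e1]
    have e2 : ∫ _, (σ.V h.state - 5 * P.ε₁) ∂(π.act n h) = σ.V h.state - 5 * P.ε₁ := by simp
    rw [← e2]
    refine integral_mono_ae (integrable_const _) Integrable.of_finite ?_
    refine ae_iff_of_countable.2 fun a ha => ?_
    have h2 := hπ n h a ha
    rw [← Ghost.run_mem M P n h, ← hσ] at h2
    -- The action is greedy for `Q'` instead of `Q`; bonuses in `[0, λ]` with `λ ≤ ε₁` lose at most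
    -- `ε₁`. With the free `4 ε₁` of the residual this makes `5 ε₁` per step.
    have h3 : σ.V h.state ≤ σ.Q (h.state, a) + P.ε₁ := by
      refine Memory.V_le fun a' => ?_
      have h4 := h2 a'
      have h5 := hP.bonus_nonneg (σ.E (h.state, a'))
      have h6 := hb.bonus_E_le hP (h.state, a)
      have h7 := hP.lam_le
      unfold Memory.Q' at h4
      linarith
    have h4 : M.residual σ (h.state, a) - 4 * P.ε₁ ≤ κ a := le_max_right _ _
    unfold MDP.residual at h4
    dsimp only
    linarith
  have i2 : Integrable (fun y : A × ℝ × S => y.2.1 + M.γ * M.value π (n + 1) (h.snoc y))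
      (M.next π n h) :=
    (M.integrable_next_reward π n h).add ((M.integrable_next_value π n h).const_mul _)
  have h2 : ∫ y, ((y.2.1 + M.γ * σ.V y.2.2) + κ y.1) ∂(M.next π n h) - M.value π n h ≤
      ∫ y, M.charge π P n h y ∂(M.next π n h) + P.γ * (5 * P.ε₁ * P.B) := by
    have e3 : ∫ y, M.charge π P n h y ∂(M.next π n h) + P.γ * (5 * P.ε₁ * P.B) =
        ∫ y, (M.charge π P n h y + P.γ * (5 * P.ε₁ * P.B)) ∂(M.next π n h) := by
      rw [integral_add (MDP.integrable_charge hP π n h hh) (integrable_const _)]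
      simp
    rw [e3, M.value_bellman π n h, ← integral_sub i1 i2]
    refine integral_mono (i1.sub i2)
      ((MDP.integrable_charge hP π n h hh).add (integrable_const _)) fun y => ?_
    -- The next excess uses `V` after the update. The loss in `V` is at most the decrease of the
    -- single Q-value that changed, which is the other part of the step cost.
    have h3 := hb.V_le_step_add hP h.state y.1 y.2.1 y.2.2 y.2.2
    have h4 := hb.Q_step_le hP h.state y.1 y.2.1 y.2.2 (h.state, y.1)
    have h5 : (σ.step P (n + 1) h.state y.1 y.2.1 y.2.2).V y.2.2 - M.value π (n + 1) (h.snoc y) -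
        5 * P.ε₁ * P.B ≤ M.excess π P (n + 1) (h.snoc y) := by
      have h6 : (Ghost.run M P (n + 1) (h.snoc y)).mem =
          σ.step P (n + 1) h.state y.1 y.2.1 y.2.2 := by rw [Ghost.run_snoc]; rfl
      rw [MDP.excess, h6, Hist.state_snoc]
      exact le_max_right _ _
    dsimp only
    rw [MDP.charge_eq, ← hσ, hM, MDP.stepCost]
    have h7 := mul_le_mul_of_nonneg_left h3 hP.γ_nonneg
    have h8 := mul_le_mul_of_nonneg_left h5 hP.γ_nonneg
    have h9 := mul_le_of_le_one_left (sub_nonneg.2 h4) hP.γ_lt_one.le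
    change _ ≤ κ y.1 + _ + _ + _
    linarith
  -- The tolerance `5 ε₁ B` is the fixed point of `x = 5 ε₁ + γ x`.
  have h3 : P.γ * (5 * P.ε₁ * P.B) + 5 * P.ε₁ = 5 * P.ε₁ * P.B := by
    have := hP.one_add_γ_mul_B
    calc P.γ * (5 * P.ε₁ * P.B) + 5 * P.ε₁ = 5 * P.ε₁ * (1 + P.γ * P.B) := by ring
      _ = _ := by rw [this]
  linarith

/-- The exponent of the supermartingale that controls the sum of the excesses. -/
def MDP.logPotential (M : MDP S A) (π : Policy S A) (P : Params) (n : ℕ) (h : Hist S A n) : ℝ :=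
  (1 - P.γ) ^ 2 / 3 * ((1 - P.γ) / 2 * M.sumExcess π P n h - (Ghost.run M P n h).totalCost -
    P.γ * M.excess π P n h)

theorem MDP.measurable_logPotential (M : MDP S A) (π : Policy S A) (P : Params) (n : ℕ) :
    Measurable (M.logPotential π P n) :=
  ((((M.measurable_sumExcess π P n).const_mul _).sub (Ghost.measurable_totalCost_run M P n)).sub
    ((M.measurable_excess π P n).const_mul _)).const_mul _

omit [MeasurableSingletonClass S] [MeasurableSingletonClass A] in
theorem MDP.logPotential_snoc (π : Policy S A) (n : ℕ) (h : Hist S A n) (y : A × ℝ × S) :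
    M.logPotential π P (n + 1) (h.snoc y) = M.logPotential π P n h +
      (1 - P.γ) ^ 2 / 3 * (1 - (1 - P.γ) / 2) * M.excess π P n h +
      -((1 - P.γ) ^ 2 / 3 * M.charge π P n h y) := by
  unfold MDP.logPotential MDP.charge
  rw [MDP.sumExcess, Hist.prev_snoc]
  ring

/-- Let `θ = 1 - γ`. Charges lie in `[0, 3 B]`, so `exp (-(θ²/3) charge)` is at most `1 - c *
charge`; its mean is at most `1 - c * excess ≤ exp (-(c * excess))`, which cancels the gain in
`logPotential_snoc`. At the scale `θ²/3 = θ / (3 B)` the quadratic term loses only the factor `1 -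
θ/2 = γ + θ/2`: the part `γ` pays for the discounted excess, and `θ/2` of each excess remains to be
summed. -/
theorem MDP.lintegral_exp_logPotential_le (hP : P.Admissible) (hM : M.γ = P.γ) (π : Policy S A)
    (hπ : IsDirectedDelayedQ P π) (n : ℕ) (h : Hist S A n) (hh : h ∈ rewardGood S A 0 n) :
    ∫⁻ y, ENNReal.ofReal (Real.exp (M.logPotential π P (n + 1) (h.snoc y))) ∂(M.next π n h) ≤
      ENNReal.ofReal (Real.exp (M.logPotential π P n h)) := by
  have hθ := hP.one_sub_γ_pos
  have hγ := hP.γ_nonneg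
  have hBθ := hP.one_sub_γ_mul_B
  have hB := hP.B_pos
  set K := M.logPotential π P n h + (1 - P.γ) ^ 2 / 3 * (1 - (1 - P.γ) / 2) * M.excess π P n h
    with hK
  set c := (1 - P.γ) ^ 2 / 3 * (1 - (1 - P.γ) / 2) with hc
  have hc0 : 0 ≤ c := mul_nonneg (by positivity) (by linarith)
  have hle : ∀ᵐ y ∂(M.next π n h), Real.exp (M.logPotential π P (n + 1) (h.snoc y)) ≤
      Real.exp K * (1 - c * M.charge π P n h y) := by
    filter_upwards [MDP.ae_charge_mem (M := M) hP π n h hh] with y hy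
    rw [MDP.logPotential_snoc, Real.exp_add]
    refine mul_le_mul_of_nonneg_left ?_ (Real.exp_pos _).le
    have h1 := exp_neg_mul_le hθ.le (x := M.charge π P n h y / (3 * P.B))
      (div_nonneg hy.1 (by linarith)) (div_le_one_of_le₀ hy.2 (by linarith))
    have e1 : (1 - P.γ) * (M.charge π P n h y / (3 * P.B)) =
        (1 - P.γ) ^ 2 / 3 * M.charge π P n h y := by
      rw [Params.B]; field_simp
    rw [e1] at h1
    refine h1.trans_eq ?_
    rw [hc, ← mul_right_comm ((1 - P.γ) ^ 2 / 3), ← e1]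
    ring
  have hic := MDP.integrable_charge (M := M) hP π n h hh
  calc ∫⁻ y, ENNReal.ofReal (Real.exp (M.logPotential π P (n + 1) (h.snoc y))) ∂(M.next π n h)
      ≤ ∫⁻ y, ENNReal.ofReal (Real.exp K * (1 - c * M.charge π P n h y)) ∂(M.next π n h) :=
        lintegral_mono_ae (hle.mono fun y hy => ENNReal.ofReal_le_ofReal hy)
    _ = ENNReal.ofReal (∫ y, Real.exp K * (1 - c * M.charge π P n h y) ∂(M.next π n h)) := by
        rw [ofReal_integral_eq_lintegral_ofReal]
        · exact ((integrable_const _).sub (hic.const_mul _)).const_mul _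
        · exact hle.mono fun y hy => (Real.exp_pos _).le.trans hy
    _ ≤ ENNReal.ofReal (Real.exp (M.logPotential π P n h)) := by
        refine ENNReal.ofReal_le_ofReal ?_
        rw [integral_const_mul, integral_sub (integrable_const _) (hic.const_mul _),
          integral_const_mul]
        simp only [integral_const, probReal_univ, one_smul]
        have h1 := mul_le_mul_of_nonneg_left
          (MDP.excess_le_integral_charge hP hM π hπ n h hh) hc0
        have h2 : 1 - c * ∫ y, M.charge π P n h y ∂(M.next π n h) ≤
            Real.exp (-(c * M.excess π P n h)) := by
          have h3 := Real.add_one_le_exp (-(c * M.excess π P n h))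
          linarith
        refine (mul_le_mul_of_nonneg_left h2 (Real.exp_pos _).le).trans_eq ?_
        rw [← Real.exp_add, hK]
        congr 1
        ring

omit [Fintype S] [MeasurableSingletonClass S] [MeasurableSingletonClass A] in
theorem MDP.sumExcess_hist (π : Policy S A) (x : Stream S A) :
    ∀ n, M.sumExcess π P n (x.hist n) = ∑ i ∈ Finset.range n, M.excess π P i (x.hist i)
  | 0 => rfl
  | n + 1 => by
    rw [MDP.sumExcess, Stream.prev_hist, MDP.sumExcess_hist π x n, Finset.sum_range_succ]

end

/-! ### Counting the bad timesteps. -/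

/-- `Set.ncard` is zero on infinite sets, so finiteness has to be derived too; testing finite
subsets gives both claims. -/
theorem finite_and_ncard_le_of_forall_finset {α : Type*} {s : Set α} {c : ℝ}
    (h : ∀ F : Finset α, (F : Set α) ⊆ s → (F.card : ℝ) ≤ c) : s.Finite ∧ (s.ncard : ℝ) ≤ c := by
  have hfin : s.Finite := by
    by_contra hs
    obtain ⟨F, hF, hc⟩ := Set.Infinite.exists_subset_card_eq hs (⌊c⌋₊ + 1)
    have h1 := h F hF
    rw [hc] at h1
    have h2 := Nat.lt_floor_add_one c
    push_cast at h1
    linarith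
  refine ⟨hfin, ?_⟩
  rw [Set.ncard_eq_toFinset_card s hfin]
  exact h _ (by simp)

section

variable {S A : Type u} [Fintype S] [Fintype A] [Nonempty A] [MeasurableSpace S]
  [MeasurableSpace A] [MeasurableSingletonClass S] [MeasurableSingletonClass A]
  {M : MDP S A} {P : Params}

omit [Nonempty A] [MeasurableSpace S] [MeasurableSpace A] [MeasurableSingletonClass S]
  [MeasurableSingletonClass A] in
theorem Ghost.totalRisk_init_le (hP : P.Admissible) (hcard : 1 ≤ Fintype.card (S × A)) :
    (Ghost.init P : Ghost S A).totalRisk P ≤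
      2 * P.m * P.tail * (9 * (Fintype.card (S × A) : ℝ) ^ 2 * P.B / P.ε₁) := by
  have hb := Memory.bounded_init (S := S) (A := A) hP
  have hB := hP.one_le_B
  have hε := hP.ε₁_pos
  have hN : (1 : ℝ) ≤ Fintype.card (S × A) := Nat.one_le_cast.2 hcard
  set N : ℝ := ((Fintype.card (S × A) : ℕ) : ℝ) with hNdef
  have e1 : (Ghost.init P : Ghost S A).totalRisk P =
      P.risk 0 0 * ((Memory.init P : Memory S A).attemptsLeft P + N) := by
    have h1 : ∀ p, P.risk ((Ghost.init P : Ghost S A).mem.n p)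
        ((Ghost.init P : Ghost S A).deviation p) = P.risk 0 0 := by
      intro p
      simp [Ghost.deviation, Ghost.init, Memory.init]
    unfold Ghost.totalRisk
    rw [Finset.sum_congr rfl fun p _ => h1 p, Finset.sum_const, Finset.card_univ, nsmul_eq_mul]
    change P.risk 0 0 * (Memory.init P : Memory S A).attemptsLeft P + _ = _
    ring
  have h1 : ∑ p, (Memory.init P : Memory S A).failuresLeft p ≤ 2 * N := by
    refine (Finset.sum_le_card_nsmul _ _ 2 fun p _ => (Memory.failuresLeft_mem _ p).2).trans ?_
    rw [nsmul_eq_mul, mul_comm, hNdef]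
    rfl
  have h2 : ∑ p, (Memory.init P : Memory S A).Q' P p ≤ N * (2 * P.B) := by
    refine (Finset.sum_le_card_nsmul _ _ (2 * P.B) fun p _ => ?_).trans ?_
    · have h3 := hb.bonus_E_le hP p
      have h4 := hb.Q_le p
      unfold Memory.Q'
      linarith [hP.lam_le, hP.ε₁_lt]
    · rw [nsmul_eq_mul, hNdef]
      rfl
  have h3 : (Memory.init P : Memory S A).attemptsLeft P + N ≤ 9 * N ^ 2 * P.B / P.ε₁ := by
    unfold Memory.attemptsLeft
    have h4 := mul_le_mul_of_nonneg_left h2 (show 0 ≤ (1 + 2 * N) / P.ε₁ by positivity)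
    have h5 : (1 + 2 * N) / P.ε₁ * (N * (2 * P.B)) ≤ 6 * N ^ 2 * P.B / P.ε₁ := by
      rw [div_mul_eq_mul_div]
      refine div_le_div_of_nonneg_right ?_ hε.le
      have : (1 + 2 * N) * (N * (2 * P.B)) ≤ (3 * N) * (N * (2 * P.B)) :=
        mul_le_mul_of_nonneg_right (by linarith) (by positivity)
      linarith
    have h6 : 3 * N ≤ 3 * N ^ 2 * P.B / P.ε₁ := by
      rw [le_div_iff₀ hε]
      have h7 : N * P.ε₁ ≤ N * (N * P.B) :=
        mul_le_mul_of_nonneg_left (by nlinarith [hP.ε₁_lt]) (by linarith)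
      linarith
    have e2 : 9 * N ^ 2 * P.B / P.ε₁ = 6 * N ^ 2 * P.B / P.ε₁ + 3 * N ^ 2 * P.B / P.ε₁ := by ring
    linarith
  rw [e1, P.risk_zero]
  exact mul_le_mul_of_nonneg_left h3 (by have := P.tail_pos; positivity)

/-- On a stream with good samples, a timestep at which the policy is not `ε`-optimal has an excess of
at least `ε / 2`. -/
theorem MDP.excess_ge_of_mem_badTimes (hP : P.Admissible)
    {ε : ℝ} (hε : 10 * P.ε₁ * P.B = ε) (π : Policy S A) (x : Stream S A)
    (hx : ∀ n, x.hist n ∈ rewardGood S A 0 n) (hg : ∀ n, Ghost.Good M P (Ghost.run M P n (x.hist n)))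
    {t : ℕ} (ht : t ∈ M.badTimes π ε x) : ε / 2 ≤ M.excess π P t (x.hist t) := by
  have hb := (Ghost.bounded_run (M := M) hP t (x.hist t) (hx t)).mem
  have : Nonempty (Policy S A) := ⟨π⟩
  have h1 := M.optValue_le_of_backup_le (v := (Ghost.run M P t (x.hist t)).mem.V) hb.V_nonneg
    (fun s a => by
      have h2 := (hg t).residual_nonneg (s, a)
      unfold MDP.residual at h2
      linarith [(Ghost.run M P t (x.hist t)).mem.Q_le_V s a]) (x.state t)
  have h2 : M.value π t (x.hist t) < M.optValue (x.state t) - ε := ht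
  refine le_trans ?_ (le_max_right _ _)
  rw [Stream.state_hist]
  linarith

/-- Removing the scale `(1 - γ)²/3` from the exponent bounds `(1 - γ)/2` times the sum of the
excesses by the total cost, one last excess of at most `B`, and `3 B² log (2/δ)`. Each bad timestep
uses up `ε / 2` of that sum. -/
theorem MDP.badTimes_bound_of_good (hP : P.Admissible)
    {ε δ : ℝ} (hε : 10 * P.ε₁ * P.B = ε) (hδ : 0 < δ) (π : Policy S A) (x : Stream S A)
    (hx : ∀ n, x.hist n ∈ rewardGood S A 0 n) (hg : ∀ n, Ghost.Good M P (Ghost.run M P n (x.hist n)))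
    (hW : ∀ n, δ / 2 * Real.exp (M.logPotential π P n (x.hist n)) < 1) :
    (M.badTimes π ε x).Finite ∧ ((M.badTimes π ε x).ncard : ℝ) ≤
      4 * P.B / ε * (20 * Fintype.card (S × A) * P.m * P.B + P.B +
        3 * P.B ^ 2 * Real.log (2 / δ)) := by
  have hε₁ := hP.ε₁_pos
  have hB := hP.B_pos
  have hε0 : 0 < ε := by rw [← hε]; positivity
  set Y := 20 * (Fintype.card (S × A) : ℝ) * P.m * P.B + P.B + 3 * P.B ^ 2 * Real.log (2 / δ)
  have hsum : ∀ n, ∑ i ∈ Finset.range n, M.excess π P i (x.hist i) ≤ 2 * P.B * Y := by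
    intro n
    have h1 : M.logPotential π P n (x.hist n) < Real.log (2 / δ) := by
      rw [Real.lt_log_iff_exp_lt (by positivity), lt_div_iff₀ hδ]
      linarith [hW n]
    have h2 := (hg n).totalCost_le (Ghost.bounded_run (M := M) hP n (x.hist n) (hx n)) hP
    have h3 := MDP.excess_le (M := M) hP π n (x.hist n) (hx n)
    have h4 := mul_le_of_le_one_left (MDP.excess_nonneg (M := M) (P := P) π n (x.hist n))
      hP.γ_lt_one.le
    rw [MDP.logPotential, MDP.sumExcess_hist] at h1
    have e1 : (1 - P.γ) = 1 / P.B := by rw [Params.B, one_div_one_div]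
    rw [e1] at h1
    set T := ∑ i ∈ Finset.range n, M.excess π P i (x.hist i)
    set D := (Ghost.run M P n (x.hist n)).totalCost
    have h5 : 1 / P.B / 2 * T - D - P.γ * M.excess π P n (x.hist n) <
        3 * P.B ^ 2 * Real.log (2 / δ) := by
      have h6 := mul_lt_mul_of_pos_left h1 (show 0 < 3 * P.B ^ 2 by positivity)
      rw [← mul_assoc, show 3 * P.B ^ 2 * ((1 / P.B) ^ 2 / 3) = 1 by field_simp, one_mul] at h6
      exact h6
    have h7 : 1 / P.B / 2 * T ≤ Y := by
      change _ ≤ 20 * (Fintype.card (S × A) : ℝ) * P.m * P.B + P.B + _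
      linarith
    have e2 : T = 2 * P.B * (1 / P.B / 2 * T) := by field_simp
    rw [e2]
    exact mul_le_mul_of_nonneg_left h7 (by positivity)
  refine finite_and_ncard_le_of_forall_finset fun F hF => ?_
  have h1 : (F.card : ℝ) * (ε / 2) ≤ 2 * P.B * Y := by
    rw [← nsmul_eq_mul]
    refine (Finset.card_nsmul_le_sum F (fun i => M.excess π P i (x.hist i)) (ε / 2) fun i hi =>
      MDP.excess_ge_of_mem_badTimes hP hε π x hx hg (hF hi)).trans ?_
    refine le_trans ?_ (hsum (F.sup id + 1))
    refine Finset.sum_le_sum_of_subset_of_nonneg (fun i hi => ?_)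
      fun i _ _ => MDP.excess_nonneg π i _
    exact Finset.mem_range.2 (Nat.lt_succ_of_le (Finset.le_sup (f := id) hi))
  rw [div_mul_eq_mul_div, le_div_iff₀ hε0]
  linarith

/-- The bound on the number of timesteps at which the policy is not `ε`-optimal, in terms of the
inputs of the algorithm. -/
theorem MDP.law_badTimes_ge (hP : P.Admissible) (hM : M.γ = P.γ) {ε δ : ℝ}
    (hε : 10 * P.ε₁ * P.B = ε) (hδ : 0 < δ) (π : Policy S A) (hπ : IsDirectedDelayedQ P π)
    (hr : 2 * P.m * P.tail * (9 * (Fintype.card (S × A) : ℝ) ^ 2 * P.B / P.ε₁) ≤ δ / 2) (s₀ : S) :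
    ENNReal.ofReal (1 - δ) ≤ M.law π 0 (Hist.init s₀)
      {x | (M.badTimes π ε x).Finite ∧ ((M.badTimes π ε x).ncard : ℝ) ≤
        4 * P.B / ε * (20 * Fintype.card (S × A) * P.m * P.B + P.B +
          3 * P.B ^ 2 * Real.log (2 / δ))} := by
  set T := {x : Stream S A | (M.badTimes π ε x).Finite ∧ ((M.badTimes π ε x).ncard : ℝ) ≤
        4 * P.B / ε * (20 * Fintype.card (S × A) * P.m * P.B + P.B +
          3 * P.B ^ 2 * Real.log (2 / δ))}
  set μ := M.law π 0 (Hist.init s₀)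
  have : Nonempty S := ⟨s₀⟩
  have hgood := M.ae_hist_mem_rewardGood π 0 (Hist.init s₀)
  have hmem : (Hist.init s₀ : Hist S A 0) ∈ rewardGood S A 0 0 := Set.mem_univ _
  have hU := M.ville π (rewardGood S A 0) (M.ae_snoc_mem_rewardGood π 0) (Ghost.riskBound M P)
    (Ghost.measurable_riskBound M P)
    (fun n h hh => Ghost.lintegral_riskBound_le hP hM π n h hh) 0 (Hist.init s₀) hmem
  have hU0 : Ghost.riskBound M P 0 (Hist.init s₀) ≤ ENNReal.ofReal (δ / 2) :=
    ENNReal.ofReal_le_ofReal ((Ghost.totalRisk_init_le hP Fintype.card_pos).trans hr)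
  -- With the factor `δ / 2`, reaching one means that the exponential reaches `2 / δ`; the initial
  -- exponent is nonpositive.
  have hW := M.ville π (rewardGood S A 0) (M.ae_snoc_mem_rewardGood π 0)
    (fun n h => ENNReal.ofReal (δ / 2) * ENNReal.ofReal (Real.exp (M.logPotential π P n h)))
    (fun n => (ENNReal.measurable_ofReal.comp
      (Real.measurable_exp.comp (M.measurable_logPotential π P n))).const_mul _)
    (fun n h hh => by
      rw [lintegral_const_mul (f := fun y => ENNReal.ofReal
        (Real.exp (M.logPotential π P (n + 1) (h.snoc y)))) _
        (ENNReal.measurable_ofReal.comp (Real.measurable_exp.comp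
        ((M.measurable_logPotential π P (n + 1)).comp h.measurable_snoc_right)))]
      exact mul_le_mul_right (MDP.lintegral_exp_logPotential_le hP hM π hπ n h hh) _)
    0 (Hist.init s₀) hmem
  have hW0 : ENNReal.ofReal (δ / 2) *
      ENNReal.ofReal (Real.exp (M.logPotential π P 0 (Hist.init s₀))) ≤ ENNReal.ofReal (δ / 2) := by
    refine mul_le_of_le_one_right zero_le ?_
    rw [ENNReal.ofReal_le_one, Real.exp_le_one_iff]
    have h1 := mul_nonneg hP.γ_nonneg
      (MDP.excess_nonneg (M := M) (P := P) π 0 (Hist.init s₀))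
    have h2 : (Ghost.run M P 0 (Hist.init s₀ : Hist S A 0)).totalCost = 0 := by
      simp [Ghost.run, Ghost.init, Ghost.totalCost]
    rw [MDP.logPotential, MDP.sumExcess, h2]
    exact mul_nonpos_of_nonneg_of_nonpos (by positivity) (by linarith)
  set U1 := {x : Stream S A | ∃ k, 1 ≤ Ghost.riskBound M P k (x.hist k)}
  set U2 := {x : Stream S A | ∃ k, 1 ≤ ENNReal.ofReal (δ / 2) *
    ENNReal.ofReal (Real.exp (M.logPotential π P k (x.hist k)))}
  have hU1 : μ U1 ≤ ENNReal.ofReal (δ / 2) := by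
    refine (measure_mono ?_).trans (hU.trans hU0)
    rintro x ⟨k, hk⟩
    exact ⟨k, by rwa [Nat.zero_add]⟩
  have hU2 : μ U2 ≤ ENNReal.ofReal (δ / 2) := by
    refine (measure_mono ?_).trans (hW.trans hW0)
    rintro x ⟨k, hk⟩
    exact ⟨k, by rwa [Nat.zero_add]⟩
  -- Covering the space and using subadditivity needs no measurability of `T`, `U1` or `U2`.
  have hsub : μ Set.univ ≤ μ (T ∪ (U1 ∪ U2)) := by
    refine measure_mono_ae ?_
    filter_upwards [hgood] with x hx' _
    have hx : ∀ n, x.hist n ∈ rewardGood S A 0 n := fun n => by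
      have := hx' n
      rwa [Nat.zero_add] at this
    by_cases h1 : x ∈ U1
    · exact Or.inr (Or.inl h1)
    by_cases h2 : x ∈ U2
    · exact Or.inr (Or.inr h2)
    left
    have h1' : ∀ k, Ghost.riskBound M P k (x.hist k) < 1 := by
      intro k
      by_contra h3
      exact h1 ⟨k, not_lt.1 h3⟩
    refine MDP.badTimes_bound_of_good hP hε hδ π x hx
      (Ghost.good_run hP hM x hx h1') fun k => ?_
    by_contra h3
    refine h2 ⟨k, ?_⟩
    rw [← ENNReal.ofReal_mul (by positivity), ← ENNReal.ofReal_one]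
    exact ENNReal.ofReal_le_ofReal (not_lt.1 h3)
  rw [measure_univ] at hsub
  have h3 : (1 : ENNReal) ≤ μ T + ENNReal.ofReal δ := by
    refine hsub.trans ((measure_union_le _ _).trans (add_le_add le_rfl ?_))
    refine (measure_union_le _ _).trans ?_
    refine (add_le_add hU1 hU2).trans_eq ?_
    rw [← ENNReal.ofReal_add (by positivity) (by positivity), add_halves]
  rw [ENNReal.ofReal_sub _ hδ.le, ENNReal.ofReal_one]
  exact tsub_le_iff_right.2 h3

omit [Fintype S] [Fintype A] [Nonempty A] [MeasurableSingletonClass S]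
  [MeasurableSingletonClass A] in
theorem MDP.badTimes_eq_empty {ε : ℝ} (hε : 1 / (1 - M.γ) ≤ ε) (π : Policy S A) (x : Stream S A) :
    M.badTimes π ε x = ∅ := by
  refine Set.eq_empty_iff_forall_notMem.2 fun t ht => ?_
  have : Nonempty (Policy S A) := ⟨π⟩
  have h1 : M.optValue (x.state t) ≤ 1 / (1 - M.γ) :=
    ciSup_le fun π' => M.value_le π' 0 (Hist.init (x.state t))
  have h2 : M.value π t (x.hist t) < M.optValue (x.state t) - ε := ht
  linarith [M.value_nonneg π t (x.hist t)]

end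

/-! ### Choice of the number of samples and arithmetic of the constants. -/

/-- The logarithmic factor of the number of samples of an attempted update, for `n` state-action
pairs, the horizon `B = 1 / (1 - γ)`, the accuracy `x = ε (1 - γ)` and the confidence `1 - δ`. -/
def confidenceLog (n B x δ : ℝ) : ℝ := Real.log (72000 * n ^ 2 * B ^ 3 / (x ^ 3 * δ))

/-- The number of samples of an attempted update. -/
def sampleSize (n B x δ : ℝ) : ℕ := ⌈100 * confidenceLog n B x δ * B ^ 2 / x ^ 2⌉₊

section

variable {n B x δ : ℝ} (hn : 1 ≤ n) (hB : 1 ≤ B) (hx : 0 < x) (hx1 : x < 1) (hδ : 0 < δ)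
  (hδ1 : δ < 1)
include hn hB hx hx1 hδ hδ1

theorem one_le_confidenceLog : 1 ≤ confidenceLog n B x δ := by
  unfold confidenceLog
  rw [Real.le_log_iff_exp_le (by positivity), le_div_iff₀ (by positivity)]
  have h1 : x ^ 3 * δ ≤ 1 := mul_le_one₀ (pow_le_one₀ hx.le hx1.le) hδ.le hδ1.le
  have h2 : 1 ≤ n ^ 2 * B ^ 3 := one_le_mul_of_one_le_of_one_le (one_le_pow₀ hn) (one_le_pow₀ hB)
  have h3 := mul_le_mul Real.exp_one_lt_d9.le h1 (by positivity) (by norm_num)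
  linarith

theorem sampleSize_le :
    (sampleSize n B x δ : ℝ) ≤ 200 * confidenceLog n B x δ * B ^ 2 / x ^ 2 := by
  have hL := one_le_confidenceLog hn hB hx hx1 hδ hδ1
  have h1 : 1 ≤ 100 * confidenceLog n B x δ * B ^ 2 / x ^ 2 := by
    rw [one_le_div₀ (by positivity)]
    have h2 : x ^ 2 ≤ 1 := pow_le_one₀ hx.le hx1.le
    have h3 : 1 ≤ confidenceLog n B x δ * B ^ 2 :=
      one_le_mul_of_one_le_of_one_le hL (one_le_pow₀ hB)
    linarith
  refine (Nat.ceil_lt_add_one (by linarith)).le.trans ?_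
  have e : 200 * confidenceLog n B x δ * B ^ 2 / x ^ 2 =
      100 * confidenceLog n B x δ * B ^ 2 / x ^ 2 + 100 * confidenceLog n B x δ * B ^ 2 / x ^ 2 := by
    ring
  linarith

/-- With `ε₁ = x / 10` the sample size gives `ρ² / B² ≥ L` for `L = confidenceLog n B x δ`, so the
tail is at most `exp (-2 L)`. One factor `exp (-L)` absorbs the `L` contained in the sample size;
the other cancels the polynomial factors, and `72000 = 2 · 400 · 90` leaves `δ / 2`. -/
theorem failure_probability_le :
    2 * (sampleSize n B x δ : ℝ) * Real.exp (-(2 * ((x / 10) ^ 2 * sampleSize n B x δ) / B ^ 2)) *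
      (9 * n ^ 2 * B / (x / 10)) ≤ δ / 2 := by
  have hL := one_le_confidenceLog hn hB hx hx1 hδ hδ1
  have hm := sampleSize_le hn hB hx hx1 hδ hδ1
  have hm' : 100 * confidenceLog n B x δ * B ^ 2 / x ^ 2 ≤ sampleSize n B x δ := Nat.le_ceil _
  have hexp : Real.exp (-confidenceLog n B x δ) = x ^ 3 * δ / (72000 * n ^ 2 * B ^ 3) := by
    rw [Real.exp_neg, confidenceLog, Real.exp_log (by positivity), inv_div]
  set L := confidenceLog n B x δ
  set m : ℝ := (sampleSize n B x δ : ℝ)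
  have h1 : Real.exp (-(2 * ((x / 10) ^ 2 * m) / B ^ 2)) ≤ Real.exp (-L) * Real.exp (-L) := by
    rw [← Real.exp_add, Real.exp_le_exp]
    have h2 : L ≤ (x / 10) ^ 2 * m / B ^ 2 := by
      rw [le_div_iff₀ (by positivity)]
      rw [div_le_iff₀ (by positivity)] at hm'
      nlinarith
    rw [mul_div_assoc]
    linarith
  have h2 : L * Real.exp (-L) ≤ 1 := by
    rw [Real.exp_neg, ← div_eq_mul_inv, div_le_one (Real.exp_pos _)]
    linarith [Real.add_one_le_exp L]
  have h3 : 2 * m * Real.exp (-(2 * ((x / 10) ^ 2 * m) / B ^ 2)) ≤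
      400 * B ^ 2 / x ^ 2 * Real.exp (-L) := by
    calc 2 * m * Real.exp (-(2 * ((x / 10) ^ 2 * m) / B ^ 2))
        ≤ 2 * (200 * L * B ^ 2 / x ^ 2) * (Real.exp (-L) * Real.exp (-L)) := by gcongr
      _ = 400 * B ^ 2 / x ^ 2 * Real.exp (-L) * (L * Real.exp (-L)) := by ring
      _ ≤ _ := mul_le_of_le_one_right (by positivity) h2
  refine (mul_le_mul_of_nonneg_right h3 (by positivity)).trans_eq ?_
  rw [hexp]
  field_simp
  norm_num

/-- The argument of the logarithm is at most `72000 (n / (δ x))³ B³`. The crude `log B ≤ B` costs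
one factor `B`, for which the final `B ^ 4` has room. -/
theorem confidenceLog_le :
    confidenceLog n B x δ ≤ 18 * B * max 1 (Real.log (n / (δ * x))) := by
  have hx3 : 72000 * n ^ 2 * B ^ 3 / (x ^ 3 * δ) ≤ 72000 * ((n / (δ * x)) ^ 3 * B ^ 3) := by
    rw [div_pow, div_mul_eq_mul_div, ← mul_div_assoc, div_le_div_iff₀ (by positivity) (by positivity)]
    have h1 : δ ^ 2 ≤ n := (pow_le_one₀ hδ.le hδ1.le).trans hn
    have h2 := mul_le_mul_of_nonneg_left h1 (show 0 ≤ 72000 * n ^ 2 * B ^ 3 * (x ^ 3 * δ) by positivity)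
    linarith
  have hlog : Real.log 72000 ≤ 12 := by
    rw [Real.log_le_iff_le_exp (by norm_num)]
    have h1 : (2.7 : ℝ) ^ 12 ≤ Real.exp 1 ^ 12 :=
      pow_le_pow_left₀ (by norm_num) (by linarith [Real.exp_one_gt_d9]) 12
    rw [← Real.exp_nat_mul] at h1
    norm_num at h1 ⊢
    linarith
  have h1 := Real.log_le_log (by positivity) hx3
  rw [Real.log_mul (by norm_num) (by positivity), Real.log_mul (by positivity) (by positivity),
    Real.log_pow, Real.log_pow] at h1
  have h2 : Real.log B ≤ B := Real.log_le_self (by linarith)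
  have h3 : Real.log (n / (δ * x)) ≤ max 1 (Real.log (n / (δ * x))) := le_max_right _ _
  have h4 : 1 ≤ max 1 (Real.log (n / (δ * x))) := le_max_left _ _
  unfold confidenceLog
  set Λ := max 1 (Real.log (n / (δ * x)))
  push_cast at h1
  nlinarith [mul_nonneg (sub_nonneg.2 hB) (sub_nonneg.2 h4)]

/-- The leading term has order `n B⁴ Λ / x³`, where `Λ` is the last logarithmic factor, so a factor
`1 / x` is to spare; of the other logarithms only the one of `1 / δ` is used, for `log (2 / δ)`. The
constant is `4 · 75000`. -/
theorem timesteps_bound_le :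
    4 / x * (20 * n * sampleSize n B x δ * B + B + 3 * B ^ 2 * Real.log (2 / δ)) ≤
      300000 * (n * B ^ 4 / x ^ 4 * max 1 (Real.log (1 / δ)) * max 1 (Real.log (1 / x)) *
        max 1 (Real.log (n / (δ * x)))) := by
  have hm := sampleSize_le hn hB hx hx1 hδ hδ1
  have hL := confidenceLog_le hn hB hx hx1 hδ hδ1
  have hlog : Real.log (2 / δ) ≤ 2 * max 1 (Real.log (1 / δ)) := by
    rw [show (2 : ℝ) / δ = 2 * (1 / δ) by ring, Real.log_mul (by norm_num) (by positivity)]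
    linarith [Real.log_two_lt_d9, le_max_left 1 (Real.log (1 / δ)),
      le_max_right 1 (Real.log (1 / δ))]
  have hD : 1 ≤ max 1 (Real.log (1 / δ)) := le_max_left _ _
  have hX : 1 ≤ max 1 (Real.log (1 / x)) := le_max_left _ _
  have hΛ : 1 ≤ max 1 (Real.log (n / (δ * x))) := le_max_left _ _
  set D := max 1 (Real.log (1 / δ))
  set X := max 1 (Real.log (1 / x))
  set Λ := max 1 (Real.log (n / (δ * x)))
  set m : ℝ := (sampleSize n B x δ : ℝ)
  have h1 : 20 * n * m * B ≤ 72000 * (n * B ^ 4 / x ^ 3 * (D * X * Λ)) := by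
    calc 20 * n * m * B ≤ 20 * n * (200 * (18 * B * Λ) * B ^ 2 / x ^ 2) * B := by
          gcongr
          exact hm.trans (by gcongr)
      _ = 72000 * (n * B ^ 4 / x ^ 3 * (x * Λ)) := by field_simp; norm_num
      _ ≤ _ := by
          gcongr
          exact hx1.le.trans (one_le_mul_of_one_le_of_one_le hD hX)
  have h2 : B + 3 * B ^ 2 * Real.log (2 / δ) ≤ 7 * (n * B ^ 4 / x ^ 3 * (D * X * Λ)) := by
    have h3 : B ≤ B ^ 4 * D := by
      have := one_le_mul_of_one_le_of_one_le (one_le_pow₀ hB : 1 ≤ B ^ 3) hD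
      nlinarith
    have h4 : B ^ 2 * Real.log (2 / δ) ≤ B ^ 4 * (2 * D) := by
      refine mul_le_mul (pow_le_pow_right₀ hB (by norm_num)) hlog
        (Real.log_nonneg ?_) (by positivity)
      rw [le_div_iff₀ hδ]
      linarith
    have h5 : 1 ≤ n / x ^ 3 := by
      rw [one_le_div₀ (by positivity)]
      exact (pow_le_one₀ hx.le hx1.le).trans hn
    have h6 : B ^ 4 * D ≤ B ^ 4 * D * (n / x ^ 3 * (X * Λ)) :=
      le_mul_of_one_le_right (by positivity)
        (one_le_mul_of_one_le_of_one_le h5 (one_le_mul_of_one_le_of_one_le hX hΛ))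
    have e : n * B ^ 4 / x ^ 3 * (D * X * Λ) = B ^ 4 * D * (n / x ^ 3 * (X * Λ)) := by ring
    rw [e]
    linarith
  have h3 : 20 * n * m * B + B + 3 * B ^ 2 * Real.log (2 / δ) ≤
      75000 * (n * B ^ 4 / x ^ 3 * (D * X * Λ)) := by
    have : 0 ≤ n * B ^ 4 / x ^ 3 * (D * X * Λ) := by positivity
    linarith
  refine (mul_le_mul_of_nonneg_left h3 (by positivity)).trans_eq ?_
  field_simp
  norm_num

end

end RL

end

/-! ### Assembly. -/

theorem theorem1 :
    ∃ C : ℝ, 0 < C ∧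
      ∀ (nS nA : ℕ) (γ ε δ : ℝ), 0 ≤ γ → γ < 1 → 0 < ε → 0 < δ →
      ∃ (ε₁ : ℝ) (m : ℕ), 0 < ε₁ ∧ ε₁ < 1 / 2 ∧ 0 < m ∧
      ∀ lam γE : ℝ, 0 < lam → lam ≤ ε₁ → 0 < γE → γE < 1 →
      ∀ (S A : Type u) [Fintype S] [Fintype A] [Nonempty A]
        [MeasurableSpace S] [MeasurableSingletonClass S]
        [MeasurableSpace A] [MeasurableSingletonClass A],
        Fintype.card S = nS → Fintype.card A = nA →
      ∀ M : RL.MDP S A, M.γ = γ →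
      ∀ π : RL.Policy S A,
        RL.IsDirectedDelayedQ
          { γ := γ, ε₁ := ε₁, m := m, lam := lam, ρ := ε₁ * √(m : ℝ), γE := γE, η := 1 - ε₁ } π →
      ∀ s₀ : S,
        ENNReal.ofReal (1 - δ) ≤
          M.law π 0 (RL.Hist.init s₀)
            {x | (M.badTimes π ε x).Finite ∧
              ((M.badTimes π ε x).ncard : ℝ) ≤
                C * ((nS * nA : ℝ) / (ε ^ 4 * (1 - γ) ^ 8) *
                  max 1 (Real.log (1 / δ)) *
                  max 1 (Real.log (1 / (ε * (1 - γ)))) *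
                  max 1 (Real.log ((nS * nA : ℝ) / (δ * (ε * (1 - γ))))))} := by
  refine ⟨300000, by norm_num, fun nS nA γ ε δ hγ hγ1 hε hδ => ?_⟩
  have hγ' : 0 < 1 - γ := by linarith
  -- Otherwise the claim is trivial: `δ ≥ 1` asks for nothing, no pairs contradict the initial state
  -- and the nonempty action set, and `ε ≥ 1 / (1 - γ)` exceeds every possible loss.
  by_cases hmain : δ < 1 ∧ ε * (1 - γ) < 1 ∧ 1 ≤ nS * nA
  · obtain ⟨hδ1, hx1, hn⟩ := hmain
    have hn1 : (1 : ℝ) ≤ nS * nA := by exact_mod_cast hn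
    have hx : 0 < ε * (1 - γ) := by positivity
    have hB : 1 ≤ 1 / (1 - γ) := by rw [one_le_div₀ hγ']; linarith
    have hm : 0 < RL.sampleSize (nS * nA) (1 / (1 - γ)) (ε * (1 - γ)) δ := by
      have := RL.one_le_confidenceLog hn1 hB hx hx1 hδ hδ1
      exact Nat.ceil_pos.2 (by positivity)
    have hfail := RL.failure_probability_le hn1 hB hx hx1 hδ hδ1
    have hbound := RL.timesteps_bound_le hn1 hB hx hx1 hδ hδ1
    -- This `ε₁` satisfies `10 ε₁ B = ε`, so the tolerance `5 ε₁ B` is exactly `ε / 2`.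
    refine ⟨ε * (1 - γ) / 10, RL.sampleSize (nS * nA) (1 / (1 - γ)) (ε * (1 - γ)) δ,
      by positivity, by linarith, hm, ?_⟩
    intro lam γE hlam hlam' hγE hγE' S A _ _ _ _ _ _ _ hS hA M hM π hπ s₀
    have hcard : (Fintype.card (S × A) : ℝ) = nS * nA := by
      rw [Fintype.card_prod, hS, hA, Nat.cast_mul]
    refine (RL.MDP.law_badTimes_ge (M := M)
      (P := { γ := γ, ε₁ := ε * (1 - γ) / 10,
              m := RL.sampleSize (nS * nA) (1 / (1 - γ)) (ε * (1 - γ)) δ, lam := lam,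
              ρ := ε * (1 - γ) / 10 *
                √(RL.sampleSize (nS * nA) (1 / (1 - γ)) (ε * (1 - γ)) δ : ℝ),
              γE := γE, η := 1 - ε * (1 - γ) / 10 })
      ⟨hγ, hγ1, by positivity, by change ε * (1 - γ) / 10 < 1 / 2; linarith, hm, hlam, hlam',
        hγE, hγE', rfl, rfl⟩ hM ?_ hδ π hπ ?_ s₀).trans
      (measure_mono fun x hx' => ⟨hx'.1, hx'.2.trans ?_⟩)
    · simp only [RL.Params.B]
      field_simp
    · rw [RL.Params.tail, hcard]
      simp only [RL.Params.B, mul_pow, Real.sq_sqrt (Nat.cast_nonneg _)] at hfail ⊢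
      exact hfail
    · rw [hcard]
      simp only [RL.Params.B]
      have e1 : 4 * (1 / (1 - γ)) / ε = 4 / (ε * (1 - γ)) := by field_simp
      have e2 : (nS * nA : ℝ) / (ε ^ 4 * (1 - γ) ^ 8) =
          nS * nA * (1 / (1 - γ)) ^ 4 / (ε * (1 - γ)) ^ 4 := by field_simp
      rw [e1, e2]
      exact hbound
  -- In the trivial cases any admissible inputs serve.
  · refine ⟨1 / 4, 1, by norm_num, by norm_num, one_pos, ?_⟩
    intro lam γE _ _ _ _ S A _ _ _ _ _ _ _ hS hA M hM π _ s₀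
    rcases le_or_gt 1 δ with hδ1 | hδ1
    · rw [ENNReal.ofReal_of_nonpos (by linarith)]
      exact zero_le
    have : Nonempty S := ⟨s₀⟩
    have hn : 1 ≤ nS * nA := by
      rw [← hS, ← hA]
      exact Nat.mul_pos Fintype.card_pos Fintype.card_pos
    have hx1 : 1 ≤ ε * (1 - γ) := by
      by_contra h
      exact hmain ⟨hδ1, not_le.1 h, hn⟩
    have hbad : ∀ x, M.badTimes π ε x = ∅ := fun x =>
      RL.MDP.badTimes_eq_empty (by rw [hM, div_le_iff₀ hγ']; exact hx1) π x
    have huniv : M.law π 0 (RL.Hist.init s₀) Set.univ ≤ M.law π 0 (RL.Hist.init s₀)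
        {x | (M.badTimes π ε x).Finite ∧ ((M.badTimes π ε x).ncard : ℝ) ≤
          300000 * ((nS * nA : ℝ) / (ε ^ 4 * (1 - γ) ^ 8) * max 1 (Real.log (1 / δ)) *
            max 1 (Real.log (1 / (ε * (1 - γ)))) *
            max 1 (Real.log ((nS * nA : ℝ) / (δ * (ε * (1 - γ))))))} := by
      refine measure_mono fun x _ => ⟨by rw [hbad]; exact Set.finite_empty, ?_⟩
      rw [hbad, Set.ncard_empty, Nat.cast_zero]
      positivity
    refine le_trans ?_ huniv
    rw [measure_univ]
    exact ENNReal.ofReal_le_one.2 (by linarith)
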